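/- **Conventions.** Algorithms are programs for a random-access machine with unit-cost addition, truncated subtraction, indirect memory access, zero tests and loops (hence polynomially equivalent to Turing machines); randomized algorithms may in addition flip fair coins, one per step. The running time of a randomized algorithm on an input is its expected number of steps over its own coin flips. For $0\le\kappa\le N$, let $\mathcal G(N,\tfrac12)$ be the Erdős–Rényi distribution on graphs with vertex set $[N]$, and let $\mathcal G(N,\tfrac12,\kappa)$ be the distribution obtained by sampling from $\mathcal G(N,\tfrac12)$ and turning an independent uniformly random set of $\kappa$ vertices into a clique. **Strongish Planted Clique Hypothesis.** There is $\delta\in(0,1)$ such that no randomized algorithm $\mathbb A$ whose running time on every $N$-vertex graph (given by its adjacency matrix) is at most $N^{o(\log N)}$ satisfies, for all sufficiently large $N$, both $$\Pr_{G\sim\mathcal G(N,1/2,\lceil N^\delta\rceil)}[\mathbb A(G)=1]\ge \tfrac23\qquad\text{and}\qquad \Pr_{G\sim\mathcal G(N,1/2)}[\mathbb A(G)=1]\le\tfrac13 ,$$ where the probabilities are over $G$ and the coin flips of $\mathbb A$. **Dimensions.** Let $X$ be a finite set and $\mathcal C\subseteq\{0,1\}^X$ a non-empty concept class. The VC dimension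 of $\mathcal C$ is the largest size of a set $S\subseteq X$ such that the restrictions to $S$ of the concepts in $\mathcal C$ are all the functions $S\to\{0,1\}$. Littlestone's dimension of $\mathcal C$ is the minimum, over all deterministic online learners, of the maximum number of wrong predictions that the learner makes on a sequence $(x_1,y_1),\dots,(x_T,y_T)$ with distinct $x_i\in X$ for which some $c\in\mathcal C$ has $c(x_i)=y_i$ for all $i$; here the learner predicts $y_i$ from $(x_1,y_1),\dots,(x_{i-1},y_{i-1})$ and $x_i$. **Approximation.** The class is given explicitly as a binary $|X|\times|\mathcal C|$ matrix ($X\neq\emptyset$) whose distinct columns are its concepts; $n=|X|\cdot|\mathcal C|$ is the input size. For $\alpha:\mathbb N\to\mathbb R$, a polynomial-time $\alpha(n)$-approximation algorithm for a dimension is a deterministic algorithm that, on every such input, halts within a number of steps polynomial in $n$ and outputs a natural number $v$ with $v\le\mathrm{OPT}\le\alpha(n)\,v$, where $\mathrm{OPT}$ is the dimension of the given class. **Theorem.** Assume the Strongish Planted Clique Hypothesis. Let $\alpha:\mathbb N\to\mathbb R$ be any function with $\alpha(n)=o(\log n)$. Then there is no polynomial-time $\alpha(n)$-approximation algorithm for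 VC dimension, and there is no polynomial-time $\alpha(n)$-approximation algorithm for Littlestone's dimension. -/

import Mathlib

open Filter Asymptotics MeasureTheory
open scoped ENNReal

/-! ### Algorithms: randomized random-access machines with a step count

An algorithm is a structured program for a random-access machine with registers and an
indirectly addressed memory, both holding natural numbers. The only arithmetic operations
are addition and truncated subtraction, so that unit-cost time is polynomially related to
Turing-machine time. -/

namespace RAM

/-- The state of the machine; `coins` is the number of coin flips made so far. -/
structure State where
  reg : ℕ → ℕ
  mem : ℕ → ℕ
  coins : ℕ

/-- Write `v` into register `i`. -/
def State.setReg (s : State) (i v : ℕ) : State :=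
  { s with reg := Function.update s.reg i v }

/-- Write `v` into memory cell `a`. -/
def State.setMem (s : State) (a v : ℕ) : State :=
  { s with mem := Function.update s.mem a v }

/-- Programs. Writing `R` for the registers and `M` for the memory:
`const i k` is `R[i] := k`; `add i j k` is `R[i] := R[j] + R[k]`;
`sub i j k` is `R[i] := R[j] - R[k]` (truncated at `0`);
`load i j` is `R[i] := M[R[j]]`; `store i j` is `M[R[i]] := R[j]`;
`flip i` puts a fair coin flip into `R[i]`; `ifZero i p q` runs `p` if `R[i] = 0` and `q`
otherwise; `loop i p` repeats `p` as long as `R[i] ≠ 0`. -/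
inductive Prog where
  | const (i k : ℕ)
  | add (i j k : ℕ)
  | sub (i j k : ℕ)
  | load (i j : ℕ)
  | store (i j : ℕ)
  | flip (i : ℕ)
  | seq (p q : Prog)
  | ifZero (i : ℕ) (p q : Prog)
  | loop (i : ℕ) (p : Prog)

/-- A deterministic program: one without coin flips. -/
def Prog.CoinFree : Prog → Prop
  | .flip _ => False
  | .seq p q => p.CoinFree ∧ q.CoinFree
  | .ifZero _ p q => p.CoinFree ∧ q.CoinFree
  | .loop _ p => p.CoinFree
  | _ => True

/-- `Exec ω p s t s'`: when the results of the coin flips are `ω 0, ω 1, …`, the program `p`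
started in state `s` halts after exactly `t` steps in state `s'`. Every elementary instruction
and every test costs one step. -/
inductive Exec (ω : ℕ → Bool) : Prog → State → ℕ → State → Prop
  | const (i k : ℕ) (s : State) : Exec ω (.const i k) s 1 (s.setReg i k)
  | add (i j k : ℕ) (s : State) : Exec ω (.add i j k) s 1 (s.setReg i (s.reg j + s.reg k))
  | sub (i j k : ℕ) (s : State) : Exec ω (.sub i j k) s 1 (s.setReg i (s.reg j - s.reg k))
  | load (i j : ℕ) (s : State) : Exec ω (.load i j) s 1 (s.setReg i (s.mem (s.reg j)))
  | store (i j : ℕ) (s : State) : Exec ω (.store i j) s 1 (s.setMem (s.reg i) (s.reg j))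
  | flip (i : ℕ) (s : State) :
      Exec ω (.flip i) s 1
        { s.setReg i (if ω s.coins = true then 1 else 0) with coins := s.coins + 1 }
  | seq {p q : Prog} {s s' s'' : State} {t t' : ℕ} :
      Exec ω p s t s' → Exec ω q s' t' s'' → Exec ω (.seq p q) s (t + t') s''
  | ifZero_pos {i : ℕ} {p q : Prog} {s s' : State} {t : ℕ} :
      s.reg i = 0 → Exec ω p s t s' → Exec ω (.ifZero i p q) s (t + 1) s'
  | ifZero_neg {i : ℕ} {p q : Prog} {s s' : State} {t : ℕ} :
      s.reg i ≠ 0 → Exec ω q s t s' → Exec ω (.ifZero i p q) s (t + 1) s'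
  | loop_done {i : ℕ} {p : Prog} {s : State} :
      s.reg i = 0 → Exec ω (.loop i p) s 1 s
  | loop_step {i : ℕ} {p : Prog} {s s' s'' : State} {t t' : ℕ} :
      s.reg i ≠ 0 → Exec ω p s t s' → Exec ω (.loop i p) s' t' s'' →
        Exec ω (.loop i p) s (t + 1 + t') s''

open Classical in
/-- The initial state on an `r × c` zero-one matrix `E`: registers `0` and `1` hold `r` and `c`,
the memory holds the matrix row by row, and everything else is `0`. -/
noncomputable def inputState (r c : ℕ) (E : Fin r → Fin c → Prop) : State where
  reg i := if i = 0 then r else if i = 1 then c else 0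
  mem a := if ∃ (i : Fin r) (j : Fin c), a = i * c + j ∧ E i j then 1 else 0
  coins := 0

/-- The law of an infinite sequence of independent fair coin flips. -/
noncomputable def coinLaw : Measure (ℕ → Bool) :=
  Measure.infinitePi fun _ : ℕ => (PMF.uniformOfFintype Bool).toMeasure

/-- The running time for given coin flips (`∞` if the program does not halt). -/
noncomputable def runTime (P : Prog) (s : State) (ω : ℕ → Bool) : ℝ≥0∞ :=
  ⨅ (t : ℕ) (s' : State) (_ : Exec ω P s t s'), (t : ℝ≥0∞)

/-- The expected running time over the coin flips of the program. -/
noncomputable def expectedTime (P : Prog) (s : State) : ℝ≥0∞ :=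
  ∫⁻ ω, runTime P s ω ∂coinLaw

/-- The probability over the coin flips that the program halts with output `1`;
the output is the final content of register `0`. -/
noncomputable def acceptProb (P : Prog) (s : State) : ℝ≥0∞ :=
  coinLaw {ω | ∃ (t : ℕ) (s' : State), Exec ω P s t s' ∧ s'.reg 0 = 1}

end RAM

/-! ### The Strongish Planted Clique Hypothesis -/

namespace PlantedClique

/-- The complete graph on the vertex set `S` (and no other edges). -/
def cliqueOn {V : Type*} (S : Finset V) : SimpleGraph V :=
  SimpleGraph.fromRel fun a b => a ∈ S ∧ b ∈ S

/-- The probability `1 / 2`. -/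
noncomputable def half : unitInterval := ⟨1 / 2, by norm_num, by norm_num⟩

/-- The Erdős–Rényi distribution `G(N, 1/2)`. -/
noncomputable def null (N : ℕ) : Measure (SimpleGraph (Fin N)) :=
  SimpleGraph.binomialRandom (Fin N) half

/-- The distribution `G(N, 1/2, κ)` for `κ ≤ N`: sample from `G(N, 1/2)` and turn a uniformly
random set of `κ` vertices, chosen independently, into a clique. -/
noncomputable def planted (N κ : ℕ) : Measure (SimpleGraph (Fin N)) :=
  ((N.choose κ : ℕ) : ℝ≥0∞)⁻¹ •
    ∑ S ∈ (Finset.univ : Finset (Fin N)).powersetCard κ,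
      (null N).map fun G => G ⊔ cliqueOn S

/-- The input given to an algorithm: the adjacency matrix of the graph. -/
noncomputable def graphInput {N : ℕ} (G : SimpleGraph (Fin N)) : RAM.State :=
  RAM.inputState N N G.Adj

/-- For some `δ ∈ (0, 1)`, no randomized algorithm with running time `N ^ o(log N)`
tells, for all large `N`, `G(N, 1/2, ⌈N ^ δ⌉)` from `G(N, 1/2)`. -/
def StrongishHypothesis : Prop :=
  ∃ δ : ℝ, 0 < δ ∧ δ < 1 ∧
    ¬ ∃ (P : RAM.Prog) (f : ℕ → ℝ),
      f =o[atTop] (fun N : ℕ => Real.log N) ∧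
      ∀ᶠ N : ℕ in atTop,
        (∀ G : SimpleGraph (Fin N),
          RAM.expectedTime P (graphInput G) ≤ ENNReal.ofReal ((N : ℝ) ^ f N)) ∧
        2 / 3 ≤ ∫⁻ G, RAM.acceptProb P (graphInput G) ∂(planted N ⌈(N : ℝ) ^ δ⌉₊) ∧
        ∫⁻ G, RAM.acceptProb P (graphInput G) ∂(null N) ≤ 1 / 3

end PlantedClique

/-! ### Concept classes and their dimensions

A concept on `X` is identified with the set of points that it labels `1`, so that a concept
class is a family of subsets of `X`. The VC dimension is `Finset.vcDim`. -/

namespace Learning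

/-- A deterministic online learner: from the labelled samples seen so far (most recent first) and
the current point, it predicts a label. -/
abbrev OnlineLearner (X : Type*) := List (X × Bool) → X → Bool

/-- The number of wrong predictions of `A` on the sequence `seq`, after the history `hist`. -/
def mistakesFrom {X : Type*} (A : OnlineLearner X) :
    List (X × Bool) → List (X × Bool) → ℕ
  | _, [] => 0
  | hist, (x, y) :: seq =>
      (if A hist x = y then 0 else 1) + mistakesFrom A ((x, y) :: hist) seq

/-- The number of wrong predictions of `A` on the sequence `seq`. -/
def mistakes {X : Type*} (A : OnlineLearner X) (seq : List (X × Bool)) : ℕ :=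
  mistakesFrom A [] seq

/-- Some concept in the class is consistent with all the labels of the sequence. -/
def Realizable {X : Type*} (𝒞 : Finset (Finset X)) (seq : List (X × Bool)) : Prop :=
  ∃ c ∈ 𝒞, ∀ z ∈ seq, (z.2 = true ↔ z.1 ∈ c)

/-- `A` makes at most `b` mistakes on every sequence of labelled distinct points that is
realizable by the class. -/
def HasMistakeBound {X : Type*} (A : OnlineLearner X) (𝒞 : Finset (Finset X)) (b : ℕ) : Prop :=
  ∀ seq : List (X × Bool), (seq.map Prod.fst).Nodup → Realizable 𝒞 seq → mistakes A seq ≤ b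

/-- Littlestone's dimension: the least mistake bound that an online learner achieves. -/
noncomputable def littlestoneDim {X : Type*} (𝒞 : Finset (Finset X)) : ℕ :=
  sInf {b : ℕ | ∃ A : OnlineLearner X, HasMistakeBound A 𝒞 b}

/-- The concept in column `j` of a binary matrix whose rows are indexed by the points. -/
def concept {m k : ℕ} (M : Fin m → Fin k → Bool) (j : Fin k) : Finset (Fin m) :=
  Finset.univ.filter fun x => M x j = true

/-- The concept class of a binary matrix. -/
def conceptClass {m k : ℕ} (M : Fin m → Fin k → Bool) : Finset (Finset (Fin m)) :=
  Finset.univ.image (concept M)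

/-- The deterministic program `P` runs in polynomial time and approximates the dimension `dim` of
explicitly given concept classes to within the factor `α n`, where `n` is the number of entries
of the matrix: the output always lies between `OPT / α n` and `OPT`. The columns of the matrix
are the distinct concepts of the class. -/
def PolyTimeApprox (P : RAM.Prog) (dim : ∀ m : ℕ, Finset (Finset (Fin m)) → ℕ)
    (α : ℕ → ℝ) : Prop :=
  P.CoinFree ∧ ∃ T : Polynomial ℕ,
    ∀ (m k : ℕ) (M : Fin m → Fin k → Bool), 0 < m → 0 < k → Function.Injective (concept M) →
      ∀ ω : ℕ → Bool, ∃ (t : ℕ) (s : RAM.State),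
        RAM.Exec ω P (RAM.inputState m k fun x j => M x j = true) t s ∧
        t ≤ T.eval (m * k) ∧
        s.reg 0 ≤ dim m (conceptClass M) ∧
        (dim m (conceptClass M) : ℝ) ≤ α (m * k) * s.reg 0

end Learning

/-! ### Mistake bounds -/

namespace Learning

/-! Since the VC dimension is at most Littlestone's dimension (`vcDim_le_littlestoneDim`), both
claims follow from one randomized reduction: a large clique makes the VC dimension of the
constructed class large, whereas on a random graph even Littlestone's dimension is small. An
approximation of any quantity between the two dimensions then distinguishes the cases
(`not_polyTimeApprox`).

Fix `q > 1/δ` and let `b` be least with `N ≤ 2^(qb)`, so that the planted clique has at least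
`2^(b-1)` vertices. In stage `r`, draw for each of `n = 2^(r((8q-5)b+8))` rows and each of `n`
columns a random tuple of `8r` numbers below `2^(qb)`, regarded as vertices. The entry of a row and
a column is a fair coin, replaced by `0` unless every vertex of the row tuple is equal or adjacent
to every vertex of the column tuple. An identity block below makes the columns distinct.

If there is a clique, then with overwhelming probability `br` rows have tuples inside it, and every
pattern on these rows is the coin pattern of a column whose tuple is inside it too. Hence the VC
dimension is at least `br` (`le_vcDim_sampleMatrix`, `failBound_le`). In a random graph there is no
biclique with sides `h = 3qb`, and no `t = ⌊2q²b/r⌋ + 1` tuples live on only `2h` vertices; so `t`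
rows never have a common `1` in more than `t` columns (`littlestoneDim_sampleMatrix_le`). A learner
that predicts `0` until it has seen `t` positive points, and follows a consistent concept from then
on, makes at most `2t` mistakes (`littlestoneDim_le_two_mul`). Thus `r` times the dimension is at
most `(4q²+2)b` for a random graph, against `br²` for a planted one. The logarithm of the matrix
size is of order `qbr`, so an `o(log n)`-approximation sees the difference as soon as `r ≥ b/j`, for
any fixed `j` and large `b` (`eventually_thr_lt_mul`). Stage `r` takes time `2^(O(br))`, which for
`r ≈ b/j` is `N^(O(log N)/j)`.

The exponent has to be `o(log N)`, but nothing is known about how fast `α(n)/log n` tends to zero,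
so `r` cannot be computed. The distinguisher finds it by experiment: it goes through `r = 1, 2, …,
b`, tests each stage on planted graphs that it generates itself, `N` times for every clique size
from `2^(b-1)` to `N`, and applies the first stage that passes to the input. A stage with success
probability `p` on planted graphs passes and then fails with probability at most `p^N(1-p) ≤
1/(N+1)` (`pow_mul_one_sub_le`), so stages that pass undeservedly do no harm. For every fixed `j`,
stage `⌊b/j⌋ + 1` passes except with a probability that outweighs the cost of all later stages
(`eventually_coinLaw_real_not_passes_le`), so the expected time is below `N^(ε log N)` for every `ε
> 0`, which gives a single exponent `o(log N)` (`exists_isLittleO_exponent`). On random graphs a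
union bound over the stages suffices, whether or not they pass.

All programs flip a number of coins that depends only on the parameters. Independence therefore
reduces to disjoint ranges of a fixed coin sequence, and probabilities to counting. -/

theorem mistakesFrom_le_length {X : Type*} (A : OnlineLearner X) (seq : List (X × Bool)) :
    ∀ hist, mistakesFrom A hist seq ≤ seq.length := by
  induction seq with
  | nil => intro hist; simp [mistakesFrom]
  | cons z seq ih =>
    intro hist
    obtain ⟨x, y⟩ := z
    have := ih ((x, y) :: hist)
    simp only [mistakesFrom, List.length_cons]
    split_ifs <;> omega

/-- The points of a sequence are distinct, so no learner errs more than `m` times; the infimum is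
over a non-empty set and is attained. -/
theorem exists_hasMistakeBound {m : ℕ} (𝒞 : Finset (Finset (Fin m))) :
    ∃ A : OnlineLearner (Fin m), HasMistakeBound A 𝒞 (littlestoneDim 𝒞) := by
  have h : {b : ℕ | ∃ A : OnlineLearner (Fin m), HasMistakeBound A 𝒞 b}.Nonempty := by
    refine ⟨m, fun _ _ => false, fun seq hd _ => ?_⟩
    refine (mistakesFrom_le_length _ seq []).trans ?_
    have := hd.length_le_card
    simpa using this
  exact Nat.sInf_mem h

/-- The answers of the adversary that always contradicts the learner. -/
def contradict {X : Type*} (A : OnlineLearner X) :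
    List (X × Bool) → List X → List (X × Bool)
  | _, [] => []
  | hist, x :: l => (x, !A hist x) :: contradict A ((x, !A hist x) :: hist) l

theorem map_fst_contradict {X : Type*} (A : OnlineLearner X) (l : List X) :
    ∀ hist, (contradict A hist l).map Prod.fst = l := by
  induction l with
  | nil => intro; rfl
  | cons x l ih => intro hist; simp [contradict, ih]

theorem mistakesFrom_contradict {X : Type*} (A : OnlineLearner X) (l : List X) :
    ∀ hist, mistakesFrom A hist (contradict A hist l) = l.length := by
  induction l with
  | nil => intro; rfl
  | cons x l ih =>
    intro hist
    simp [contradict, mistakesFrom, ih, Nat.add_comm]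

theorem unique_label_of_nodup {X : Type*} {seq : List (X × Bool)}
    (h : (seq.map Prod.fst).Nodup) {x : X} {y y' : Bool} (h1 : (x, y) ∈ seq)
    (h2 : (x, y') ∈ seq) : y = y' := by
  have := List.inj_on_of_nodup_map h h1 h2 rfl
  simpa using this

/-- On a shattered set every labelling is realizable, in particular the one that contradicts each
prediction of an optimal learner. -/
theorem vcDim_le_littlestoneDim {m : ℕ} (𝒞 : Finset (Finset (Fin m))) :
    𝒞.vcDim ≤ littlestoneDim 𝒞 := by
  obtain ⟨A, hA⟩ := exists_hasMistakeBound 𝒞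
  refine Finset.sup_le fun S hS => ?_
  rw [Finset.mem_shatterer] at hS
  set seq := contradict A [] S.toList with hseq
  have hfst : seq.map Prod.fst = S.toList := map_fst_contradict A _ _
  have hnd : (seq.map Prod.fst).Nodup := by rw [hfst]; exact S.nodup_toList
  have hreal : Realizable 𝒞 seq := by
    obtain ⟨c, hc, hSc⟩ := hS (t := S.filter fun x => (x, true) ∈ seq) (Finset.filter_subset _ _)
    refine ⟨c, hc, ?_⟩
    rintro ⟨x, y⟩ hz
    have hx : x ∈ S := by
      have : x ∈ seq.map Prod.fst := List.mem_map_of_mem (f := Prod.fst) hz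
      rw [hfst] at this
      simpa using this
    have h1 : x ∈ c ↔ (x, true) ∈ seq := by
      have := congrArg (x ∈ ·) hSc
      simpa [hx] using this
    rw [h1]
    constructor
    · intro hy
      simp only at hy
      exact hy ▸ hz
    · intro ht
      exact unique_label_of_nodup hnd hz ht
  have := hA seq hnd hreal
  rw [mistakes, hseq, mistakesFrom_contradict] at this
  simpa using this

/-! ### A learner for classes in which few concepts share many points -/

section Halving

variable {X : Type*} [DecidableEq X]

/-- The points that the history labels `1`. -/
def positives (hist : List (X × Bool)) : Finset X :=
  ((hist.filter fun z => z.2).map Prod.fst).toFinset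

theorem mem_positives {hist : List (X × Bool)} {x : X} :
    x ∈ positives hist ↔ (x, true) ∈ hist := by
  simp [positives]

open Classical in
/-- The concepts consistent with the history. -/
noncomputable def versionSpace (𝒞 : Finset (Finset X)) (hist : List (X × Bool)) :
    Finset (Finset X) :=
  𝒞.filter fun c => ∀ z ∈ hist, (z.2 = true ↔ z.1 ∈ c)

open Classical in
/-- Predict `0` until `t` points are labelled `1`, and then follow a consistent concept. -/
noncomputable def patientLearner (𝒞 : Finset (Finset X)) (t : ℕ) : OnlineLearner X :=
  fun hist x =>
    if (positives hist).card < t then false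
    else if h : (versionSpace 𝒞 hist).Nonempty then decide (x ∈ h.choose) else false

/-- Bound for the number of mistakes still to come. -/
noncomputable def potential (𝒞 : Finset (Finset X)) (t : ℕ) (hist : List (X × Bool)) : ℕ :=
  if (positives hist).card < t then (t - (positives hist).card) + t
  else (versionSpace 𝒞 hist).card

theorem positives_cons_true (hist : List (X × Bool)) (x : X) :
    positives ((x, true) :: hist) = insert x (positives hist) := by
  ext z; simp [mem_positives]

theorem positives_cons_false (hist : List (X × Bool)) (x : X) :
    positives ((x, false) :: hist) = positives hist := by
  ext z; simp [mem_positives]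

theorem versionSpace_cons_subset (𝒞 : Finset (Finset X)) (hist : List (X × Bool)) (z : X × Bool) :
    versionSpace 𝒞 (z :: hist) ⊆ versionSpace 𝒞 hist := by
  intro c hc
  simp only [versionSpace, Finset.mem_filter] at hc ⊢
  exact ⟨hc.1, fun w hw => hc.2 w (List.mem_cons_of_mem _ hw)⟩

/-- The potential pays for every mistake. In the first phase an error occurs on a point labelled
`1`, which is new because points do not repeat, so the number of positive points grows. Once it
reaches `t`, at most `t` consistent concepts remain by `h𝒞`, and each later error eliminates the
concept being followed. -/
theorem mistakesFrom_patientLearner_le (𝒞 : Finset (Finset X)) (t : ℕ)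
    (h𝒞 : ∀ S : Finset X, t ≤ S.card → (𝒞.filter fun c => S ⊆ c).card ≤ t)
    (seq : List (X × Bool)) :
    ∀ hist : List (X × Bool), (seq.map Prod.fst).Nodup →
      (∀ x ∈ seq.map Prod.fst, x ∉ hist.map Prod.fst) →
      (∃ c ∈ 𝒞, (∀ z ∈ hist, (z.2 = true ↔ z.1 ∈ c)) ∧ ∀ z ∈ seq, (z.2 = true ↔ z.1 ∈ c)) →
      mistakesFrom (patientLearner 𝒞 t) hist seq ≤ potential 𝒞 t hist := by
  induction seq with
  | nil => intro hist _ _ _; simp [mistakesFrom]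
  | cons z seq ih =>
    obtain ⟨x, y⟩ := z
    intro hist hnd hdis hreal
    obtain ⟨c, hc, hc1, hc2⟩ := hreal
    simp only [List.map_cons, List.nodup_cons] at hnd
    have hx : x ∉ positives hist := by
      intro hx
      rw [mem_positives] at hx
      exact hdis x (by simp) (List.mem_map_of_mem (f := Prod.fst) hx)
    have hind := ih ((x, y) :: hist) hnd.2 (by
        intro w hw
        simp only [List.map_cons, List.mem_cons, not_or]
        refine ⟨?_, hdis w (by simp only [List.map_cons, List.mem_cons]; exact Or.inr hw)⟩
        rintro rfl
        exact hnd.1 hw) ⟨c, hc, by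
          intro w hw
          rcases List.mem_cons.1 hw with rfl | hw
          · exact hc2 _ (by simp)
          · exact hc1 _ hw, fun w hw => hc2 w (List.mem_cons_of_mem _ hw)⟩
    rw [mistakesFrom]
    by_cases hp : (positives hist).card < t
    · have hA : patientLearner 𝒞 t hist x = false := by simp [patientLearner, hp]
      rw [hA]
      cases y with
      | false =>
        have : potential 𝒞 t ((x, false) :: hist) = potential 𝒞 t hist := by
          simp only [potential, positives_cons_false, if_pos hp]
        simpa [this] using hind
      | true =>
        have hcard : (positives ((x, true) :: hist)).card = (positives hist).card + 1 := by
          rw [positives_cons_true, Finset.card_insert_of_notMem hx]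
        simp only [potential, if_pos hp, Bool.false_eq_true, if_false] at hind ⊢
        split_ifs at hind with h2
        · omega
        -- The change of phase: before it the potential is `1 + t`, after it the size of the version
        -- space, which is at most `t`.
        · have hle : (versionSpace 𝒞 ((x, true) :: hist)).card ≤ t := by
            refine (Finset.card_le_card ?_).trans (h𝒞 (positives ((x, true) :: hist)) (by omega))
            intro d hd
            simp only [versionSpace, Finset.mem_filter] at hd ⊢
            refine ⟨hd.1, fun w hw => ?_⟩
            exact (hd.2 _ (mem_positives.1 hw)).1 rfl
          omega
    · have hne : (versionSpace 𝒞 hist).Nonempty :=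
        ⟨c, by simp only [versionSpace, Finset.mem_filter]; exact ⟨hc, hc1⟩⟩
      have hp' : ¬ (positives ((x, y) :: hist)).card < t := by
        have : positives hist ⊆ positives ((x, y) :: hist) := by
          intro w hw
          rw [mem_positives] at hw ⊢
          exact List.mem_cons_of_mem _ hw
        have := Finset.card_le_card this
        omega
      simp only [potential, if_neg hp, if_neg hp'] at hind ⊢
      obtain ⟨d, hd, hA⟩ : ∃ d ∈ versionSpace 𝒞 hist,
          patientLearner 𝒞 t hist x = decide (x ∈ d) :=
        ⟨hne.choose, hne.choose_spec, by simp [patientLearner, hp, hne]⟩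
      have hsub := versionSpace_cons_subset 𝒞 hist (x, y)
      split_ifs with hm
      · have := Finset.card_le_card hsub
        omega
      -- The concept `d` that was followed contradicts the new label, so the inclusion of version
      -- spaces is strict.
      · have : versionSpace 𝒞 ((x, y) :: hist) ⊂ versionSpace 𝒞 hist := by
          refine Finset.ssubset_iff_subset_ne.2 ⟨hsub, fun he => ?_⟩
          have hmem := he.ge hd
          simp only [versionSpace, Finset.mem_filter] at hmem
          have h3 := hmem.2 (x, y) (by simp)
          apply hm
          rw [hA]
          cases y
          · simpa using h3
          · simpa using h3
        have := Finset.card_lt_card this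
        omega

end Halving

theorem littlestoneDim_le_two_mul {m : ℕ} (𝒞 : Finset (Finset (Fin m))) (t : ℕ)
    (h𝒞 : ∀ S : Finset (Fin m), t ≤ S.card → (𝒞.filter fun c => S ⊆ c).card ≤ t) :
    littlestoneDim 𝒞 ≤ 2 * t := by
  refine Nat.sInf_le ⟨patientLearner 𝒞 t, fun seq hnd hreal => ?_⟩
  obtain ⟨c, hc, hcs⟩ := hreal
  refine (mistakesFrom_patientLearner_le 𝒞 t h𝒞 seq [] hnd (by simp)
    ⟨c, hc, by simp, hcs⟩).trans ?_
  rw [potential]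
  split_ifs with h
  · simp [positives]; omega
  -- The second phase can apply from the start only if `t = 0`; then `h𝒞` for the empty set says
  -- that the class is empty.
  · have h0 : t = 0 := by simpa [positives] using h
    subst h0
    refine (Finset.card_le_card ?_).trans (h𝒞 ∅ (by simp))
    intro d hd
    simp only [versionSpace, Finset.mem_filter] at hd ⊢
    exact ⟨hd.1, by simp⟩

end Learning

/-! ### Total correctness of programs -/

namespace RAM

infixr:60 " ;; " => Prog.seq

@[simp] theorem State.setReg_reg (s : State) (i v j : ℕ) :
    (s.setReg i v).reg j = if j = i then v else s.reg j := by
  simp [State.setReg, Function.update_apply]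

@[simp] theorem State.setReg_mem (s : State) (i v : ℕ) : (s.setReg i v).mem = s.mem := rfl

@[simp] theorem State.setReg_coins (s : State) (i v : ℕ) : (s.setReg i v).coins = s.coins := rfl

@[simp] theorem State.setMem_reg (s : State) (i v : ℕ) : (s.setMem i v).reg = s.reg := rfl

@[simp] theorem State.setMem_mem (s : State) (i v j : ℕ) :
    (s.setMem i v).mem j = if j = i then v else s.mem j := by
  simp [State.setMem, Function.update_apply]

@[simp] theorem State.setMem_coins (s : State) (i v : ℕ) : (s.setMem i v).coins = s.coins := rfl

/-- Determinism for given coins. It turns a statement about one exhibited run into one about all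
runs, as needed to evaluate the acceptance probability. -/
theorem Exec.unique {ω : ℕ → Bool} {p : Prog} {s s₁ s₂ : State} {t₁ t₂ : ℕ}
    (h₁ : Exec ω p s t₁ s₁) (h₂ : Exec ω p s t₂ s₂) : t₁ = t₂ ∧ s₁ = s₂ := by
  induction h₁ generalizing t₂ s₂ with
  | const | add | sub | load | store | flip => cases h₂; exact ⟨rfl, rfl⟩
  | seq _ _ ih ih' =>
    cases h₂ with
    | seq h h' =>
      obtain ⟨rfl, rfl⟩ := ih h
      obtain ⟨rfl, rfl⟩ := ih' h'
      exact ⟨rfl, rfl⟩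
  | ifZero_pos h0 _ ih =>
    cases h₂ with
    | ifZero_pos _ h => obtain ⟨rfl, rfl⟩ := ih h; exact ⟨rfl, rfl⟩
    | ifZero_neg h _ => exact absurd h0 h
  | ifZero_neg h0 _ ih =>
    cases h₂ with
    | ifZero_pos h _ => exact absurd h h0
    | ifZero_neg _ h => obtain ⟨rfl, rfl⟩ := ih h; exact ⟨rfl, rfl⟩
  | loop_done h0 =>
    cases h₂ with
    | loop_done _ => exact ⟨rfl, rfl⟩
    | loop_step h _ _ => exact absurd h0 h
  | loop_step h0 _ _ ih ih' =>
    cases h₂ with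
    | loop_done h => exact absurd h h0
    | loop_step _ h h' =>
      obtain ⟨rfl, rfl⟩ := ih h
      obtain ⟨rfl, rfl⟩ := ih' h'
      exact ⟨rfl, rfl⟩

/-- The registers that occur as targets in a program. -/
def Prog.Writes : Prog → ℕ → Prop
  | .const i _ => fun x => x = i
  | .add i _ _ => fun x => x = i
  | .sub i _ _ => fun x => x = i
  | .load i _ => fun x => x = i
  | .store _ _ => fun _ => False
  | .flip i => fun x => x = i
  | .seq p q => fun x => p.Writes x ∨ q.Writes x
  | .ifZero _ p q => fun x => p.Writes x ∨ q.Writes x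
  | .loop _ p => p.Writes

/-- Frame conditions for concrete programs can thus be discharged by `decide`. -/
instance Prog.decidableWrites : ∀ (p : Prog) (x : ℕ), Decidable (p.Writes x)
  | .const i _, x | .add i _ _, x | .sub i _ _, x | .load i _, x | .flip i, x =>
    inferInstanceAs (Decidable (x = i))
  | .store _ _, _ => inferInstanceAs (Decidable False)
  | .seq p q, x | .ifZero _ p q, x =>
    @instDecidableOr _ _ (Prog.decidableWrites p x) (Prog.decidableWrites q x)
  | .loop _ p, x => Prog.decidableWrites p x

/-- A program that does not write to the memory. -/
def Prog.StoreFree : Prog → Prop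
  | .store _ _ => False
  | .seq p q => p.StoreFree ∧ q.StoreFree
  | .ifZero _ p q => p.StoreFree ∧ q.StoreFree
  | .loop _ p => p.StoreFree
  | _ => True

theorem Exec.reg_eq {ω : ℕ → Bool} {p : Prog} {s s' : State} {t : ℕ} (h : Exec ω p s t s') :
    ∀ x, ¬ p.Writes x → s'.reg x = s.reg x := by
  induction h with
  | const | add | sub | load | store | flip => intro x hx; simp_all [Prog.Writes]
  | seq _ _ ih ih' =>
    intro x hx
    simp only [Prog.Writes, not_or] at hx
    rw [ih' x hx.2, ih x hx.1]
  | ifZero_pos _ _ ih =>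
    intro x hx
    simp only [Prog.Writes, not_or] at hx
    exact ih x hx.1
  | ifZero_neg _ _ ih =>
    intro x hx
    simp only [Prog.Writes, not_or] at hx
    exact ih x hx.2
  | loop_done => intro x _; rfl
  | loop_step _ _ _ ih ih' => intro x hx; rw [ih' x hx, ih x hx]

theorem Exec.mem_eq {ω : ℕ → Bool} {p : Prog} {s s' : State} {t : ℕ} (h : Exec ω p s t s') :
    p.StoreFree → s'.mem = s.mem := by
  induction h with
  | const | add | sub | load | flip => intro _; rfl
  | store => intro h; exact h.elim
  | seq _ _ ih ih' => intro h; rw [ih' h.2, ih h.1]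
  | ifZero_pos _ _ ih => intro h; exact ih h.1
  | ifZero_neg _ _ ih => intro h; exact ih h.2
  | loop_done => intro _; rfl
  | loop_step _ _ _ ih ih' => intro h; rw [ih' h, ih h]

theorem Exec.coins_eq {ω : ℕ → Bool} {p : Prog} {s s' : State} {t : ℕ} (h : Exec ω p s t s') :
    p.CoinFree → s'.coins = s.coins := by
  induction h with
  | const | add | sub | load | store => intro _; rfl
  | flip => intro h; exact h.elim
  | seq _ _ ih ih' => intro h; rw [ih' h.2, ih h.1]
  | ifZero_pos _ _ ih => intro h; exact ih h.1
  | ifZero_neg _ _ ih => intro h; exact ih h.2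
  | loop_done => intro _; rfl
  | loop_step _ _ _ ih ih' => intro h; rw [ih' h, ih h]

/-- `Tot ω p s T Q`: from `s` the program `p` halts within `T` steps in a state satisfying `Q`. -/
def Tot (ω : ℕ → Bool) (p : Prog) (s : State) (T : ℕ) (Q : State → Prop) : Prop :=
  ∃ (t : ℕ) (s' : State), Exec ω p s t s' ∧ t ≤ T ∧ Q s'

section Rules

variable {ω : ℕ → Bool} {p q : Prog} {s : State} {T T' T₁ T₂ : ℕ} {Q Q' : State → Prop}
  {i j k : ℕ}

theorem Tot.le (h : Tot ω p s T Q) (hT : T ≤ T') : Tot ω p s T' Q := by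
  obtain ⟨t, s', h1, h2, h3⟩ := h
  exact ⟨t, s', h1, h2.trans hT, h3⟩

theorem Tot.imp (h : Tot ω p s T Q) (hQ : ∀ s', Q s' → Q' s') : Tot ω p s T Q' := by
  obtain ⟨t, s', h1, h2, h3⟩ := h
  exact ⟨t, s', h1, h2, hQ _ h3⟩

/-- The frame rule: specifications of subprograms mention only the registers of interest, and
everything else is recovered from the syntax. -/
theorem Tot.frame (h : Tot ω p s T Q) :
    Tot ω p s T (fun s' => Q s' ∧ ∀ x, ¬ p.Writes x → s'.reg x = s.reg x) := by
  obtain ⟨t, s', h1, h2, h3⟩ := h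
  exact ⟨t, s', h1, h2, h3, h1.reg_eq⟩

theorem Tot.mem_frame (h : Tot ω p s T Q) (hp : p.StoreFree) :
    Tot ω p s T (fun s' => Q s' ∧ s'.mem = s.mem) := by
  obtain ⟨t, s', h1, h2, h3⟩ := h
  exact ⟨t, s', h1, h2, h3, h1.mem_eq hp⟩

theorem Tot.coins_frame (h : Tot ω p s T Q) (hp : p.CoinFree) :
    Tot ω p s T (fun s' => Q s' ∧ s'.coins = s.coins) := by
  obtain ⟨t, s', h1, h2, h3⟩ := h
  exact ⟨t, s', h1, h2, h3, h1.coins_eq hp⟩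

theorem Tot.const (h : Q (s.setReg i k)) : Tot ω (.const i k) s 1 Q :=
  ⟨_, _, .const i k s, le_rfl, h⟩

theorem Tot.add (h : Q (s.setReg i (s.reg j + s.reg k))) : Tot ω (.add i j k) s 1 Q :=
  ⟨_, _, .add i j k s, le_rfl, h⟩

theorem Tot.sub (h : Q (s.setReg i (s.reg j - s.reg k))) : Tot ω (.sub i j k) s 1 Q :=
  ⟨_, _, .sub i j k s, le_rfl, h⟩

theorem Tot.load (h : Q (s.setReg i (s.mem (s.reg j)))) : Tot ω (.load i j) s 1 Q :=
  ⟨_, _, .load i j s, le_rfl, h⟩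

theorem Tot.store (h : Q (s.setMem (s.reg i) (s.reg j))) : Tot ω (.store i j) s 1 Q :=
  ⟨_, _, .store i j s, le_rfl, h⟩

theorem Tot.flip (h : Q { s.setReg i (if ω s.coins = true then 1 else 0) with
    coins := s.coins + 1 }) : Tot ω (.flip i) s 1 Q :=
  ⟨_, _, .flip i s, le_rfl, h⟩

theorem Tot.seq (h : Tot ω p s T₁ (fun s' => Tot ω q s' T₂ Q)) :
    Tot ω (p ;; q) s (T₁ + T₂) Q := by
  obtain ⟨t, s', h1, h2, t', s'', h3, h4, h5⟩ := h
  exact ⟨_, _, .seq h1 h3, by omega, h5⟩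

theorem Tot.seq_of (h : Tot ω p s T₁ Q') (h' : ∀ s', Q' s' → Tot ω q s' T₂ Q) :
    Tot ω (p ;; q) s (T₁ + T₂) Q :=
  .seq (h.imp h')

theorem Tot.ifZero (h : s.reg i = 0 → Tot ω p s T Q) (h' : s.reg i ≠ 0 → Tot ω q s T' Q) :
    Tot ω (.ifZero i p q) s (T + T' + 1) Q := by
  by_cases h0 : s.reg i = 0
  · obtain ⟨t, s', h1, h2, h3⟩ := h h0
    exact ⟨_, _, .ifZero_pos h0 h1, by omega, h3⟩
  · obtain ⟨t, s', h1, h2, h3⟩ := h' h0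
    exact ⟨_, _, .ifZero_neg h0 h1, by omega, h3⟩

end Rules

/-- Repeat `body` with register `i` running through `0, …, R[bnd] - 1`; register `9` is scratch. -/
def forUp (i bnd : ℕ) (body : Prog) : Prog :=
  .const i 0 ;; .sub 9 bnd i ;;
    .loop 9 (body ;; .const 9 1 ;; .add i i 9 ;; .sub 9 bnd i)

theorem writes_forUp (i bnd : ℕ) (body : Prog) (x : ℕ) :
    (forUp i bnd body).Writes x ↔ x = i ∨ x = 9 ∨ body.Writes x := by
  simp only [forUp, Prog.Writes]
  tauto

theorem storeFree_forUp (i bnd : ℕ) (body : Prog) :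
    (forUp i bnd body).StoreFree ↔ body.StoreFree := by
  simp [forUp, Prog.StoreFree]

theorem coinFree_forUp (i bnd : ℕ) (body : Prog) :
    (forUp i bnd body).CoinFree ↔ body.CoinFree := by
  simp [forUp, Prog.CoinFree]

/-- The loop rule with invariant `I`. Hypothesis `hst` makes the invariant insensitive to the loop
control, which changes only `i` and register `9` between iterations. An iteration costs the body,
three control instructions and one test. -/
theorem Tot.forUp {ω : ℕ → Bool} {body : Prog} {s : State} {i bnd n T : ℕ}
    (I : ℕ → State → Prop) (hn : s.reg bnd = n) (hi : i ≠ 9 ∧ ¬ body.Writes i)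
    (hb : bnd ≠ 9 ∧ bnd ≠ i ∧ ¬ body.Writes bnd)
    (hst : ∀ j s₁ s₂, I j s₁ → s₂.mem = s₁.mem → s₂.coins = s₁.coins →
      (∀ x, x ≠ i → x ≠ 9 → s₂.reg x = s₁.reg x) → I j s₂)
    (h0 : I 0 s)
    (step : ∀ j s₁, j < n → I j s₁ → s₁.reg i = j →
      (∀ x, ¬ (x = i ∨ x = 9 ∨ body.Writes x) → s₁.reg x = s.reg x) →
      Tot ω body s₁ T (I (j + 1))) :
    Tot ω (RAM.forUp i bnd body) s (3 + n * (T + 4)) (I n) := by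
  -- Induction on the number `d` of remaining iterations, which is also the content of register `9`
  -- at each test.
  have key : ∀ d j s₁, j + d = n → I j s₁ → s₁.reg i = j → s₁.reg 9 = n - j →
      (∀ x, ¬ (x = i ∨ x = 9 ∨ body.Writes x) → s₁.reg x = s.reg x) →
      Tot ω (.loop 9 (body ;; .const 9 1 ;; .add i i 9 ;; .sub 9 bnd i)) s₁
        (1 + d * (T + 4)) (I n) := by
    intro d
    induction d with
    | zero =>
      intro j s₁ hj hI _ h9 _
      exact ⟨1, s₁, .loop_done (by omega), by omega, by rwa [show n = j by omega]⟩
    | succ d ih =>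
      intro j s₁ hj hI hij h9 hfr
      obtain ⟨t, s₂, hx, ht, hI2, hfr2⟩ := (step j s₁ (by omega) hI hij hfr).frame
      have hbn : s₂.reg bnd = n := by
        rw [hfr2 _ hb.2.2, hfr, hn]
        tauto
      set s₃ := ((s₂.setReg 9 1).setReg i (j + 1)).setReg 9 (n - (j + 1)) with hs3
      have hi2 : s₂.reg i = j := by rw [hfr2 _ hi.2, hij]
      have hx3 : Exec ω (body ;; .const 9 1 ;; .add i i 9 ;; .sub 9 bnd i) s₁
          (t + (1 + (1 + 1))) s₃ := by
        refine .seq hx (.seq (.const 9 1 _) (.seq (.add i i 9 _) ?_))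
        have := Exec.sub (ω := ω) 9 bnd i
          ((s₂.setReg 9 1).setReg i ((s₂.setReg 9 1).reg i + (s₂.setReg 9 1).reg 9))
        convert this using 2
        all_goals simp [hi.1, hi2, hb.1, hb.2.1, hbn]
      obtain ⟨t', s', hx', ht', hQ⟩ := ih (j + 1) s₃ (by omega)
        (hst _ _ _ hI2 rfl rfl (by intro x hx1 hx2; simp [hs3, hx1, hx2]))
        (by simp [hs3, hi.1]) (by simp [hs3]) (by
          intro x hx
          have hx1 : x ≠ i := fun h => hx (Or.inl h)
          have hx2 : x ≠ 9 := fun h => hx (Or.inr (Or.inl h))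
          simp only [hs3, State.setReg_reg, if_neg hx1, if_neg hx2]
          rw [hfr2 _ (fun h => hx (Or.inr (Or.inr h))), hfr x hx])
      refine ⟨_, s', .loop_step (by omega) hx3 hx', ?_, hQ⟩
      rw [add_mul]
      omega
  refine Tot.le (T := 1 + (1 + (1 + n * (T + 4)))) ?_ (by omega)
  refine .seq (.const (.seq (.sub ?_)))
  have h9i : (9 : ℕ) ≠ i := Ne.symm hi.1
  refine key n 0 _ (by omega) (hst _ _ _ h0 rfl rfl ?_) ?_ ?_ ?_
  · intro x hx1 hx2; simp [hx1, hx2]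
  · simp [hi.1]
  · simp [hb.2.1, hn]
  · intro x hx
    have hx1 : x ≠ i := fun h => hx (Or.inl h)
    have hx2 : x ≠ 9 := fun h => hx (Or.inr (Or.inl h))
    simp [hx1, hx2]

/-! ### Running a program on relocated registers and memory -/

/-- A bound for the registers that a program mentions. -/
def Prog.bound : Prog → ℕ
  | .const i _ => i + 1
  | .add i j k => i + j + k + 1
  | .sub i j k => i + j + k + 1
  | .load i j => i + j + 1
  | .store i j => i + j + 1
  | .flip i => i + 1
  | .seq p q => max p.bound q.bound
  | .ifZero i p q => max (i + 1) (max p.bound q.bound)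
  | .loop i p => max (i + 1) p.bound

/-- Relocated version of a coin-free program: registers are shifted by `64` and addresses by the
content of register `40`; register `2` stays above all addresses that have been used. -/
def reloc : Prog → Prog
  | .const i k => .const (i + 64) k
  | .add i j k => .add (i + 64) (j + 64) (k + 64)
  | .sub i j k => .sub (i + 64) (j + 64) (k + 64)
  | .load i j => .add 41 40 (j + 64) ;; .load (i + 64) 41
  | .store i j => .add 41 40 (i + 64) ;; .store 41 (j + 64) ;; .const 42 1 ;; .add 41 41 42 ;;
      .sub 42 41 2 ;; .add 2 2 42
  | .flip i => .const (i + 64) 0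
  | .seq p q => reloc p ;; reloc q
  | .ifZero i p q => .ifZero (i + 64) (reloc p) (reloc q)
  | .loop i p => .loop (i + 64) (reloc p)

theorem coinFree_reloc (p : Prog) : (reloc p).CoinFree := by
  induction p <;> simp_all [reloc, Prog.CoinFree]

theorem writes_reloc {p : Prog} {x : ℕ} (h : (reloc p).Writes x) :
    x = 2 ∨ x = 41 ∨ x = 42 ∨ 64 ≤ x := by
  induction p with
  | seq p q ihp ihq | ifZero i p q ihp ihq =>
    rcases h with h | h
    · exact ihp h
    · exact ihq h
  | loop i p ih => exact ih h
  | _ => simp only [reloc, Prog.Writes, false_or] at h; omega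

/-- `u` represents `s` in the relocated registers and memory. -/
structure Represents (R base : ℕ) (s u : State) : Prop where
  base_eq : u.reg 40 = base
  base_le : base ≤ u.reg 2
  reg_eq : ∀ i < R, u.reg (i + 64) = s.reg i
  mem_eq : ∀ a, u.mem (base + a) = s.mem a
  mem_top : ∀ a, u.reg 2 ≤ a → u.mem a = 0

theorem Represents.setReg {R base : ℕ} {s u : State} (h : Represents R base s u) (i v : ℕ) :
    Represents R base (s.setReg i v) (u.setReg (i + 64) v) where
  base_eq := by simp [h.base_eq]
  base_le := by simpa using h.base_le
  reg_eq j hj := by simp [h.reg_eq j hj]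
  mem_eq := h.mem_eq
  mem_top a ha := h.mem_top a (by simpa using ha)

/-- Each instruction becomes at most six, the worst case being `store`. Because the simulated
program is coin-free, `ω'` has nothing to do with `ω`. Memory below `base` is untouched, and
everything from `R[2]` on stays zero, so that later code finds clean space. -/
theorem exec_reloc {ω ω' : ℕ → Bool} {p : Prog} {s s' : State} {t : ℕ} (h : Exec ω p s t s')
    {R base : ℕ} (hc : p.CoinFree) (hR : p.bound ≤ R) (u : State) (hu : Represents R base s u) :
    Tot ω' (reloc p) u (6 * t) (fun u' => Represents R base s' u' ∧
      (∀ a < base, u'.mem a = u.mem a) ∧ u.reg 2 ≤ u'.reg 2) := by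
  induction h generalizing u with
  | const i k s =>
    refine Tot.le (.const ⟨hu.setReg i k, fun _ _ => rfl, ?_⟩) (by omega)
    simp
  | add i j k s =>
    simp only [Prog.bound] at hR
    refine Tot.le (.add ⟨?_, fun _ _ => rfl, ?_⟩) (by omega)
    · rw [hu.reg_eq j (by omega), hu.reg_eq k (by omega)]
      exact hu.setReg _ _
    · simp
  | sub i j k s =>
    simp only [Prog.bound] at hR
    refine Tot.le (.sub ⟨?_, fun _ _ => rfl, ?_⟩) (by omega)
    · rw [hu.reg_eq j (by omega), hu.reg_eq k (by omega)]
      exact hu.setReg _ _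
    · simp
  | load i j s =>
    simp only [Prog.bound] at hR
    refine Tot.le (.seq (.add (.load ⟨?_, fun _ _ => rfl, ?_⟩))) (by omega)
    · have h1 : Represents R base s (u.setReg 41 (u.reg 40 + u.reg (j + 64))) :=
        ⟨by simp [hu.base_eq], by simpa using hu.base_le,
          fun i hi => by simp [hu.reg_eq i hi], hu.mem_eq,
          fun a ha => hu.mem_top a (by simpa using ha)⟩
      have h2 := h1.setReg i (s.mem (s.reg j))
      convert h2 using 2
      simp [hu.base_eq, hu.reg_eq j (by omega), hu.mem_eq]
    · simp
  | store i j s =>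
    simp only [Prog.bound] at hR
    -- The final truncated subtraction and addition replace `R[2]` by the maximum of `R[2]` and the
    -- stored address plus one.
    refine Tot.le (.seq (.add (.seq (.store (.seq (.const (.seq (.add (.seq (.sub
      (.add ⟨?_, ?_, ?_⟩))))))))))) (by omega)
    · have hi := hu.reg_eq i (by omega)
      have hj := hu.reg_eq j (by omega)
      have hbl := hu.base_le
      refine ⟨?_, ?_, ?_, ?_, ?_⟩
      · simp [hu.base_eq]
      · simp; omega
      · intro x hx
        simp [hu.reg_eq x hx]
      · intro a
        simp [hu.base_eq, hi, hj, hu.mem_eq]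
      · intro a ha
        simp [hu.base_eq, hi] at ha ⊢
        rw [if_neg (by omega)]
        exact hu.mem_top a (by omega)
    · intro a ha
      simp [hu.base_eq]
      omega
    · simp
  | flip i s => exact hc.elim
  | @seq p q s s' s'' t t' _ _ ih ih' =>
    simp only [Prog.bound, max_le_iff] at hR
    refine Tot.le (.seq_of (ih hc.1 hR.1 u hu) fun u' hu' => ?_) (T := 6 * t + 6 * t') (by omega)
    refine (ih' hc.2 hR.2 u' hu'.1).imp fun u'' hu'' => ⟨hu''.1, fun a ha => ?_, ?_⟩
    · rw [hu''.2.1 a ha, hu'.2.1 a ha]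
    · exact hu'.2.2.trans hu''.2.2
  | @ifZero_pos i p q s s' t h0 _ ih =>
    simp only [Prog.bound, max_le_iff] at hR
    obtain ⟨t', u', hx, ht, hQ⟩ := ih hc.1 hR.2.1 u hu
    exact ⟨t' + 1, u', .ifZero_pos (by rw [hu.reg_eq i (by omega), h0]) hx, by omega, hQ⟩
  | @ifZero_neg i p q s s' t h0 _ ih =>
    simp only [Prog.bound, max_le_iff] at hR
    obtain ⟨t', u', hx, ht, hQ⟩ := ih hc.2 hR.2.2 u hu
    exact ⟨t' + 1, u', .ifZero_neg (by rwa [hu.reg_eq i (by omega)]) hx, by omega, hQ⟩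
  | @loop_done i p s h0 =>
    simp only [Prog.bound, max_le_iff] at hR
    exact ⟨1, u, .loop_done (by rw [hu.reg_eq i (by omega), h0]), by omega, hu,
      fun _ _ => rfl, le_rfl⟩
  | @loop_step i p s s' s'' t t' h0 _ _ ih ih' =>
    have hR' := hR
    simp only [Prog.bound, max_le_iff] at hR'
    obtain ⟨t1, u', hx, ht, hu'⟩ := ih hc hR'.2 u hu
    obtain ⟨t2, u'', hx', ht', hu''⟩ := ih' hc hR u' hu'.1
    refine ⟨t1 + 1 + t2, u'', .loop_step (by rwa [hu.reg_eq i (by omega)]) hx hx', by omega,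
      hu''.1, fun a ha => ?_, hu'.2.2.trans hu''.2.2⟩
    rw [hu''.2.1 a ha, hu'.2.1 a ha]

/-- Set the registers `64, …, 64 + R - 1` to `0`. -/
def clear : ℕ → Prog
  | 0 => .const 42 0
  | R + 1 => clear R ;; .const (R + 64) 0

/-- Earlier simulations leave values in the relocated registers, while an input state has zeros
there. -/
theorem tot_clear (ω : ℕ → Bool) (R : ℕ) (s : State) :
    Tot ω (clear R) s (R + 1) (fun s' => ∀ i < R, s'.reg (i + 64) = 0) := by
  induction R with
  | zero => exact .const (by simp)
  | succ R ih =>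
    refine .seq_of ih fun s' hs' => .const fun i hi => ?_
    rcases Nat.lt_succ_iff_lt_or_eq.1 hi with h | rfl
    · simp [hs' i h]
    · simp

theorem writes_clear {R x : ℕ} (h : (clear R).Writes x) : x = 42 ∨ 64 ≤ x := by
  induction R with
  | zero => exact Or.inl h
  | succ R ih =>
    rcases h with h | h
    · exact ih h
    · simp only [Prog.Writes] at h; omega

theorem storeFree_clear (R : ℕ) : (clear R).StoreFree := by
  induction R <;> simp_all [clear, Prog.StoreFree]

theorem coinFree_clear (R : ℕ) : (clear R).CoinFree := by
  induction R <;> simp_all [clear, Prog.CoinFree]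

end RAM

/-! ### Building blocks -/

namespace RAM

/-- `s'` arises from `s` by appending the values `f 0, …, f (m - 1)` to the used part of the
memory, whose end is kept in register `2`. -/
def Pushed (s s' : State) (m : ℕ) (f : ℕ → ℕ) : Prop :=
  s'.reg 2 = s.reg 2 + m ∧
    ∀ x, s'.mem x = if s.reg 2 ≤ x ∧ x < s.reg 2 + m then f (x - s.reg 2) else s.mem x

theorem Pushed.mem_lt {s s' : State} {m : ℕ} {f : ℕ → ℕ} (h : Pushed s s' m f) :
    ∀ x < s.reg 2, s'.mem x = s.mem x := by
  intro x hx
  rw [h.2, if_neg (by omega)]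

theorem Pushed.mem_ge {s s' : State} {m : ℕ} {f : ℕ → ℕ} (h : Pushed s s' m f)
    (h0 : ∀ x, s.reg 2 ≤ x → s.mem x = 0) : ∀ x, s'.reg 2 ≤ x → s'.mem x = 0 := by
  intro x hx
  rw [h.1] at hx
  rw [h.2, if_neg (by omega), h0 x (by omega)]

theorem Pushed.mem_add {s s' : State} {m : ℕ} {f : ℕ → ℕ} (h : Pushed s s' m f)
    {x : ℕ} (hx : x < m) : s'.mem (s.reg 2 + x) = f x := by
  rw [h.2, if_pos (by omega), Nat.add_sub_cancel_left]

theorem Pushed.trans {s s₁ s₂ : State} {m m' : ℕ} {f g h : ℕ → ℕ} (h₁ : Pushed s s₁ m f)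
    (h₂ : Pushed s₁ s₂ m' g) (hf : ∀ x < m, h x = f x) (hg : ∀ x < m', h (m + x) = g x) :
    Pushed s s₂ (m + m') h := by
  refine ⟨by rw [h₂.1, h₁.1, add_assoc], fun x => ?_⟩
  rw [h₂.2, h₁.1, h₁.2]
  by_cases h1 : s.reg 2 + m ≤ x ∧ x < s.reg 2 + m + m'
  · rw [if_pos h1, if_pos (by omega), ← hg _ (by omega)]
    congr 1
    omega
  · rw [if_neg h1]
    by_cases h2 : s.reg 2 ≤ x ∧ x < s.reg 2 + m
    · rw [if_pos h2, if_pos (by omega), hf _ (by omega)]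
    · rw [if_neg h2, if_neg (by omega)]

/-- Each iteration appends `m` values and flips exactly `K` coins, whatever the outcomes. The
position in the coin sequence from which a value is drawn is therefore known in advance; all later
independence arguments rest on this. -/
theorem tot_pushLoop {ω : ℕ → Bool} {body : Prog} {s : State} {i bnd n T m K : ℕ}
    (g : ℕ → ℕ → ℕ) (hn : s.reg bnd = n) (hi : i ≠ 9 ∧ ¬ body.Writes i)
    (hb : bnd ≠ 9 ∧ bnd ≠ i ∧ ¬ body.Writes bnd) (hi2 : i ≠ 2)
    (step : ∀ j s₁, j < n → s₁.reg i = j → s₁.coins = s.coins + j * K →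
      (∀ x < s.reg 2, s₁.mem x = s.mem x) →
      (∀ x, ¬ (x = i ∨ x = 9 ∨ body.Writes x) → s₁.reg x = s.reg x) →
      Tot ω body s₁ T (fun s₂ => Pushed s₁ s₂ m (g j) ∧ s₂.coins = s₁.coins + K)) :
    Tot ω (forUp i bnd body) s (3 + n * (T + 4)) (fun s' =>
      Pushed s s' (n * m) (fun x => g (x / m) (x % m)) ∧ s'.coins = s.coins + n * K) := by
  refine Tot.forUp (fun j s' => Pushed s s' (j * m) (fun x => g (x / m) (x % m)) ∧
    s'.coins = s.coins + j * K) hn hi hb ?_ ?_ ?_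
  · rintro j s₁ s₂ ⟨⟨h1, h2⟩, h3⟩ hm hc hr
    refine ⟨⟨?_, ?_⟩, ?_⟩
    · rw [hr 2 hi2.symm (by norm_num), h1]
    · rwa [hm]
    · rwa [hc]
  · exact ⟨⟨by simp, fun x => by rw [if_neg (by omega)]⟩, by simp⟩
  · rintro j s₁ hj ⟨h1, h2⟩ hij hfr
    refine (step j s₁ hj hij h2 h1.mem_lt hfr).imp ?_
    rintro s₂ ⟨h3, h4⟩
    refine ⟨?_, by rw [h4, h2]; ring⟩
    rw [add_mul, one_mul]
    refine h1.trans h3 (fun _ _ => rfl) fun x hx => ?_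
    have hm : 0 < m := by omega
    rw [mul_comm j m, Nat.mul_add_div hm, Nat.div_eq_of_lt hx, Nat.mul_add_mod,
      Nat.mod_eq_of_lt hx, add_zero]

theorem tot_pushGrid {ω : ℕ → Bool} {body : Prog} {s : State} {i bi j bj n m T K : ℕ}
    (g : ℕ → ℕ → ℕ) (hn : s.reg bi = n) (hm : s.reg bj = m)
    (hi : i ≠ 9 ∧ i ≠ j ∧ i ≠ 2 ∧ ¬ body.Writes i) (hj : j ≠ 9 ∧ j ≠ 2 ∧ ¬ body.Writes j)
    (hbi : bi ≠ 9 ∧ bi ≠ i ∧ bi ≠ j ∧ ¬ body.Writes bi)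
    (hbj : bj ≠ 9 ∧ bj ≠ i ∧ bj ≠ j ∧ ¬ body.Writes bj)
    (step : ∀ a b s₁, a < n → b < m → s₁.reg i = a → s₁.reg j = b →
      s₁.coins = s.coins + (a * m + b) * K →
      (∀ x < s.reg 2, s₁.mem x = s.mem x) →
      (∀ x, ¬ (x = i ∨ x = j ∨ x = 9 ∨ body.Writes x) → s₁.reg x = s.reg x) →
      Tot ω body s₁ T (fun s₂ => Pushed s₁ s₂ 1 (fun _ => g a b) ∧ s₂.coins = s₁.coins + K)) :
    Tot ω (forUp i bi (forUp j bj body)) s (3 + n * ((3 + m * (T + 4)) + 4)) (fun s' =>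
      Pushed s s' (n * m) (fun x => g (x / m) (x % m)) ∧ s'.coins = s.coins + n * (m * K)) := by
  refine Tot.forUp (fun a s' => Pushed s s' (a * m) (fun x => g (x / m) (x % m)) ∧
    s'.coins = s.coins + a * (m * K)) hn ⟨hi.1, ?_⟩ ⟨hbi.1, hbi.2.1, ?_⟩ ?_ ?_ ?_
  · rw [writes_forUp]; tauto
  · rw [writes_forUp]; tauto
  · rintro a s₁ s₂ ⟨⟨h1, h2⟩, h3⟩ hm hc hr
    refine ⟨⟨?_, ?_⟩, ?_⟩
    · rw [hr 2 hi.2.2.1.symm (by norm_num), h1]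
    · rwa [hm]
    · rwa [hc]
  · exact ⟨⟨by simp, fun x => by rw [if_neg (by omega)]⟩, by simp⟩
  · rintro a s₁ ha ⟨h1, h2⟩ hia hfr
    have hfr' : ∀ x, ¬ (x = i ∨ x = j ∨ x = 9 ∨ body.Writes x) → s₁.reg x = s.reg x := by
      intro x hx
      refine hfr x ?_
      rw [writes_forUp]
      tauto
    refine (tot_pushLoop (m := 1) (K := K) (T := T) (fun b _ => g a b) (n := m) ?_
      ⟨hj.1, hj.2.2⟩ ⟨hbj.1, hbj.2.2⟩ hj.2.1 ?_).imp ?_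
    · rw [hfr' _ (by tauto), hm]
    · intro b s₂ hb hjb hc hmem hfr2
      refine step a b s₂ ha hb ?_ hjb ?_ ?_ ?_
      · rw [hfr2 i (by tauto), hia]
      · rw [hc, h2]; ring
      · intro x hx
        rw [hmem x (by rw [h1.1]; omega), h1.mem_lt x hx]
      · intro x hx
        rw [hfr2 x (by tauto), hfr' x hx]
    · rintro s₂ ⟨h3, h4⟩
      refine ⟨?_, by rw [h4, h2]; ring⟩
      rw [add_mul, one_mul]
      rw [mul_one] at h3
      refine h1.trans h3 (fun _ _ => rfl) fun x hx => ?_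
      have hm : 0 < m := by omega
      rw [mul_comm a m, Nat.mul_add_div hm, Nat.div_eq_of_lt hx, Nat.mul_add_mod,
        Nat.mod_eq_of_lt hx, add_zero, Nat.div_one]

/-- Append the content of register `31`. -/
def push : Prog := .store 2 31 ;; .const 42 1 ;; .add 2 2 42

theorem tot_push (ω : ℕ → Bool) (s : State) :
    Tot ω push s 3 (fun s' => Pushed s s' 1 (fun _ => s.reg 31) ∧ s'.coins = s.coins) := by
  refine Tot.le (.seq (.store (.seq (.const (.add ⟨⟨?_, fun x => ?_⟩, ?_⟩))))) le_rfl
  · simp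
  · simp only [State.setReg_mem, State.setMem_mem]
    congr 1
    simp only [eq_iff_iff]
    omega
  · simp

theorem tot_then_push {ω : ℕ → Bool} {p : Prog} {s : State} {T K v : ℕ}
    (h : Tot ω p s T fun s' => s'.reg 31 = v ∧ s'.coins = s.coins + K)
    (hp : p.StoreFree) (h2 : ¬ p.Writes 2) :
    Tot ω (p ;; push) s (T + 3) (fun s' => Pushed s s' 1 (fun _ => v) ∧
      s'.coins = s.coins + K) := by
  refine .seq_of (h.frame.mem_frame hp) ?_
  rintro s₁ ⟨⟨⟨h31, hc⟩, hr⟩, hm⟩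
  refine (tot_push ω s₁).imp ?_
  rintro s₂ ⟨⟨h3, h4⟩, h5⟩
  refine ⟨⟨?_, ?_⟩, by rw [h5, hc]⟩
  · rw [h3, hr 2 h2]
  · rw [hr 2 h2] at h4
    intro x
    rw [h4, h31, hm]

/-- `R[d] := R[d] + R[bnd] * R[a]`. -/
def addMul (d a i bnd : ℕ) : Prog := forUp i bnd (.add d d a)

theorem tot_addMul (ω : ℕ → Bool) (s : State) {d a i bnd : ℕ}
    (h : i ≠ 9 ∧ i ≠ d ∧ bnd ≠ 9 ∧ bnd ≠ i ∧ bnd ≠ d ∧ d ≠ 9 ∧ a ≠ i ∧ a ≠ 9 ∧ a ≠ d) :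
    Tot ω (addMul d a i bnd) s (3 + s.reg bnd * 5)
      (fun s' => s'.reg d = s.reg d + s.reg bnd * s.reg a) := by
  refine Tot.forUp (T := 1) (fun j s' => s'.reg d = s.reg d + j * s.reg a) rfl ?_ ?_ ?_ ?_ ?_
  · simp only [Prog.Writes]; tauto
  · simp only [Prog.Writes]; tauto
  · intro j s₁ s₂ h1 _ _ hr
    rw [hr d (by tauto) (by tauto), h1]
  · simp
  · intro j s₁ _ h1 _ hfr
    refine .add ?_
    rw [State.setReg_reg, if_pos rfl, h1, hfr a (by simp only [Prog.Writes]; tauto)]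
    ring

/-- The number whose `k` binary digits, most significant first, are given by `ω`. -/
def bitsVal : ℕ → (ℕ → Bool) → ℕ
  | 0, _ => 0
  | k + 1, ω => 2 * bitsVal k ω + if ω k = true then 1 else 0

/-- The sequence `ω` without its first `d` terms. -/
def shift (d : ℕ) (ω : ℕ → Bool) : ℕ → Bool := fun i => ω (d + i)

theorem shift_apply (d : ℕ) (ω : ℕ → Bool) (i : ℕ) : shift d ω i = ω (d + i) := rfl

theorem shift_shift (d e : ℕ) (ω : ℕ → Bool) : shift e (shift d ω) = shift (d + e) ω := by
  funext i; simp [shift, add_assoc]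

/-- Put a number with `R[5]` random binary digits into register `31`. -/
def sampleVertex : Prog :=
  .const 31 0 ;; forUp 25 5 (.flip 27 ;; .add 31 31 31 ;; .add 31 31 27)

theorem tot_sampleVertex (ω : ℕ → Bool) (s : State) {B : ℕ} (hB : s.reg 5 = B) :
    Tot ω sampleVertex s (4 + B * 7) (fun s' => s'.reg 31 = bitsVal B (shift s.coins ω) ∧
      s'.coins = s.coins + B) := by
  refine Tot.le (.seq (.const ?_)) (T := 1 + (3 + B * (1 + (1 + 1) + 4))) (by omega)
  refine Tot.forUp (fun j s' => s'.reg 31 = bitsVal j (shift s.coins ω) ∧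
      s'.coins = s.coins + j) ?_ ?_ ?_ ?_ ?_ ?_
  · simp [hB]
  · simp [Prog.Writes]
  · simp [Prog.Writes]
  · rintro j s₁ s₂ ⟨h1, h2⟩ _ hc hr
    exact ⟨by rw [hr 31 (by norm_num) (by norm_num), h1], by rw [hc, h2]⟩
  · simp [bitsVal]
  · rintro j s₁ hj ⟨h1, h2⟩ h3 hfr
    refine .seq (.flip (.seq (.add (.add ⟨?_, ?_⟩))))
    · simp [h1, h2, bitsVal, two_mul]
      rfl
    · simp [h2, add_assoc]

/-- Append `R[12] * R[10]` random numbers with `R[5]` binary digits. -/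
def sampleTuples : Prog := forUp 21 12 (forUp 22 10 (sampleVertex ;; push))

/-- The `j`-th number with `B` binary digits that is encoded by `ω`. -/
def vertexOf (B : ℕ) (ω : ℕ → Bool) (j : ℕ) : ℕ := bitsVal B (shift (j * B) ω)

theorem tot_sampleTuples (ω : ℕ → Bool) (s : State) {B l m : ℕ} (hB : s.reg 5 = B)
    (hl : s.reg 10 = l) (hm : s.reg 12 = m) :
    Tot ω sampleTuples s (3 + m * ((3 + l * ((4 + B * 7 + 3) + 4)) + 4)) (fun s' =>
      Pushed s s' (m * l) (fun x => vertexOf B (shift s.coins ω) x) ∧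
      s'.coins = s.coins + m * (l * B)) := by
  refine (tot_pushGrid (K := B) (T := 4 + B * 7 + 3)
    (fun a b => vertexOf B (shift s.coins ω) (a * l + b)) hm hl
    ?_ ?_ ?_ ?_ ?_).imp ?_
  · simp [Prog.Writes, sampleVertex, push, writes_forUp]
  · simp [Prog.Writes, sampleVertex, push, writes_forUp]
  · simp [Prog.Writes, sampleVertex, push, writes_forUp]
  · simp [Prog.Writes, sampleVertex, push, writes_forUp]
  · intro a b s₁ ha hb h21 h22 hc _ hfr
    refine tot_then_push ((tot_sampleVertex ω s₁ (B := B) ?_).imp ?_) ?_ ?_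
    · rw [hfr 5 (by simp [Prog.Writes, sampleVertex, push, writes_forUp]), hB]
    · rintro s₂ ⟨h1, h2⟩
      refine ⟨?_, h2⟩
      rw [h1, vertexOf, shift_shift, hc]
    · simp [sampleVertex, Prog.StoreFree, storeFree_forUp]
    · simp [Prog.Writes, sampleVertex, writes_forUp]
  · rintro s' ⟨h1, h2⟩
    refine ⟨⟨h1.1, fun x => ?_⟩, h2⟩
    rw [h1.2]
    simp only [Nat.div_add_mod']

/-- Append the adjacency matrix of a random graph on `R[0]` vertices, of which the first `R[14]`
form a clique; only the part above the diagonal is meaningful. -/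
def sampleGraph : Prog :=
  forUp 21 0 (forUp 22 0 ((.flip 31 ;; .sub 27 14 21 ;; .ifZero 27 (.const 42 0)
    (.sub 27 14 22 ;; .ifZero 27 (.const 42 0) (.const 31 1))) ;; push))

/-- The adjacency matrix that `sampleGraph` produces. -/
def PlantedEntry (N κ : ℕ) (ω : ℕ → Bool) (u v : ℕ) : Prop :=
  (u < κ ∧ v < κ) ∨ ω (u * N + v) = true

-- A coin is flipped for every entry, even inside the clique, where its result is overwritten, and
-- below the diagonal, where it is never read. The number of coins is then independent of `κ`.
open Classical in
theorem tot_sampleGraph (ω : ℕ → Bool) (s : State) {N κ : ℕ} (hN : s.reg 0 = N)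
    (hκ : s.reg 14 = κ) :
    Tot ω sampleGraph s (3 + N * ((3 + N * (13 + 4)) + 4)) (fun s' =>
      Pushed s s' (N * N)
        (fun x => if PlantedEntry N κ (shift s.coins ω) (x / N) (x % N) then 1 else 0) ∧
      s'.coins = s.coins + N * N) := by
  refine (tot_pushGrid (K := 1) (T := 13)
    (fun a b => if PlantedEntry N κ (shift s.coins ω) a b then 1 else 0) hN hN
    ?_ ?_ ?_ ?_ ?_).imp ?_
  · simp [Prog.Writes, push]
  · simp [Prog.Writes, push]
  · simp [Prog.Writes, push]
  · simp [Prog.Writes, push]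
  · intro a b s₁ ha hb h21 h22 hc _ hfr
    have h14 : s₁.reg 14 = κ := by rw [hfr 14 (by simp [Prog.Writes, push]), hκ]
    refine Tot.le (T := (1 + (1 + (1 + (1 + (1 + 1 + 1)) + 1))) + 3) (tot_then_push ?_ ?_ ?_)
      (by omega)
    · refine .seq (.flip (.seq (.sub (.ifZero ?_ ?_))))
      · intro h0
        refine .const ⟨?_, ?_⟩
        · simp [h14, h21] at h0
          rw [Nat.sub_eq_zero_iff_le] at h0
          simp only [PlantedEntry, hc, shift_apply, not_lt.2 h0]
          simp
        · simp
      · intro h0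
        refine Tot.le (T := 1 + (1 + 1 + 1)) (.seq (.sub (.ifZero ?_ ?_))) (by norm_num)
        · intro h1
          refine .const ⟨?_, ?_⟩
          · simp [h14, h22] at h1
            rw [Nat.sub_eq_zero_iff_le] at h1
            simp only [PlantedEntry, hc, shift_apply, not_lt.2 h1]
            simp
          · simp
        · intro h1
          refine .const ⟨?_, ?_⟩
          · simp [h14, h21] at h0
            simp [h14, h22] at h1
            have h2 : a < κ ∧ b < κ := by omega
            simp [PlantedEntry, h2]
          · simp
    · simp [Prog.StoreFree]
    · simp [Prog.Writes]
  · rintro s' ⟨h1, h2⟩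
    exact ⟨h1, by rw [h2, mul_one]⟩

open Classical in
/-- `v` if `p` holds, and `0` otherwise. -/
noncomputable def keepIf (p : Prop) (v : ℕ) : ℕ := if p then v else 0

theorem keepIf_pos {p : Prop} (h : p) (v : ℕ) : keepIf p v = v := if_pos h

theorem keepIf_neg {p : Prop} (h : ¬ p) (v : ℕ) : keepIf p v = 0 := if_neg h

/-- Reflexive adjacency of vertices below `N`, read off from the part of an adjacency matrix
above the diagonal. -/
def ReflAdj (N : ℕ) (E : ℕ → ℕ → Prop) (u v : ℕ) : Prop :=
  u < N ∧ v < N ∧ (u = v ∨ E (min u v) (max u v))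

/-- Set register `31` to `0` unless `R[32]` and `R[33]` are equal or adjacent in the graph whose
adjacency matrix is stored at address `R[15]`. -/
def testAdj : Prog :=
  .sub 27 0 32 ;; .ifZero 27 (.const 31 0) (
  .sub 27 0 33 ;; .ifZero 27 (.const 31 0) (
  .sub 27 32 33 ;; .sub 28 33 32 ;; .add 29 27 28 ;; .ifZero 29 (.const 29 0) (
  .sub 34 32 27 ;; .add 35 32 28 ;; .const 42 0 ;; .add 36 15 42 ;; addMul 36 0 37 34 ;;
  .add 36 36 35 ;; .load 36 36 ;; .ifZero 36 (.const 31 0) (.const 29 0))))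

/-- Sampled numbers may be `N` or larger; these are adjacent to nothing, not even to themselves.
Only entries above the diagonal are consulted, because a generated matrix is not symmetric; the
minimum and the maximum of the two vertices come from truncated differences. -/
theorem tot_testAdj (ω : ℕ → Bool) (s : State) {N : ℕ} (hN : s.reg 0 = N) :
    Tot ω testAdj s (5 * N + 30) (fun s' => s'.reg 31 =
      keepIf (ReflAdj N (fun u v => s.mem (s.reg 15 + (u * N + v)) ≠ 0) (s.reg 32) (s.reg 33))
        (s.reg 31)) := by
  unfold keepIf
  set u := s.reg 32 with hu
  set v := s.reg 33 with hv
  refine Tot.le (.seq (.sub (.ifZero (T := 1) (T' := 5 * N + 25) ?_ ?_))) (by omega)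
  · intro h0
    refine .const ?_
    simp [hN, ← hu] at h0
    rw [Nat.sub_eq_zero_iff_le] at h0
    simp [ReflAdj, not_lt.2 h0]
  · intro h0
    refine Tot.le (.seq (.sub (.ifZero (T := 1) (T' := 5 * N + 20) ?_ ?_))) (by omega)
    · intro h1
      refine .const ?_
      simp [hN, ← hv] at h1
      rw [Nat.sub_eq_zero_iff_le] at h1
      simp [ReflAdj, not_lt.2 h1]
    · intro h1
      simp [hN, ← hu] at h0
      simp [hN, ← hv] at h1
      refine Tot.le (.seq (.sub (.seq (.sub (.seq (.add (.ifZero (T := 1) (T' := 5 * N + 15)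
        ?_ ?_))))))) (by omega)
      · intro h2
        refine .const ?_
        simp [← hu, ← hv] at h2
        have : u = v := by omega
        have h3 : v < N := by omega
        simp [ReflAdj, this, h3]
      · intro h2
        simp [← hu, ← hv] at h2
        have huv : u ≠ v := by omega
        refine Tot.le (.seq (.sub (.seq (.add (.seq (.const (.seq (.add
          (.seq_of (T₁ := 3 + N * 5) (Q' := fun s₁ => s₁.reg 36 = s.reg 15 + min u v * N ∧
            s₁.reg 35 = max u v ∧ s₁.reg 31 = s.reg 31 ∧ s₁.mem = s.mem)
            ?_ ?_))))))))) (T := 1 + (1 + (1 + (1 + (3 + N * 5 +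
              (1 + (1 + (1 + 1 + 1)))))))) (by omega)
        · have hmin : u - (u - v) = min u v := by omega
          have hmax : u + (v - u) = max u v := by omega
          refine ((Tot.le (tot_addMul ω _ (by norm_num)) ?_).frame.mem_frame ?_).imp ?_
          · simp [← hu, ← hv, hmin]
            left; omega
          · simp [addMul, storeFree_forUp, Prog.StoreFree]
          · rintro s₁ ⟨⟨h3, h4⟩, h5⟩
            refine ⟨?_, ?_, ?_, ?_⟩
            · simp [h3, ← hu, ← hv, hmin, hN]
            · rw [h4 35 (by simp [addMul, writes_forUp, Prog.Writes])]
              simp [← hu, ← hv, hmax]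
            · rw [h4 31 (by simp [addMul, writes_forUp, Prog.Writes])]
              simp
            · simp [h5]
        · rintro s₁ ⟨h3, h4, h5, h6⟩
          refine .seq (.add (.seq (.load (.ifZero ?_ ?_))))
          · intro h7
            refine .const ?_
            simp [h3, h4, h6, add_assoc] at h7
            simp [ReflAdj, huv, h7]
          · intro h7
            refine .const ?_
            simp [h3, h4, h6, add_assoc] at h7
            have h8 : u < N := by omega
            have h9 : v < N := by omega
            simp [ReflAdj, h8, h9, h7, h5]

end RAM

/-! ### The reduction on one graph -/

namespace RAM

/-- Register `31` accumulates a conjunction, since the body either keeps it or clears it. -/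
theorem tot_forAll {ω : ℕ → Bool} {body : Prog} {s : State} {i bnd n T : ℕ}
    (R : ℕ → Prop) (hn : s.reg bnd = n) (hi : i ≠ 9 ∧ i ≠ 31 ∧ ¬ body.Writes i)
    (hb : bnd ≠ 9 ∧ bnd ≠ i ∧ ¬ body.Writes bnd) (hp : body.StoreFree)
    (step : ∀ j s₁, j < n → s₁.reg i = j → s₁.mem = s.mem →
      (∀ x, ¬ (x = i ∨ x = 9 ∨ body.Writes x) → s₁.reg x = s.reg x) →
      Tot ω body s₁ T (fun s₂ => s₂.reg 31 = keepIf (R j) (s₁.reg 31))) :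
    Tot ω (forUp i bnd body) s (3 + n * (T + 4)) (fun s' =>
      s'.reg 31 = keepIf (∀ j < n, R j) (s.reg 31)) := by
  refine (Tot.forUp (T := T) (fun j s' => s'.reg 31 = keepIf (∀ k < j, R k) (s.reg 31) ∧
    s'.mem = s.mem) hn ⟨hi.1, hi.2.2⟩ hb ?_ ?_ ?_).imp fun s' h => h.1
  · rintro j s₁ s₂ ⟨h1, h2⟩ hm _ hr
    exact ⟨by rw [hr 31 hi.2.1.symm (by norm_num), h1], by rw [hm, h2]⟩
  · exact ⟨by rw [keepIf_pos (by simp)], rfl⟩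
  · rintro j s₁ hj ⟨h1, h2⟩ h3 hfr
    refine ((step j s₁ hj h3 h2 hfr).mem_frame hp).imp ?_
    rintro s₂ ⟨h4, h5⟩
    refine ⟨?_, h5.trans h2⟩
    rw [h4, h1]
    by_cases hR : R j
    · rw [keepIf_pos hR]
      congr 1
      simp only [Nat.lt_succ_iff_lt_or_eq, or_imp, forall_and, forall_eq, hR, and_true]
    · rw [keepIf_neg hR, keepIf_neg]
      exact fun h => hR (h j (Nat.lt_succ_self j))

/-- Set register `31` to `0` unless all vertices of the tuple at address `R[38]` are adjacent to
all vertices of the tuple at address `R[39]`. -/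
def testTuples : Prog :=
  forUp 23 10 (forUp 24 10 (.add 32 38 23 ;; .load 32 32 ;; .add 33 39 24 ;; .load 33 33 ;;
    testAdj))

theorem storeFree_addMul (d a i bnd : ℕ) : (addMul d a i bnd).StoreFree := by
  simp [addMul, storeFree_forUp, Prog.StoreFree]

theorem coinFree_addMul (d a i bnd : ℕ) : (addMul d a i bnd).CoinFree := by
  simp [addMul, coinFree_forUp, Prog.CoinFree]

theorem writes_addMul (d a i bnd x : ℕ) :
    (addMul d a i bnd).Writes x ↔ x = i ∨ x = 9 ∨ x = d := by
  simp [addMul, writes_forUp, Prog.Writes]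

theorem storeFree_testAdj : testAdj.StoreFree := by
  simp [testAdj, Prog.StoreFree, storeFree_addMul]

theorem coinFree_testAdj : testAdj.CoinFree := by
  simp [testAdj, Prog.CoinFree, coinFree_addMul]

theorem storeFree_testTuples : testTuples.StoreFree := by
  simp [testTuples, Prog.StoreFree, storeFree_forUp, storeFree_testAdj]

theorem coinFree_testTuples : testTuples.CoinFree := by
  simp [testTuples, Prog.CoinFree, coinFree_forUp, coinFree_testAdj]

theorem tot_testTuples (ω : ℕ → Bool) (s : State) {N l : ℕ} (hN : s.reg 0 = N)
    (hl : s.reg 10 = l) :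
    Tot ω testTuples s (3 + l * ((3 + l * ((5 * N + 34) + 4)) + 4)) (fun s' => s'.reg 31 =
      keepIf (∀ x < l, ∀ y < l, ReflAdj N (fun u v => s.mem (s.reg 15 + (u * N + v)) ≠ 0)
        (s.mem (s.reg 38 + x)) (s.mem (s.reg 39 + y))) (s.reg 31)) := by
  refine tot_forAll (bnd := 10) (i := 23) (T := 3 + l * ((5 * N + 34) + 4))
    (fun x => ∀ y < l, ReflAdj N (fun u v => s.mem (s.reg 15 + (u * N + v)) ≠ 0)
        (s.mem (s.reg 38 + x)) (s.mem (s.reg 39 + y))) hl (by decide) (by decide) ?_ ?_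
  · simp [Prog.StoreFree, storeFree_forUp, storeFree_testAdj]
  · intro x s₁ hx h23 hm hfr
    refine tot_forAll (bnd := 10) (i := 24) (T := 5 * N + 34) (n := l)
      (fun y => ReflAdj N (fun u v => s.mem (s.reg 15 + (u * N + v)) ≠ 0)
        (s.mem (s.reg 38 + x)) (s.mem (s.reg 39 + y))) ?_ (by decide) (by decide) ?_ ?_
    · rw [hfr 10 (by decide), hl]
    · simp [Prog.StoreFree, storeFree_testAdj]
    · intro y s₂ hy h24 hm2 hfr2
      have h38 : s₂.reg 38 = s.reg 38 := by rw [hfr2 38 (by decide), hfr 38 (by decide)]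
      have h39 : s₂.reg 39 = s.reg 39 := by rw [hfr2 39 (by decide), hfr 39 (by decide)]
      have h0 : s₂.reg 0 = N := by rw [hfr2 0 (by decide), hfr 0 (by decide), hN]
      have h15 : s₂.reg 15 = s.reg 15 := by rw [hfr2 15 (by decide), hfr 15 (by decide)]
      have h23' : s₂.reg 23 = x := by rw [hfr2 23 (by decide), h23]
      refine Tot.le (T := 1 + (1 + (1 + (1 + (5 * N + 30))))) ?_ (by omega)
      refine .seq (.add (.seq (.load (.seq (.add (.seq (.load ?_)))))))
      refine (tot_testAdj ω _ (N := N) ?_).imp ?_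
      · simp [h0]
      · intro s₃ h3
        rw [h3]
        simp [hm2, hm, h38, h39, h15, h23', h24]

/-- The entry in row `a` and column `b` of the matrix: in the first `n` rows the adjacency of two
tuples and a coin flip, and below an identity matrix. -/
def Entry (N l n B : ℕ) (E : ℕ → ℕ → Prop) (ω : ℕ → Bool) (a b : ℕ) : Prop :=
  if a < n then ω (2 * n * (l * B) + (a * n + b)) = true ∧ ∀ x < l, ∀ y < l,
    ReflAdj N E (vertexOf B ω (a * l + x)) (vertexOf B ω ((n + b) * l + y))
  else a = n + b

theorem reflAdj_congr {N : ℕ} {E E' : ℕ → ℕ → Prop}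
    (h : ∀ u v, u < N → v < N → (E u v ↔ E' u v)) (u v : ℕ) :
    ReflAdj N E u v ↔ ReflAdj N E' u v := by
  unfold ReflAdj
  refine and_congr_right fun hu => and_congr_right fun hv => or_congr Iff.rfl ?_
  exact h _ _ (by omega) (by omega)

theorem entry_congr {N l n B : ℕ} {E E' : ℕ → ℕ → Prop} {ω : ℕ → Bool} {a b : ℕ}
    (h : ∀ u v, u < N → v < N → (E u v ↔ E' u v)) :
    Entry N l n B E ω a b ↔ Entry N l n B E' ω a b := by
  simp only [Entry, reflAdj_congr h]

/-- Put the matrix entry in row `R[21]` and column `R[22]` into register `31`. -/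
def computeEntry : Prog :=
  .flip 31 ;; .sub 27 11 21 ;; .ifZero 27
    (.add 28 11 22 ;; .sub 27 28 21 ;; .sub 29 21 28 ;; .add 27 27 29 ;;
      .ifZero 27 (.const 31 1) (.const 31 0))
    (.const 42 0 ;; .add 38 30 42 ;; addMul 38 10 37 21 ;; .add 39 30 42 ;; .add 43 11 22 ;;
      addMul 39 10 37 43 ;; testTuples)

theorem storeFree_computeEntry : computeEntry.StoreFree := by
  simp [computeEntry, Prog.StoreFree, storeFree_addMul, storeFree_testTuples]

/-- Time bound for `computeEntry`. -/
def entryTime (N l n : ℕ) : ℕ := 3 + l * ((3 + l * ((5 * N + 34) + 4)) + 4) + 15 * n + 30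

-- The coin is flipped before the row is examined, so rows of the identity block use one coin per
-- entry as well. In the upper half the coin stays in register `31`, and the adjacency tests can
-- only clear it.
open Classical in
theorem tot_computeEntry (ω₀ ω : ℕ → Bool) (s : State) {N l n B a b U c : ℕ} (hN : s.reg 0 = N)
    (hl : s.reg 10 = l) (hn : s.reg 11 = n) (hU : s.reg 30 = U) (ha : s.reg 21 = a)
    (hb : s.reg 22 = b) (ha' : a < 2 * n) (hb' : b < n) (hω : ω = shift c ω₀)
    (hc : s.coins = c + (2 * n * (l * B) + (a * n + b)))
    (hT : ∀ x < 2 * n * l, s.mem (U + x) = vertexOf B ω x) :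
    Tot ω₀ computeEntry s (entryTime N l n) (fun s' => (s'.reg 31 =
      if Entry N l n B (fun u v => s.mem (s.reg 15 + (u * N + v)) ≠ 0) ω a b then 1 else 0) ∧
      s'.coins = s.coins + 1) := by
  have hcoin : ω₀ s.coins = ω (2 * n * (l * B) + (a * n + b)) := by rw [hω, hc]; rfl
  unfold entryTime
  refine Tot.le (.seq (.flip (.seq (.sub (.ifZero (T := 7)
    (T' := 3 + l * ((3 + l * ((5 * N + 34) + 4)) + 4) + 15 * n + 10) ?_ ?_))))) (by omega)
  · intro h0
    simp [hn, ha, Nat.sub_eq_zero_iff_le] at h0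
    refine Tot.le (.seq (.add (.seq (.sub (.seq (.sub (.seq (.add (.ifZero (T := 1) (T' := 1)
      ?_ ?_))))))))) (by omega)
    · intro h1
      refine .const ⟨?_, by simp⟩
      simp [hn, ha, hb] at h1
      -- Equality is detected by the sum of both truncated differences being zero.
      have h2 : a = n + b := by omega
      have h3 : ¬ a < n := by omega
      simp [Entry, h2]
    · intro h1
      refine .const ⟨?_, by simp⟩
      simp [hn, ha, hb] at h1
      have h2 : ¬ a = n + b := by omega
      have h3 : ¬ a < n := by omega
      simp [Entry, h2, h3]
  · intro h0
    simp [hn, ha] at h0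
    have han : a < n := by omega
    refine Tot.le (.seq (.const (.seq (.add (.seq_of (T₁ := 3 + 5 * n)
      (T₂ := 1 + (1 + ((3 + 10 * n) + (3 + l * ((3 + l * ((5 * N + 34) + 4)) + 4)))))
      (Tot.le ((((tot_addMul ω₀ _ (by norm_num)).frame).mem_frame
      (storeFree_addMul _ _ _ _)).coins_frame (coinFree_addMul _ _ _ _)) ?_) ?_)))))
      (by omega)
    · simp [ha]
      omega
    rintro s₁ ⟨⟨⟨h38, hr1⟩, hm1⟩, hc1⟩
    simp only [writes_addMul] at hr1
    refine .seq (.add (.seq (.add (.seq_of (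
      Tot.le ((((tot_addMul ω₀ _ (by norm_num)).frame).mem_frame
      (storeFree_addMul _ _ _ _)).coins_frame (coinFree_addMul _ _ _ _)) ?_) ?_))))
    · simp [hr1, hn, hb]
      omega
    rintro s₂ ⟨⟨⟨h39, hr2⟩, hm2⟩, hc2⟩
    simp only [writes_addMul] at hr2
    simp [hr1, hn, hb, hl, hU] at h39
    simp [ha, hl, hU] at h38
    refine (((tot_testTuples ω₀ s₂ (N := N) (l := l) ?_ ?_).coins_frame
      coinFree_testTuples).imp ?_)
    · simp [hr2, hr1, hN]
    · simp [hr2, hr1, hl]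
    · rintro s₃ ⟨h31, hc3⟩
      constructor
      · rw [h31]
        have e38 : s₂.reg 38 = U + a * l := by simp [hr2, h38]
        have e39 : s₂.reg 39 = U + (n + b) * l := h39
        have e31 : s₂.reg 31 = if ω (2 * n * (l * B) + (a * n + b)) = true then 1 else 0 := by
          simp [hr2, hr1, hcoin]
        have e15 : s₂.reg 15 = s.reg 15 := by simp [hr2, hr1]
        have emem : s₂.mem = s.mem := by simp [hm2, hm1]
        have hx : ∀ x < l, s₂.mem (s₂.reg 38 + x) = vertexOf B ω (a * l + x) := by
          intro x hx
          rw [e38, emem, add_assoc, hT]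
          have := Nat.mul_le_mul_right l (show a + 1 ≤ 2 * n by omega)
          rw [add_mul] at this
          omega
        have hy : ∀ y < l, s₂.mem (s₂.reg 39 + y) = vertexOf B ω ((n + b) * l + y) := by
          intro y hy
          rw [e39, emem, add_assoc, hT]
          have := Nat.mul_le_mul_right l (show n + b + 1 ≤ 2 * n by omega)
          rw [add_mul _ 1] at this
          omega
        have key : (∀ x < l, ∀ y < l,
            ReflAdj N (fun u v => s₂.mem (s₂.reg 15 + (u * N + v)) ≠ 0)
              (s₂.mem (s₂.reg 38 + x)) (s₂.mem (s₂.reg 39 + y))) ↔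
            ∀ x < l, ∀ y < l, ReflAdj N (fun u v => s.mem (s.reg 15 + (u * N + v)) ≠ 0)
              (vertexOf B ω (a * l + x)) (vertexOf B ω ((n + b) * l + y)) := by
          refine forall₂_congr fun x hx' => forall₂_congr fun y hy' => ?_
          rw [hx x hx', hy y hy', e15, emem]
        rw [key, e31]
        simp only [Entry, if_pos han]
        by_cases h1 : ω (2 * n * (l * B) + (a * n + b)) = true
        · rw [if_pos h1]; simp [h1, keepIf]
        · rw [if_neg h1]; simp [h1, keepIf]
      · rw [hc3, hc2]
        simp [hc1]

/-- Append the matrix. -/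
def buildMatrix : Prog := forUp 21 12 (forUp 22 11 (computeEntry ;; push))

/-- Time bound for `buildMatrix`. -/
def matrixTime (N l n : ℕ) : ℕ := 3 + 2 * n * ((3 + n * ((entryTime N l n + 3) + 4)) + 4)

open Classical in
theorem tot_buildMatrix (ω₀ ω : ℕ → Bool) (s : State) {N l n B U c : ℕ} (hN : s.reg 0 = N)
    (hl : s.reg 10 = l) (hn : s.reg 11 = n) (hn2 : s.reg 12 = 2 * n) (hU : s.reg 30 = U)
    (hω : ω = shift c ω₀) (hc : s.coins = c + 2 * n * (l * B))
    (hU2 : U + 2 * n * l ≤ s.reg 2) (hg : s.reg 15 + N * N ≤ s.reg 2)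
    (hT : ∀ x < 2 * n * l, s.mem (U + x) = vertexOf B ω x) :
    Tot ω₀ buildMatrix s (matrixTime N l n) (fun s' =>
      Pushed s s' (2 * n * n) (fun x =>
        if Entry N l n B (fun u v => s.mem (s.reg 15 + (u * N + v)) ≠ 0) ω (x / n) (x % n)
        then 1 else 0) ∧ s'.coins = s.coins + 2 * n * n) := by
  unfold matrixTime
  refine (tot_pushGrid (K := 1) (T := entryTime N l n + 3)
    (fun a b => if Entry N l n B (fun u v => s.mem (s.reg 15 + (u * N + v)) ≠ 0) ω a b
      then 1 else 0) hn2 hn ?_ ?_ ?_ ?_ ?_).imp ?_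
  · decide
  · decide
  · decide
  · decide
  · intro a b s₁ ha hb h21 h22 hc1 hm1 hfr
    have h30 : s₁.reg 30 = U := by rw [hfr 30 (by decide), hU]
    refine tot_then_push ((tot_computeEntry ω₀ ω s₁ (N := N) (l := l) (n := n) (B := B) (a := a)
      (b := b) (U := U) (c := c) ?_ ?_ ?_ h30 h21 h22 ha hb hω ?_ ?_).imp ?_) ?_ ?_
    · rw [hfr 0 (by decide), hN]
    · rw [hfr 10 (by decide), hl]
    · rw [hfr 11 (by decide), hn]
    · rw [hc1, hc]; ring
    · intro x hx
      rw [hm1 _ (by omega), hT x hx]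
    · rintro s₂ ⟨h1, h2⟩
      refine ⟨?_, h2⟩
      rw [h1]
      refine if_congr ?_ rfl rfl
      have hE : ∀ u v, u < N → v < N → (s₁.mem (s₁.reg 15 + (u * N + v)) ≠ 0 ↔
          s.mem (s.reg 15 + (u * N + v)) ≠ 0) := by
        intro u v hu hv
        have h15 := hfr 15 (by decide)
        have := Nat.mul_le_mul_right N (show u + 1 ≤ N by omega)
        rw [add_mul] at this
        rw [h15, hm1 _ (by omega)]
      exact entry_congr hE
    · exact storeFree_computeEntry
    · decide
  · rintro s' ⟨h1, h2⟩
    exact ⟨h1, by rw [h2, mul_one, mul_assoc]⟩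


open Classical in
/-- The binary matrix with the entries `Entry`. -/
noncomputable def entryMatrix (N l n B : ℕ) (E : ℕ → ℕ → Prop) (ω : ℕ → Bool) :
    Fin (2 * n) → Fin n → Bool :=
  fun a b => decide (Entry N l n B E ω a b)

theorem entryMatrix_eq_true {N l n B : ℕ} {E : ℕ → ℕ → Prop} {ω : ℕ → Bool} {a : Fin (2 * n)}
    {b : Fin n} : entryMatrix N l n B E ω a b = true ↔ Entry N l n B E ω a b := by
  simp [entryMatrix]

/-- Row `n + b` of the identity block meets column `b` only. This is the purpose of the lower half:
the matrix is a legal input whatever the graph and the coins. -/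
theorem injective_concept_entryMatrix (N l n B : ℕ) (E : ℕ → ℕ → Prop) (ω : ℕ → Bool) :
    Function.Injective (Learning.concept (entryMatrix N l n B E ω)) := by
  intro b b' h
  have hb := b.2
  have h1 : (⟨n + b, by omega⟩ : Fin (2 * n)) ∈
      Learning.concept (entryMatrix N l n B E ω) b' := by
    rw [← h]
    simp [Learning.concept, entryMatrix_eq_true, Entry]
  simp [Learning.concept, entryMatrix_eq_true, Entry] at h1
  exact Fin.ext h1

/-- The coin-free program `P` computes `val M` for every matrix `M` that describes a concept class,
in time polynomial in the size of the matrix. -/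
def Computes (P : Prog) (T : Polynomial ℕ)
    (val : ∀ m k : ℕ, (Fin m → Fin k → Bool) → ℕ) : Prop :=
  P.CoinFree ∧ ∀ (m k : ℕ) (M : Fin m → Fin k → Bool), 0 < m → 0 < k →
    Function.Injective (Learning.concept M) →
      ∃ (t : ℕ) (s : State), Exec (fun _ => false) P (inputState m k fun x j => M x j = true) t s ∧
        t ≤ T.eval (m * k) ∧ s.reg 0 = val m k M

/-- Write the matrix for the graph at address `R[15]`; its address is put into register `40`. -/
def writeInstance : Prog :=
  .const 42 0 ;; .add 30 2 42 ;; sampleTuples ;; .const 42 0 ;; .add 40 2 42 ;; buildMatrix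

/-- The number of coin flips of `writeInstance`. -/
def coinCount (l n B : ℕ) : ℕ := 2 * n * (l * B) + 2 * n * n

/-- Time bound for `writeInstance`. -/
def writeTime (N l n B : ℕ) : ℕ :=
  4 + (3 + 2 * n * ((3 + l * ((4 + B * 7 + 3) + 4)) + 4)) + matrixTime N l n

-- The address of the graph is a parameter because the same routine serves the input, stored at
-- address `0`, and the planted graphs generated above it.
open Classical in
theorem tot_writeInstance (ω : ℕ → Bool) (s : State) {N l n B : ℕ} (hN : s.reg 0 = N)
    (hB : s.reg 5 = B) (hl : s.reg 10 = l) (hn : s.reg 11 = n) (hn2 : s.reg 12 = 2 * n)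
    (hg : s.reg 15 + N * N ≤ s.reg 2) :
    Tot ω writeInstance s (writeTime N l n B) (fun s' =>
      s.reg 2 ≤ s'.reg 40 ∧ s'.reg 2 = s'.reg 40 + 2 * n * n ∧
      (∀ x < s.reg 2, s'.mem x = s.mem x) ∧
      (∀ x < 2 * n * n, s'.mem (s'.reg 40 + x) =
        if Entry N l n B (fun u v => s.mem (s.reg 15 + (u * N + v)) ≠ 0) (shift s.coins ω)
          (x / n) (x % n) then 1 else 0) ∧
      (∀ x, s'.reg 2 ≤ x → s'.mem x = s.mem x) ∧
      s'.coins = s.coins + coinCount l n B) := by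
  unfold writeTime
  refine Tot.le (.seq (.const (.seq (.add (.seq_of
    (tot_sampleTuples ω _ (B := B) (l := l) (m := 2 * n) ?_ ?_ ?_).frame ?_)))))
      (T := 1 + (1 + (_ + (1 + (1 + matrixTime N l n))))) (by omega)
  · simp [hB]
  · simp [hl]
  · simp [hn2]
  rintro s₁ ⟨⟨h1, h2⟩, hfr⟩
  have hs2 : s₁.reg 2 = s.reg 2 + 2 * n * l := by simpa using h1.1
  have hs30 : s₁.reg 30 = s.reg 2 := by rw [hfr 30 (by decide)]; simp
  refine .seq (.const (.seq (.add ?_)))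
  have e : ∀ x, x ≠ 30 → x ≠ 40 → x ≠ 42 → ¬ sampleTuples.Writes x →
      ((s₁.setReg 42 0).setReg 40 ((s₁.setReg 42 0).reg 2 + (s₁.setReg 42 0).reg 42)).reg x =
        s.reg x := by
    intro x hx1 hx2 hx3 hx
    have := hfr x hx
    simp [hx1, hx3] at this
    simp [hx2, hx3, this]
  refine ((tot_buildMatrix ω (shift s.coins ω) _ (N := N) (l := l) (n := n) (B := B)
    (U := s.reg 2) (c := s.coins) ?_ ?_ ?_ ?_ ?_ rfl ?_ ?_ ?_ ?_).frame).imp ?_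
  · rw [e 0 (by decide) (by decide) (by decide) (by decide), hN]
  · rw [e 10 (by decide) (by decide) (by decide) (by decide), hl]
  · rw [e 11 (by decide) (by decide) (by decide) (by decide), hn]
  · rw [e 12 (by decide) (by decide) (by decide) (by decide), hn2]
  · simp [hs30]
  · simp [h2]
  · simp [hs2]
  · rw [e 15 (by decide) (by decide) (by decide) (by decide)]
    simp [hs2]; omega
  · intro x hx
    have := h1.mem_add hx
    simpa using this
  · rintro s₂ ⟨⟨h3, h4⟩, hfr2⟩
    have h40 : s₂.reg 40 = s₁.reg 2 := by rw [hfr2 40 (by decide)]; simp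
    have hlt1 : ∀ x < s.reg 2, s₁.mem x = s.mem x := by
      intro x hx
      have := h1.mem_lt x (by simpa using hx)
      simpa using this
    have hlt2 : ∀ x < s₁.reg 2, s₂.mem x = s₁.mem x := by
      intro x hx
      have := h3.mem_lt x (by simpa using hx)
      simpa using this
    have h23 : s₂.reg 2 = s₁.reg 2 + 2 * n * n := by simpa using h3.1
    refine ⟨by omega, by rw [h40, h23], ?_, ?_, ?_, ?_⟩
    · intro x hx
      rw [hlt2 x (by omega), hlt1 x hx]
    · intro x hx
      have h5 := h3.mem_add hx
      rw [h40]
      have e2 : ((s₁.setReg 42 0).setReg 40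
        ((s₁.setReg 42 0).reg 2 + (s₁.setReg 42 0).reg 42)).reg 2 = s₁.reg 2 := by simp
      rw [e2] at h5
      rw [h5]
      refine if_congr (entry_congr fun u v hu hv => ?_) rfl rfl
      rw [e 15 (by decide) (by decide) (by decide) (by decide)]
      have := Nat.mul_le_mul_right N (show u + 1 ≤ N by omega)
      rw [add_mul] at this
      rw [← hlt1 _ (by omega)]
      simp
    · intro x hx
      have h5 := h3.2 x
      have h6 := h1.2 x
      rw [h5, if_neg (by simp; omega)]
      simp only [State.setReg_mem]
      rw [h6, if_neg (by simp; omega)]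
      simp
    · rw [h4, coinCount]
      simp [h2]
      ring

/-- Run `P` on the matrix at address `R[40]`, and put `1` into register `16` if the result times
`R[8]` exceeds `R[7]`, and `0` otherwise. -/
def evalInstance (P : Prog) : Prog :=
  clear (P.bound + 2) ;; .const 42 0 ;; .add 64 12 42 ;; .add 65 11 42 ;; reloc P ;;
    .const 16 0 ;; addMul 16 64 23 8 ;; .sub 16 16 7 ;; .ifZero 16 (.const 16 0) (.const 16 1)

/-- Time bound for `evalInstance`. -/
def evalTime (P : Prog) (T : Polynomial ℕ) (n r : ℕ) : ℕ :=
  (P.bound + 3) + 3 + 6 * T.eval (2 * n * n) + 1 + (3 + r * 5) + 4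

theorem writes_evalInstance {P : Prog} {x : ℕ} (h : (evalInstance P).Writes x) :
    x = 2 ∨ x = 9 ∨ x = 16 ∨ x = 23 ∨ x = 41 ∨ x = 42 ∨ 64 ≤ x := by
  simp only [evalInstance, Prog.Writes, writes_addMul] at h
  casesm* _ ∨ _
  all_goals first
    | omega
    | (have := writes_clear (x := x) (by assumption); omega)
    | (have := writes_reloc (x := x) (by assumption); omega)

/-- Hypothesis `hmem` concerns all addresses: the memory beyond the matrix is still zero, so the
relocated program sees exactly its own initial state. No coins are used, since `P` has none. -/
theorem tot_evalInstance {P : Prog} {T : Polynomial ℕ}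
    {val : ∀ m k : ℕ, (Fin m → Fin k → Bool) → ℕ} (hP : Computes P T val) (ω : ℕ → Bool)
    (s : State) {n r θ : ℕ} (M : Fin (2 * n) → Fin n → Bool) (hn0 : 0 < n)
    (hM : Function.Injective (Learning.concept M))
    (hθ : s.reg 7 = θ) (hr : s.reg 8 = r) (hn : s.reg 11 = n) (hn2 : s.reg 12 = 2 * n)
    (hbase : s.reg 40 ≤ s.reg 2) (htop : ∀ x, s.reg 2 ≤ x → s.mem x = 0)
    (hmem : ∀ x, s.mem (s.reg 40 + x) = (inputState (2 * n) n fun x j => M x j = true).mem x) :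
    Tot ω (evalInstance P) s (evalTime P T n r) (fun s' =>
      s'.reg 16 = keepIf (θ < r * val (2 * n) n M) 1 ∧ s.reg 2 ≤ s'.reg 2 ∧
      (∀ x < s.reg 40, s'.mem x = s.mem x) ∧ (∀ x, s'.reg 2 ≤ x → s'.mem x = 0) ∧
      s'.coins = s.coins) := by
  obtain ⟨hc, hP⟩ := hP
  obtain ⟨t, sf, hx, ht, hv⟩ := hP (2 * n) n M (by omega) hn0 hM
  have hcf : (evalInstance P).CoinFree := by
    simp [evalInstance, Prog.CoinFree, coinFree_clear, coinFree_reloc, coinFree_addMul]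
  suffices H : Tot ω (evalInstance P) s (evalTime P T n r) (fun s' =>
      s'.reg 16 = keepIf (θ < r * val (2 * n) n M) 1 ∧ s.reg 2 ≤ s'.reg 2 ∧
      (∀ x < s.reg 40, s'.mem x = s.mem x) ∧ (∀ x, s'.reg 2 ≤ x → s'.mem x = 0)) from
    (H.coins_frame hcf).imp fun s' h => ⟨h.1.1, h.1.2.1, h.1.2.2.1, h.1.2.2.2, h.2⟩
  refine Tot.le (.seq_of (((tot_clear ω (P.bound + 2) s).frame).mem_frame (storeFree_clear _)) ?_)
    (T := (P.bound + 2 + 1) + (1 + (1 + (1 + (6 * t + (1 + ((3 + r * 5) + (1 + (1 + 1 + 1)))))))))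
    (by unfold evalTime; omega)
  rintro s₁ ⟨⟨h64, hfr⟩, hm⟩
  have hfr1 : ∀ x, x < 64 → x ≠ 42 → s₁.reg x = s.reg x := by
    intro x h1 h2
    refine hfr x fun h => ?_
    have := writes_clear h
    omega
  refine .seq (.const (.seq (.add (.seq (.add (.seq_of
    ((exec_reloc (ω' := ω) hx hc (R := P.bound + 2) (by omega) _ (base := s.reg 40) ?_).frame)
      ?_))))))
  · refine ⟨?_, ?_, ?_, ?_, ?_⟩
    · simp [hfr1]
    · simp [hfr1, hbase]
    · intro i hi
      have := h64 i hi
      by_cases h0 : i = 0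
      · subst h0
        simp [inputState, hfr1, hn2]
      · by_cases h1 : i = 1
        · subst h1
          simp [inputState, hfr1, hn]
        · have e1 : i + 64 ≠ 64 := by omega
          have e2 : i + 64 ≠ 65 := by omega
          have e3 : i + 64 ≠ 42 := by omega
          simp [inputState, h0, h1, e2, e3, this]
    · intro x
      simp [hm, hmem]
    · intro x hx
      simp [hfr1] at hx
      simp [hm, htop x hx]
  · rintro s₂ ⟨⟨hrep, hlt, hle⟩, hfr2⟩
    have hfr3 : ∀ x, x < 64 → x ≠ 2 → x ≠ 41 → x ≠ 42 → s₂.reg x = s.reg x := by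
      intro x h1 h2 h3 h4
      rw [hfr2 x fun h => by have := writes_reloc h; omega]
      have e1 : x ≠ 64 := by omega
      have e2 : x ≠ 65 := by omega
      simp [e1, e2, h4, hfr1 x h1]
    refine .seq (.const (.seq_of (T₁ := 3 + r * 5) (Tot.le ((((tot_addMul ω _ (by decide)).frame).mem_frame
      (storeFree_addMul _ _ _ _))) ?_) ?_))
    · simp [hfr3, hr]
    · rintro s₃ ⟨⟨h16, hfr4⟩, hm4⟩
      simp only [writes_addMul] at hfr4
      have hv' : s₂.reg 64 = val (2 * n) n M := by
        rw [← hv]; exact hrep.reg_eq 0 (by omega)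
      have h7 : s₃.reg 7 = θ := by rw [hfr4 7 (by decide)]; simp [hfr3, hθ]
      simp [hv', hfr3, hr] at h16
      have hrest : s.reg 2 ≤ s₃.reg 2 ∧ (∀ x < s.reg 40, s₃.mem x = s.mem x) ∧
          ∀ x, s₃.reg 2 ≤ x → s₃.mem x = 0 := by
        have e2 : s₃.reg 2 = s₂.reg 2 := by rw [hfr4 2 (by decide)]; simp
        have em : s₃.mem = s₂.mem := by rw [hm4]; rfl
        rw [e2, em]
        refine ⟨?_, ?_, hrep.mem_top⟩
        · refine le_trans ?_ hle
          simp [hfr1]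
        · intro x hx
          rw [hlt x hx]
          simp [hm]
      refine .seq (.sub (.ifZero ?_ ?_))
      · intro h0
        simp [h16, h7] at h0
        refine .const ⟨?_, by simpa using hrest⟩
        rw [keepIf_neg (by omega)]
        simp
      · intro h0
        simp [h16, h7] at h0
        refine .const ⟨?_, by simpa using hrest⟩
        rw [keepIf_pos (by omega)]
        simp

/-- The reduction is successful: the computed value is too large for a random graph. -/
def Success (val : ∀ m k : ℕ, (Fin m → Fin k → Bool) → ℕ) (N l n B θ r : ℕ)
    (E : ℕ → ℕ → Prop) (ω : ℕ → Bool) : Prop :=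
  θ < r * val (2 * n) n (entryMatrix N l n B E ω)

theorem success_congr {val : ∀ m k : ℕ, (Fin m → Fin k → Bool) → ℕ} {N l n B θ r : ℕ}
    {E E' : ℕ → ℕ → Prop} {ω : ℕ → Bool} (h : ∀ u v, u < N → v < N → (E u v ↔ E' u v)) :
    Success val N l n B θ r E ω ↔ Success val N l n B θ r E' ω := by
  have : entryMatrix N l n B E ω = entryMatrix N l n B E' ω := by
    funext a b
    rw [Bool.eq_iff_iff, entryMatrix_eq_true, entryMatrix_eq_true, entry_congr h]
  rw [Success, Success, this]

/-- Run the reduction on the graph at address `R[15]`, and put `1` or `0` into register `16`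
according to its success. -/
def runStage (P : Prog) : Prog := writeInstance ;; evalInstance P

/-- The parameters of a stage are in the registers, and the memory above `R[2]` is unused. -/
structure Ready (N l n B θ r : ℕ) (s : State) : Prop where
  reg0 : s.reg 0 = N
  reg5 : s.reg 5 = B
  reg7 : s.reg 7 = θ
  reg8 : s.reg 8 = r
  reg10 : s.reg 10 = l
  reg11 : s.reg 11 = n
  reg12 : s.reg 12 = 2 * n
  mem_top : ∀ x, s.reg 2 ≤ x → s.mem x = 0

/-- Time bound for `runStage`. -/
def runTimeBound (P : Prog) (T : Polynomial ℕ) (N l n B r : ℕ) : ℕ :=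
  writeTime N l n B + evalTime P T n r

theorem writes_runStage {P : Prog} {x : ℕ} (h : (runStage P).Writes x) :
    x = 2 ∨ x = 9 ∨ x = 16 ∨ 21 ≤ x := by
  rcases h with h | h
  · by_contra hx
    have h21 : x < 21 := by omega
    revert h
    interval_cases x <;> first | decide | omega
  · have := writes_evalInstance h
    omega

open Classical in
theorem tot_runStage {P : Prog} {T : Polynomial ℕ}
    {val : ∀ m k : ℕ, (Fin m → Fin k → Bool) → ℕ} (hP : Computes P T val) (ω : ℕ → Bool)
    (s : State) {N l n B θ r : ℕ} (hn : 0 < n) (hs : Ready N l n B θ r s)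
    (hg : s.reg 15 + N * N ≤ s.reg 2) :
    Tot ω (runStage P) s (runTimeBound P T N l n B r) (fun s' =>
      Ready N l n B θ r s' ∧ s.reg 2 ≤ s'.reg 2 ∧ (∀ x < s.reg 2, s'.mem x = s.mem x) ∧
      s'.coins = s.coins + coinCount l n B ∧
      s'.reg 16 = keepIf (Success val N l n B θ r
        (fun u v => s.mem (s.reg 15 + (u * N + v)) ≠ 0) (shift s.coins ω)) 1 ∧
      ∀ x, x < 21 → x ≠ 2 → x ≠ 9 → x ≠ 16 → s'.reg x = s.reg x) := by
  have main : Tot ω (runStage P) s (runTimeBound P T N l n B r) (fun s' =>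
      s.reg 2 ≤ s'.reg 2 ∧ (∀ x < s.reg 2, s'.mem x = s.mem x) ∧
      s'.coins = s.coins + coinCount l n B ∧
      s'.reg 16 = keepIf (Success val N l n B θ r
        (fun u v => s.mem (s.reg 15 + (u * N + v)) ≠ 0) (shift s.coins ω)) 1 ∧
      ∀ x, s'.reg 2 ≤ x → s'.mem x = 0) := by
    refine .seq_of (tot_writeInstance ω s hs.reg0 hs.reg5 hs.reg10 hs.reg11 hs.reg12 hg).frame ?_
    rintro s₁ ⟨⟨h1, h2, h3, h4, h5, h6⟩, hfr⟩
    refine (tot_evalInstance hP ω s₁ (entryMatrix N l n B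
      (fun u v => s.mem (s.reg 15 + (u * N + v)) ≠ 0) (shift s.coins ω)) hn
      (injective_concept_entryMatrix ..) (θ := θ) (r := r) ?_ ?_ ?_ ?_ ?_ ?_ ?_).imp ?_
    · rw [hfr 7 (by decide), hs.reg7]
    · rw [hfr 8 (by decide), hs.reg8]
    · rw [hfr 11 (by decide), hs.reg11]
    · rw [hfr 12 (by decide), hs.reg12]
    · omega
    · intro x hx
      rw [h5 x hx]
      exact hs.mem_top x (by omega)
    · intro x
      -- Addresses inside the matrix are decoded by division with remainder; beyond it both sides
      -- are zero.
      by_cases hx : x < 2 * n * n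
      · rw [h4 x hx]
        have hdiv : x / n < 2 * n := Nat.div_lt_of_lt_mul (by rwa [mul_comm])
        have hmod : x % n < n := Nat.mod_lt _ hn
        simp only [inputState, entryMatrix_eq_true]
        refine if_congr ⟨fun h => ?_, ?_⟩ rfl rfl
        · exact ⟨⟨x / n, hdiv⟩, ⟨x % n, hmod⟩, (Nat.div_add_mod' x n).symm, h⟩
        · rintro ⟨i, j, rfl, h⟩
          rw [mul_comm, Nat.mul_add_div hn, Nat.div_eq_of_lt j.2, Nat.mul_add_mod,
            Nat.mod_eq_of_lt j.2, add_zero]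
          exact h
      · rw [h5 _ (by omega), hs.mem_top _ (by omega)]
        simp only [inputState]
        rw [if_neg]
        rintro ⟨i, j, rfl, -⟩
        apply hx
        have := Nat.mul_le_mul_right n (show (i : ℕ) + 1 ≤ 2 * n from i.2)
        rw [add_mul] at this
        have := j.2
        omega
    · rintro s₂ ⟨h7, h8, h9, h10, h11⟩
      refine ⟨by omega, ?_, by rw [h11, h6], h7, h10⟩
      intro x hx
      rw [h9 x (by omega), h3 x hx]
  refine main.frame.imp ?_
  rintro s' ⟨⟨h1, h2, h3, h4, h5⟩, hfr⟩
  have hfr' : ∀ x, x < 21 → x ≠ 2 → x ≠ 9 → x ≠ 16 → s'.reg x = s.reg x := by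
    intro x hx h2 h9 h16
    refine hfr x fun h => ?_
    have := writes_runStage h
    omega
  refine ⟨⟨?_, ?_, ?_, ?_, ?_, ?_, ?_, h5⟩, h1, h2, h3, h4, hfr'⟩
  · rw [hfr' 0 (by decide) (by decide) (by decide) (by decide), hs.reg0]
  · rw [hfr' 5 (by decide) (by decide) (by decide) (by decide), hs.reg5]
  · rw [hfr' 7 (by decide) (by decide) (by decide) (by decide), hs.reg7]
  · rw [hfr' 8 (by decide) (by decide) (by decide) (by decide), hs.reg8]
  · rw [hfr' 10 (by decide) (by decide) (by decide) (by decide), hs.reg10]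
  · rw [hfr' 11 (by decide) (by decide) (by decide) (by decide), hs.reg11]
  · rw [hfr' 12 (by decide) (by decide) (by decide) (by decide), hs.reg12]

end RAM

/-! ### The distinguisher -/

namespace RAM

/-- Compute the parameters of stage `R[8]`. -/
def setParams : Prog :=
  .add 10 8 8 ;; .add 10 10 10 ;; .add 10 10 10 ;; .const 11 1 ;;
    forUp 21 8 (forUp 22 6 (.add 11 11 11)) ;; .add 12 11 11

theorem tot_setParams (ω : ℕ → Bool) (s : State) {r w : ℕ} (hr : s.reg 8 = r) (hw : s.reg 6 = w) :
    Tot ω setParams s (8 + r * ((3 + w * 5) + 4)) (fun s' => s'.reg 10 = 8 * r ∧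
      s'.reg 11 = 2 ^ (r * w) ∧ s'.reg 12 = 2 * 2 ^ (r * w)) := by
  refine Tot.le (.seq (.add (.seq (.add (.seq (.add (.seq (.const (.seq_of
    (T₁ := 3 + r * ((3 + w * 5) + 4)) (Q' := fun s' => s'.reg 11 = 2 ^ (r * w) ∧
      s'.reg 10 = 8 * r) ?_ (fun s' h => .add ?_)))))))))) (by omega)
  · refine ((Tot.forUp (T := 3 + w * 5) (n := r) (fun j s' => s'.reg 11 = 2 ^ (j * w)) ?_
      (by decide) (by decide) ?_ ?_ ?_).frame).imp ?_
    · simp [hr]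
    · intro j s₁ s₂ h _ _ hfr
      rw [hfr 11 (by decide) (by decide), h]
    · simp
    · intro j s₁ hj h1 h2 hfr
      refine (Tot.forUp (T := 1) (n := w) (fun i s' => s'.reg 11 = 2 ^ (j * w + i)) ?_
        (by decide) (by decide) ?_ ?_ ?_).imp ?_
      · rw [hfr 6 (by decide)]; simp [hw]
      · intro j s₁ s₂ h _ _ hfr
        rw [hfr 11 (by decide) (by decide), h]
      · simp [h1]
      · intro i s₂ hi h3 _ _
        refine .add ?_
        simp only [State.setReg_reg, if_true, h3]
        ring
      · intro s₂ h
        rw [h]; ring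
    · rintro s₁ ⟨h1, h2⟩
      refine ⟨h1, ?_⟩
      rw [h2 10 (by decide)]
      simp [hr]
      ring
  · simp [h.1, h.2]
    ring

/-- Generate a random graph with a planted clique on `R[4] + R[19]` vertices, run the reduction
on it, and set register `13` to `0` if it is not successful. -/
def oneTest (P : Prog) : Prog :=
  .add 14 4 19 ;; .const 42 0 ;; .add 15 2 42 ;; sampleGraph ;; runStage P ;;
    .ifZero 16 (.const 13 0) (.const 42 0)

/-- The reduction is successful on a random graph with a clique planted on the first `κ`
vertices. -/
def PlantedSuccess (val : ∀ m k : ℕ, (Fin m → Fin k → Bool) → ℕ) (N l n B θ r κ : ℕ)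
    (ω : ℕ → Bool) : Prop :=
  Success val N l n B θ r (PlantedEntry N κ ω) (shift (N * N) ω)

/-- The number of coin flips of `oneTest`. -/
def testCoins (N l n B : ℕ) : ℕ := N * N + coinCount l n B

/-- Time bound for `oneTest`. -/
def testTime (P : Prog) (T : Polynomial ℕ) (N l n B r : ℕ) : ℕ :=
  3 + (3 + N * ((3 + N * (13 + 4)) + 4)) + runTimeBound P T N l n B r + 3

theorem writes_oneTest {P : Prog} {x : ℕ} (h : (oneTest P).Writes x) :
    x = 2 ∨ x = 9 ∨ x = 13 ∨ x = 14 ∨ x = 15 ∨ x = 16 ∨ 21 ≤ x := by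
  simp only [oneTest, Prog.Writes, sampleGraph, writes_forUp, push] at h
  casesm* _ ∨ _
  all_goals first
    | omega
    | (have := writes_runStage (x := x) (by assumption); omega)
    | (exfalso; assumption)

-- The test plants its clique on the first `κ` vertices instead of a random set. That this makes no
-- difference on average is shown by `sum_successProb_planted`.
open Classical in
theorem tot_oneTest {P : Prog} {T : Polynomial ℕ}
    {val : ∀ m k : ℕ, (Fin m → Fin k → Bool) → ℕ} (hP : Computes P T val) (ω : ℕ → Bool)
    (s : State) {N l n B θ r κ : ℕ} (hn : 0 < n) (hs : Ready N l n B θ r s)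
    (hκ : s.reg 4 + s.reg 19 = κ) :
    Tot ω (oneTest P) s (testTime P T N l n B r) (fun s' =>
      Ready N l n B θ r s' ∧ s.reg 2 ≤ s'.reg 2 ∧ (∀ x < s.reg 2, s'.mem x = s.mem x) ∧
      s'.coins = s.coins + testCoins N l n B ∧
      s'.reg 13 = keepIf (PlantedSuccess val N l n B θ r κ (shift s.coins ω)) (s.reg 13)) := by
  refine Tot.le (.seq (.add (.seq (.const (.seq (.add (.seq_of
    (tot_sampleGraph ω _ (N := N) (κ := κ) ?_ ?_).frame ?_)))))))
    (T := 1 + (1 + (1 + (_ + (runTimeBound P T N l n B r + (1 + 1 + 1))))))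
    (by unfold testTime; omega)
  · simp [hs.reg0]
  · simp [hκ]
  rintro s₁ ⟨⟨h1, h2⟩, hfr⟩
  have hfr' : ∀ x, x ≠ 14 → x ≠ 15 → x ≠ 42 → ¬ sampleGraph.Writes x → s₁.reg x = s.reg x := by
    intro x h14 h15 h42 hx
    rw [hfr x hx]
    simp [h14, h15, h42]
  have hs2 : s₁.reg 2 = s.reg 2 + N * N := by simpa using h1.1
  have h15 : s₁.reg 15 = s.reg 2 := by rw [hfr 15 (by decide)]; simp
  have hlt : ∀ x < s.reg 2, s₁.mem x = s.mem x := by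
    intro x hx
    have := h1.mem_lt x (by simpa using hx)
    simpa using this
  have hready : Ready N l n B θ r s₁ := by
    refine ⟨?_, ?_, ?_, ?_, ?_, ?_, ?_, ?_⟩
    · rw [hfr' 0 (by decide) (by decide) (by decide) (by decide), hs.reg0]
    · rw [hfr' 5 (by decide) (by decide) (by decide) (by decide), hs.reg5]
    · rw [hfr' 7 (by decide) (by decide) (by decide) (by decide), hs.reg7]
    · rw [hfr' 8 (by decide) (by decide) (by decide) (by decide), hs.reg8]
    · rw [hfr' 10 (by decide) (by decide) (by decide) (by decide), hs.reg10]
    · rw [hfr' 11 (by decide) (by decide) (by decide) (by decide), hs.reg11]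
    · rw [hfr' 12 (by decide) (by decide) (by decide) (by decide), hs.reg12]
    · refine h1.mem_ge ?_
      intro x hx
      exact hs.mem_top x (by simpa using hx)
  refine .seq_of (tot_runStage hP ω s₁ hn hready (by omega)) ?_
  rintro s₂ ⟨h3, h4, h5, h6, h7, h8⟩
  have hcoins : s₂.coins = s.coins + testCoins N l n B := by
    rw [h6, h2, testCoins]; simp [add_assoc]
  have hmem : ∀ x < s.reg 2, s₂.mem x = s.mem x := by
    intro x hx
    rw [h5 x (by omega), hlt x hx]
  have hsucc : Success val N l n B θ r (fun u v => s₁.mem (s₁.reg 15 + (u * N + v)) ≠ 0)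
      (shift s₁.coins ω) ↔ PlantedSuccess val N l n B θ r κ (shift s.coins ω) := by
    rw [PlantedSuccess, shift_shift]
    have : s₁.coins = s.coins + N * N := by simpa using h2
    rw [this]
    refine success_congr fun u v hu hv => ?_
    have hb := Nat.mul_le_mul_right N (show u + 1 ≤ N by omega)
    rw [add_mul] at hb
    have h9 := h1.mem_add (x := u * N + v) (by omega)
    have e2 : (((s.setReg 14 (s.reg 4 + s.reg 19)).setReg 42 0).setReg 15
      (((s.setReg 14 (s.reg 4 + s.reg 19)).setReg 42 0).reg 2 +
        ((s.setReg 14 (s.reg 4 + s.reg 19)).setReg 42 0).reg 42)).reg 2 = s.reg 2 := by simp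
    rw [e2] at h9
    rw [h15, h9, mul_comm u, Nat.mul_add_div (by omega), Nat.div_eq_of_lt hv, Nat.mul_add_mod,
      Nat.mod_eq_of_lt hv, add_zero]
    simp
  rw [hsucc] at h7
  have h13 : s₂.reg 13 = s.reg 13 := by
    rw [h8 13 (by decide) (by decide) (by decide) (by decide),
      hfr' 13 (by decide) (by decide) (by decide) (by decide)]
  have hst : ∀ i v, 21 ≤ i ∨ i = 13 → Ready N l n B θ r (s₂.setReg i v) := by
    intro i v hi
    refine ⟨?_, ?_, ?_, ?_, ?_, ?_, ?_, ?_⟩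
    · rw [State.setReg_reg, if_neg (by omega), h3.reg0]
    · rw [State.setReg_reg, if_neg (by omega), h3.reg5]
    · rw [State.setReg_reg, if_neg (by omega), h3.reg7]
    · rw [State.setReg_reg, if_neg (by omega), h3.reg8]
    · rw [State.setReg_reg, if_neg (by omega), h3.reg10]
    · rw [State.setReg_reg, if_neg (by omega), h3.reg11]
    · rw [State.setReg_reg, if_neg (by omega), h3.reg12]
    · intro x hx
      refine h3.mem_top x ?_
      rwa [State.setReg_reg, if_neg (by omega)] at hx
  refine .ifZero ?_ ?_
  · intro h0
    refine .const ⟨hst 13 0 (Or.inr rfl), by simp; omega, hmem, hcoins, ?_⟩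
    rw [h7] at h0
    have : ¬ PlantedSuccess val N l n B θ r κ (shift s.coins ω) := by
      intro h; rw [keepIf_pos h] at h0; omega
    rw [keepIf_neg this]
    simp
  · intro h0
    refine .const ⟨hst 42 0 (by omega), by simp; omega, hmem, hcoins, ?_⟩
    rw [h7] at h0
    have : PlantedSuccess val N l n B θ r κ (shift s.coins ω) := by
      by_contra h; rw [keepIf_neg h] at h0; omega
    rw [keepIf_pos this]
    simp [h13]

/-- Run `R[0]` tests for each of `R[18]` clique sizes from `R[4]` on; register `13` tells whether
all of them are successful. -/
def runTests (P : Prog) : Prog := .const 13 1 ;; forUp 19 18 (forUp 20 0 (oneTest P))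

/-- All tests are successful. -/
def TestsPass (val : ∀ m k : ℕ, (Fin m → Fin k → Bool) → ℕ) (N l n B θ r y D : ℕ)
    (ω : ℕ → Bool) : Prop :=
  ∀ a < D, ∀ i < N, PlantedSuccess val N l n B θ r (y + a)
    (shift ((a * N + i) * testCoins N l n B) ω)

theorem writes_runTests {P : Prog} {x : ℕ} (h : (runTests P).Writes x) :
    x = 2 ∨ x = 9 ∨ x = 13 ∨ x = 14 ∨ x = 15 ∨ x = 16 ∨ x = 19 ∨ x = 20 ∨ 21 ≤ x := by
  simp only [runTests, Prog.Writes, writes_forUp] at h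
  casesm* _ ∨ _
  all_goals first
    | omega
    | (have := writes_oneTest (x := x) (by assumption); omega)

theorem Ready.congr {N l n B θ r : ℕ} {s s' : State} (h : Ready N l n B θ r s)
    (hm : s'.mem = s.mem) (hr : ∀ x, x = 0 ∨ x = 2 ∨ x = 5 ∨ x = 7 ∨ x = 8 ∨ x = 10 ∨ x = 11 ∨
      x = 12 → s'.reg x = s.reg x) : Ready N l n B θ r s' := by
  refine ⟨?_, ?_, ?_, ?_, ?_, ?_, ?_, ?_⟩
  · rw [hr 0 (by decide), h.reg0]
  · rw [hr 5 (by decide), h.reg5]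
  · rw [hr 7 (by decide), h.reg7]
  · rw [hr 8 (by decide), h.reg8]
  · rw [hr 10 (by decide), h.reg10]
  · rw [hr 11 (by decide), h.reg11]
  · rw [hr 12 (by decide), h.reg12]
  · rw [hr 2 (by decide), hm]
    exact h.mem_top

/-- The clique size `⌈N^δ⌉` with a real `δ` is not available to the program, so every size that
could occur is tested. Test number `a * N + i` reads its own block of coins. -/
theorem tot_runTests {P : Prog} {T : Polynomial ℕ}
    {val : ∀ m k : ℕ, (Fin m → Fin k → Bool) → ℕ} (hP : Computes P T val) (ω : ℕ → Bool)
    (s : State) {N l n B θ r y D : ℕ} (hn : 0 < n) (hs : Ready N l n B θ r s)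
    (hy : s.reg 4 = y) (hD : s.reg 18 = D) :
    Tot ω (runTests P) s (4 + D * ((3 + N * (testTime P T N l n B r + 4)) + 4)) (fun s' =>
      Ready N l n B θ r s' ∧ s.reg 2 ≤ s'.reg 2 ∧ (∀ x < s.reg 2, s'.mem x = s.mem x) ∧
      s'.coins = s.coins + D * (N * testCoins N l n B) ∧
      s'.reg 13 = keepIf (TestsPass val N l n B θ r y D (shift s.coins ω)) 1) := by
  set C := testCoins N l n B with hC
  let Good : ℕ → ℕ → Prop := fun a i =>
    PlantedSuccess val N l n B θ r (y + a) (shift ((a * N + i) * C) (shift s.coins ω))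
  have hw : ∀ x, x < 21 → x ≠ 2 → x ≠ 9 → x ≠ 13 → x ≠ 14 → x ≠ 15 → x ≠ 16 →
      ¬ (oneTest P).Writes x := by
    intro x h1 h2 h3 h4 h5 h6 h7 h
    have := writes_oneTest h
    omega
  refine Tot.le (.seq (.const ?_)) (T := 1 + (3 + D * ((3 + N * (testTime P T N l n B r + 4)) + 4)))
    (by omega)
  refine Tot.forUp (n := D) (fun a s' => Ready N l n B θ r s' ∧ s.reg 2 ≤ s'.reg 2 ∧
      (∀ x < s.reg 2, s'.mem x = s.mem x) ∧ s'.coins = s.coins + a * (N * C) ∧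
      s'.reg 13 = keepIf (∀ a' < a, ∀ i < N, Good a' i) 1) ?_ ⟨by decide, ?_⟩
      ⟨by decide, by decide, ?_⟩ ?_ ?_ ?_
  · simp [hD]
  · rw [writes_forUp]
    have := hw 19 (by decide) (by decide) (by decide) (by decide) (by decide) (by decide)
      (by decide)
    simp [this]
  · rw [writes_forUp]
    have := hw 18 (by decide) (by decide) (by decide) (by decide) (by decide) (by decide)
      (by decide)
    simp [this]
  · rintro a s₁ s₂ ⟨h1, h2, h3, h4, h5⟩ hm hc hr
    refine ⟨h1.congr hm fun x hx => hr x (by omega) (by omega), ?_, ?_, ?_, ?_⟩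
    · rwa [hr 2 (by decide) (by decide)]
    · rwa [hm]
    · rwa [hc]
    · rwa [hr 13 (by decide) (by decide)]
  · refine ⟨hs.congr rfl fun x hx => ?_, ?_, fun _ _ => rfl, ?_, ?_⟩
    · simp; omega
    · simp
    · simp
    · rw [keepIf_pos (by simp)]; simp
  · rintro a s₁ ha ⟨h1, h2, h3, h4, h5⟩ h19 hfr
    refine (Tot.forUp (n := N) (T := testTime P T N l n B r) (fun i s' => Ready N l n B θ r s' ∧
      s.reg 2 ≤ s'.reg 2 ∧ (∀ x < s.reg 2, s'.mem x = s.mem x) ∧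
      s'.coins = s.coins + (a * N + i) * C ∧
      s'.reg 13 = keepIf ((∀ a' < a, ∀ i < N, Good a' i) ∧ ∀ i' < i, Good a i') 1) ?_
      ⟨by decide, ?_⟩ ⟨by decide, by decide, ?_⟩ ?_ ?_ ?_).imp ?_
    · exact h1.reg0
    · exact hw 20 (by decide) (by decide) (by decide) (by decide) (by decide) (by decide)
        (by decide)
    · exact hw 0 (by decide) (by decide) (by decide) (by decide) (by decide) (by decide)
        (by decide)
    · rintro a s₁ s₂ ⟨h1, h2, h3, h4, h5⟩ hm hc hr
      refine ⟨h1.congr hm fun x hx => hr x (by omega) (by omega), ?_, ?_, ?_, ?_⟩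
      · rwa [hr 2 (by decide) (by decide)]
      · rwa [hm]
      · rwa [hc]
      · rwa [hr 13 (by decide) (by decide)]
    · refine ⟨h1, h2, h3, by rw [h4]; ring, ?_⟩
      rw [h5]
      congr 1
      simp
    · rintro i s₂ hi ⟨h6, h7, h8, h9, h10⟩ h20 hfr2
      have hw2 : ∀ x, x < 19 → x ≠ 2 → x ≠ 9 → x ≠ 13 → x ≠ 14 → x ≠ 15 → x ≠ 16 →
          s₁.reg x = (s.setReg 13 1).reg x := by
        intro x e1 e2 e3 e4 e5 e6 e7
        refine hfr x ?_
        rw [writes_forUp]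
        have := hw x (by omega) e2 e3 e4 e5 e6 e7
        simp only [this, or_false]
        omega
      have hw3 : ∀ x, x < 20 → x ≠ 2 → x ≠ 9 → x ≠ 13 → x ≠ 14 → x ≠ 15 → x ≠ 16 →
          s₂.reg x = s₁.reg x := by
        intro x e1 e2 e3 e4 e5 e6 e7
        refine hfr2 x ?_
        have := hw x (by omega) e2 e3 e4 e5 e6 e7
        simp only [this, or_false]
        omega
      have e4 : s₂.reg 4 = y := by
        rw [hw3 4 (by decide) (by decide) (by decide) (by decide) (by decide) (by decide)
          (by decide), hw2 4 (by decide) (by decide) (by decide) (by decide) (by decide)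
          (by decide) (by decide)]
        simp [hy]
      have e19 : s₂.reg 19 = a := by
        rw [hw3 19 (by decide) (by decide) (by decide) (by decide) (by decide) (by decide)
          (by decide), h19]
      refine (tot_oneTest hP ω s₂ hn h6 (κ := y + a) (by rw [e4, e19])).imp ?_
      rintro s₃ ⟨g1, g2, g3, g4, g5⟩
      refine ⟨g1, by omega, ?_, ?_, ?_⟩
      · intro x hx
        rw [g3 x (by omega), h8 x hx]
      · rw [g4, h9]; ring
      · rw [g5, h10, h9]
        have hg : PlantedSuccess val N l n B θ r (y + a)
            (shift (s.coins + (a * N + i) * C) ω) ↔ Good a i := by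
          simp only [Good, shift_shift]
        rw [hg]
        by_cases hgi : Good a i
        · rw [keepIf_pos hgi]
          congr 1
          simp only [Nat.lt_succ_iff_lt_or_eq, or_imp, forall_and, forall_eq, hgi, and_true]
        · rw [keepIf_neg hgi, keepIf_neg]
          exact fun h => hgi (h.2 i (Nat.lt_succ_self i))
    · rintro s₂ ⟨h6, h7, h8, h9, h10⟩
      refine ⟨h6, h7, h8, by rw [h9]; ring, ?_⟩
      rw [h10]
      congr 1
      simp only [Nat.lt_succ_iff_lt_or_eq, or_imp, forall_and, forall_eq]


/-- The logarithm of the number of columns divided by the number of the stage. -/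
def width (q b : ℕ) : ℕ := (8 * q - 5) * b + 8

/-- The number of columns in stage `r`. -/
def cols (q b r : ℕ) : ℕ := 2 ^ (r * width q b)

theorem cols_pos (q b r : ℕ) : 0 < cols q b r := by unfold cols; positivity

/-- The threshold for the product of the computed dimension and the number of the stage. -/
def thr (q b : ℕ) : ℕ := (4 * q ^ 2 + 2) * b

/-- The number of clique sizes that are tested. -/
def sizes (b N : ℕ) : ℕ := N + 1 - 2 ^ (b - 1)

/-- The number of coin flips for the tests of stage `r`. -/
def stageCoins (q b N r : ℕ) : ℕ :=
  sizes b N * (N * testCoins N (8 * r) (cols q b r) (q * b))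

/-- The number of coin flips before stage `i + 1`. -/
def offset (q b N i : ℕ) : ℕ := ∑ j ∈ Finset.range i, stageCoins q b N (j + 1)

/-- The tests of stage `i + 1` are successful. -/
def Passes (val : ∀ m k : ℕ, (Fin m → Fin k → Bool) → ℕ) (q b N i : ℕ) (ω : ℕ → Bool) : Prop :=
  TestsPass val N (8 * (i + 1)) (cols q b (i + 1)) (q * b) (thr q b) (i + 1) (2 ^ (b - 1))
    (sizes b N) (shift (offset q b N i) ω)

/-- The reduction of stage `i + 1` is successful on the input. -/
def Detects (val : ∀ m k : ℕ, (Fin m → Fin k → Bool) → ℕ) (q b N : ℕ) (E : ℕ → ℕ → Prop)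
    (i : ℕ) (ω : ℕ → Bool) : Prop :=
  Success val N (8 * (i + 1)) (cols q b (i + 1)) (q * b) (thr q b) (i + 1) E
    (shift (offset q b N (i + 1)) ω)

theorem writes_setParams {x : ℕ} (h : setParams.Writes x) :
    x = 10 ∨ x = 11 ∨ x = 12 ∨ x = 9 ∨ 21 ≤ x := by
  simp only [setParams, Prog.Writes, writes_forUp] at h
  casesm* _ ∨ _ <;> omega

/-- One stage: increase `R[8]`, run the tests and, if they are successful, the reduction on the
input. Register `17` tells whether to continue. -/
def stage (P : Prog) : Prog :=
  .const 42 1 ;; .add 8 8 42 ;; setParams ;; runTests P ;; .sub 17 3 8 ;;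
    .ifZero 13 (.const 42 0)
      (.const 15 0 ;; runStage P ;; .const 42 0 ;; .add 1 16 42 ;; .const 17 0)

/-- Time bound for stage `r`. -/
def stageTime (P : Prog) (T : Polynomial ℕ) (q b N r : ℕ) : ℕ :=
  2 + (8 + r * ((3 + width q b * 5) + 4)) +
    (4 + sizes b N * ((3 + N * (testTime P T N (8 * r) (cols q b r) (q * b) r + 4)) + 4)) + 3 +
    runTimeBound P T N (8 * r) (cols q b r) (q * b) r + 5

/-- The state after `i` stages without a decision, for an input with memory `m₀`. -/
structure Undecided (q b N : ℕ) (m₀ : ℕ → ℕ) (i : ℕ) (s : State) : Prop where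
  reg0 : s.reg 0 = N
  reg1 : s.reg 1 = 0
  reg3 : s.reg 3 = b
  reg4 : s.reg 4 = 2 ^ (b - 1)
  reg5 : s.reg 5 = q * b
  reg6 : s.reg 6 = width q b
  reg7 : s.reg 7 = thr q b
  reg8 : s.reg 8 = i
  reg17 : s.reg 17 = b - i
  reg18 : s.reg 18 = sizes b N
  le_top : N * N ≤ s.reg 2
  mem_top : ∀ x, s.reg 2 ≤ x → s.mem x = 0
  mem_eq : ∀ x < N * N, s.mem x = m₀ x
  coins_eq : s.coins = offset q b N i

/-- The run on the input starts with the coins that follow those of the tests of its stage. If the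
tests fail, these coins serve the next stage; the two uses never occur together, and only
independence within one stage is needed. -/
theorem tot_stage {P : Prog} {T : Polynomial ℕ}
    {val : ∀ m k : ℕ, (Fin m → Fin k → Bool) → ℕ} (hP : Computes P T val) (ω : ℕ → Bool)
    (s : State) {q b N i : ℕ} {m₀ : ℕ → ℕ} (hs : Undecided q b N m₀ i s) :
    Tot ω (stage P) s (stageTime P T q b N (i + 1)) (fun s' =>
      (¬ Passes val q b N i ω → Undecided q b N m₀ (i + 1) s') ∧
      (Passes val q b N i ω → s'.reg 17 = 0 ∧ s'.reg 1 =
        keepIf (Detects val q b N (fun u v => m₀ (u * N + v) ≠ 0) i ω) 1)) := by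
  refine Tot.le (.seq (.const (.seq (.add (.seq_of ((((tot_setParams ω _ (r := i + 1)
    (w := width q b) ?_ ?_).frame).mem_frame ?_).coins_frame ?_) ?_)))))
    (T := 1 + (1 + (_ + ((4 + sizes b N * ((3 + N * (testTime P T N (8 * (i + 1))
      (cols q b (i + 1)) (q * b) (i + 1) + 4)) + 4)) + (1 + (1 + (1 + (runTimeBound P T N
        (8 * (i + 1)) (cols q b (i + 1)) (q * b) (i + 1) + (1 + (1 + 1)))) + 1))))))
    (by unfold stageTime; omega)
  · simp [hs.reg8]
  · simp [hs.reg6]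
  · simp [setParams, Prog.StoreFree, storeFree_forUp]
  · simp [setParams, Prog.CoinFree, coinFree_forUp]
  rintro s₁ ⟨⟨⟨⟨h10, h11, h12⟩, hfr⟩, hm⟩, hc⟩
  have hfr' : ∀ x, x ≠ 8 → x ≠ 42 → ¬ setParams.Writes x → s₁.reg x = s.reg x := by
    intro x h8 h42 hx
    rw [hfr x hx]
    simp [h8, h42]
  have hm1 : s₁.mem = s.mem := by rw [hm]; simp
  have hc1 : s₁.coins = offset q b N i := by rw [hc]; simp [hs.coins_eq]
  have r8 : s₁.reg 8 = i + 1 := by rw [hfr 8 (by decide)]; simp [hs.reg8]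
  have r2 : s₁.reg 2 = s.reg 2 := hfr' 2 (by decide) (by decide) (by decide)
  have hready : Ready N (8 * (i + 1)) (cols q b (i + 1)) (q * b) (thr q b) (i + 1) s₁ := by
    refine ⟨?_, ?_, ?_, r8, h10, h11, h12, ?_⟩
    · rw [hfr' 0 (by decide) (by decide) (by decide), hs.reg0]
    · rw [hfr' 5 (by decide) (by decide) (by decide), hs.reg5]
    · rw [hfr' 7 (by decide) (by decide) (by decide), hs.reg7]
    · rw [r2, hm1]; exact hs.mem_top
  refine .seq_of (tot_runTests hP ω s₁ (cols_pos q b (i + 1)) hready (y := 2 ^ (b - 1))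
    (D := sizes b N) ?_ ?_).frame ?_
  · rw [hfr' 4 (by decide) (by decide) (by decide), hs.reg4]
  · rw [hfr' 18 (by decide) (by decide) (by decide), hs.reg18]
  rintro s₂ ⟨⟨g1, g2, g3, g4, g5⟩, gfr⟩
  have gfr' : ∀ x, x < 19 → x ≠ 2 → x ≠ 9 → x ≠ 13 → x ≠ 14 → x ≠ 15 → x ≠ 16 →
      s₂.reg x = s₁.reg x := by
    intro x e1 e2 e3 e4 e5 e6 e7
    refine gfr x fun h => ?_
    have := writes_runTests h
    omega
  have hpass : TestsPass val N (8 * (i + 1)) (cols q b (i + 1)) (q * b) (thr q b) (i + 1)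
      (2 ^ (b - 1)) (sizes b N) (shift s₁.coins ω) ↔ Passes val q b N i ω := by
    rw [hc1, Passes]
  rw [hpass] at g5
  have gc : s₂.coins = offset q b N (i + 1) := by
    rw [g4, hc1, offset, offset, Finset.sum_range_succ, stageCoins]
  have gm : ∀ x < N * N, s₂.mem x = m₀ x := by
    intro x hx
    rw [g3 x (by have := hs.le_top; omega), hm1, hs.mem_eq x hx]
  have g2' : N * N ≤ s₂.reg 2 := by have := hs.le_top; omega
  refine .seq (.sub (.ifZero ?_ ?_))
  · intro h0
    have hnp : ¬ Passes val q b N i ω := by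
      intro h
      rw [keepIf_pos h] at g5
      simp [g5] at h0
    refine .const ⟨fun _ => ?_, fun h => absurd h hnp⟩
    have key : ∀ x, x < 19 → x ≠ 2 → x ≠ 8 → x ≠ 9 → x ≠ 10 → x ≠ 11 → x ≠ 12 → x ≠ 13 →
        x ≠ 14 → x ≠ 15 → x ≠ 16 → x ≠ 17 →
        ((s₂.setReg 17 (s₂.reg 3 - s₂.reg 8)).setReg 42 0).reg x = s.reg x := by
      intro x e1 e2 e3 e4 e5 e6 e7 e8 e9 e10 e11 e12
      have h42 : x ≠ 42 := by omega
      have hnw : ¬ setParams.Writes x := fun h => by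
        have := writes_setParams h
        omega
      simp only [State.setReg_reg, if_neg h42, if_neg e12]
      rw [gfr' x e1 e2 e4 e8 e9 e10 e11, hfr' x e3 h42 hnw]
    have k3 : s₂.reg 3 = b := by
      rw [gfr' 3 (by decide) (by decide) (by decide) (by decide) (by decide) (by decide)
        (by decide), hfr' 3 (by decide) (by decide) (by decide), hs.reg3]
    refine ⟨?_, ?_, ?_, ?_, ?_, ?_, ?_, ?_, ?_, ?_, ?_, ?_, ?_, ?_⟩
    · rw [key 0 (by decide) (by decide) (by decide) (by decide) (by decide) (by decide)
        (by decide) (by decide) (by decide) (by decide) (by decide) (by decide), hs.reg0]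
    · rw [key 1 (by decide) (by decide) (by decide) (by decide) (by decide) (by decide)
        (by decide) (by decide) (by decide) (by decide) (by decide) (by decide), hs.reg1]
    · rw [key 3 (by decide) (by decide) (by decide) (by decide) (by decide) (by decide)
        (by decide) (by decide) (by decide) (by decide) (by decide) (by decide), hs.reg3]
    · rw [key 4 (by decide) (by decide) (by decide) (by decide) (by decide) (by decide)
        (by decide) (by decide) (by decide) (by decide) (by decide) (by decide), hs.reg4]
    · rw [key 5 (by decide) (by decide) (by decide) (by decide) (by decide) (by decide)
        (by decide) (by decide) (by decide) (by decide) (by decide) (by decide), hs.reg5]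
    · rw [key 6 (by decide) (by decide) (by decide) (by decide) (by decide) (by decide)
        (by decide) (by decide) (by decide) (by decide) (by decide) (by decide), hs.reg6]
    · rw [key 7 (by decide) (by decide) (by decide) (by decide) (by decide) (by decide)
        (by decide) (by decide) (by decide) (by decide) (by decide) (by decide), hs.reg7]
    · simp [g1.reg8]
    · simp [g1.reg8, k3]
    · rw [key 18 (by decide) (by decide) (by decide) (by decide) (by decide) (by decide)
        (by decide) (by decide) (by decide) (by decide) (by decide) (by decide), hs.reg18]
    · simpa using g2'
    · intro x hx
      exact g1.mem_top x (by simpa using hx)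
    · exact gm
    · exact gc
  · intro h0
    have hp : Passes val q b N i ω := by
      by_contra h
      rw [keepIf_neg h] at g5
      simp [g5] at h0
    refine .seq (.const (.seq_of (tot_runStage hP ω _ (cols_pos q b (i + 1))
      (g1.congr rfl ?_) ?_) ?_))
    · intro x hx
      rw [State.setReg_reg, if_neg (by omega), State.setReg_reg, if_neg (by omega)]
    · simpa using g2'
    · rintro s₃ ⟨-, -, -, -, f1, -⟩
      refine .seq (.const (.seq (.add (.const ⟨fun h => absurd hp h, fun _ => ⟨by simp, ?_⟩⟩))))
      simp only [State.setReg_reg, State.setReg_mem, State.setReg_coins] at f1 ⊢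
      simp only [Nat.reduceEqDiff, if_true, if_false, add_zero, f1, gc, Detects]
      have : Success val N (8 * (i + 1)) (cols q b (i + 1)) (q * b) (thr q b) (i + 1)
          (fun u v => s₂.mem (0 + (u * N + v)) ≠ 0) (shift (offset q b N (i + 1)) ω) ↔
          Success val N (8 * (i + 1)) (cols q b (i + 1)) (q * b) (thr q b) (i + 1)
          (fun u v => m₀ (u * N + v) ≠ 0) (shift (offset q b N (i + 1)) ω) := by
        refine success_congr fun u v hu hv => ?_
        have hb := Nat.mul_le_mul_right N (show u + 1 ≤ N by omega)
        rw [add_mul] at hb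
        rw [zero_add, gm _ (by omega)]
      rw [this]

/-- The stages until a decision is reached. -/
theorem tot_stages_of_passes {P : Prog} {T : Polynomial ℕ}
    {val : ∀ m k : ℕ, (Fin m → Fin k → Bool) → ℕ} (hP : Computes P T val) (ω : ℕ → Bool)
    {q b N M : ℕ} {m₀ : ℕ → ℕ} {i : ℕ} (hib : i < b) (hi : Passes val q b N i ω)
    (hM : ∀ j ≤ i, stageTime P T q b N (j + 1) ≤ M) :
    ∀ d j s, j + d = i → (∀ k, j ≤ k → k < i → ¬ Passes val q b N k ω) →
      Undecided q b N m₀ j s →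
      Tot ω (.loop 17 (stage P)) s ((d + 1) * (M + 1) + 1) (fun s' => s'.reg 1 =
        keepIf (Detects val q b N (fun u v => m₀ (u * N + v) ≠ 0) i ω) 1) := by
  intro d
  induction d with
  | zero =>
    intro j s hj _ hs
    obtain rfl : j = i := by omega
    obtain ⟨t, s', hx, ht, -, h2⟩ := tot_stage hP ω s hs
    obtain ⟨h3, h4⟩ := h2 hi
    have hMj := hM j le_rfl
    exact ⟨_, _, .loop_step (by rw [hs.reg17]; omega) hx (.loop_done h3), by omega, h4⟩
  | succ d ih =>
    intro j s hj hk hs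
    obtain ⟨t, s', hx, ht, h1, -⟩ := tot_stage hP ω s hs
    obtain ⟨t', s'', hx', ht', hQ⟩ := ih (j + 1) s' (by omega)
      (fun k h1 h2 => hk k (by omega) h2) (h1 (hk j le_rfl (by omega)))
    have hMj := hM j (by omega)
    refine ⟨_, _, .loop_step (by rw [hs.reg17]; omega) hx hx', ?_, hQ⟩
    rw [add_mul (d + 1) 1]
    omega

/-- Register `17` holds `b - i` after `i` undecided stages, so the loop ends after stage `b` with
the output flag still zero. -/
theorem tot_stages_of_not_passes {P : Prog} {T : Polynomial ℕ}
    {val : ∀ m k : ℕ, (Fin m → Fin k → Bool) → ℕ} (hP : Computes P T val) (ω : ℕ → Bool)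
    {q b N M : ℕ} {m₀ : ℕ → ℕ} (hnp : ∀ k < b, ¬ Passes val q b N k ω)
    (hM : ∀ j < b, stageTime P T q b N (j + 1) ≤ M) :
    ∀ d j s, j + d = b → Undecided q b N m₀ j s →
      Tot ω (.loop 17 (stage P)) s (d * (M + 1) + 1) (fun s' => s'.reg 1 = 0) := by
  intro d
  induction d with
  | zero =>
    intro j s hj hs
    exact ⟨1, s, .loop_done (by rw [hs.reg17]; omega), by omega, hs.reg1⟩
  | succ d ih =>
    intro j s hj hs
    obtain ⟨t, s', hx, ht, h1, -⟩ := tot_stage hP ω s hs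
    obtain ⟨t', s'', hx', ht', hQ⟩ := ih (j + 1) s' (by omega) (h1 (hnp j (by omega)))
    have hMj := hM j (by omega)
    refine ⟨_, _, .loop_step (by rw [hs.reg17]; omega) hx hx', ?_, hQ⟩
    rw [add_mul d 1]
    omega

/-- `R[i] := 2 ^ k * R[i]`. -/
def double (i : ℕ) : ℕ → Prog
  | 0 => .const 42 0
  | k + 1 => double i k ;; .add i i i

theorem tot_double (ω : ℕ → Bool) (s : State) (i : ℕ) (hi : i ≠ 42) (k : ℕ) :
    Tot ω (double i k) s (k + 1) (fun s' => s'.reg i = 2 ^ k * s.reg i) := by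
  induction k with
  | zero => exact .const (by simp [hi])
  | succ k ih =>
    refine .seq_of ih fun s' h => .add ?_
    simp only [State.setReg_reg, if_true, h]
    ring

theorem writes_double {i k x : ℕ} (h : (double i k).Writes x) : x = i ∨ x = 42 := by
  induction k with
  | zero => exact Or.inr h
  | succ k ih =>
    rcases h with h | h
    · exact ih h
    · exact Or.inl h

theorem storeFree_double (i k : ℕ) : (double i k).StoreFree := by
  induction k <;> simp_all [double, Prog.StoreFree]

theorem coinFree_double (i k : ℕ) : (double i k).CoinFree := by
  induction k <;> simp_all [double, Prog.CoinFree]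

/-- `R[d] := k * R[a]`. -/
def multiple (d a : ℕ) : ℕ → Prog
  | 0 => .const d 0
  | k + 1 => multiple d a k ;; .add d d a

theorem tot_multiple (ω : ℕ → Bool) (s : State) (d a : ℕ) (h : a ≠ d) (k : ℕ) :
    Tot ω (multiple d a k) s (k + 1) (fun s' => s' = s.setReg d (k * s.reg a)) := by
  induction k with
  | zero => exact .const (by simp)
  | succ k ih =>
    refine .seq_of ih fun s' h' => .add ?_
    subst h'
    simp only [State.setReg_reg, if_true, if_neg h]
    rw [show k * s.reg a + s.reg a = (k + 1) * s.reg a by ring]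
    simp [State.setReg]

/-- Compute `R[3] := ⌈log N / q⌉`, the least `b` with `N ≤ 2 ^ (q b)`, and `R[4] := 2 ^ (b - 1)`. -/
def computeBlock (q : ℕ) : Prog :=
  .const 3 1 ;; .const 4 1 ;; .const 29 1 ;; double 29 q ;;
    forUp 21 0 (.sub 27 0 29 ;; .ifZero 27 (.const 42 0)
      (.const 42 1 ;; .add 3 3 42 ;; .add 4 4 4 ;; double 29 q))

theorem writes_computeBlock {q x : ℕ} (h : (computeBlock q).Writes x) :
    x = 3 ∨ x = 4 ∨ x = 9 ∨ 21 ≤ x := by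
  simp only [computeBlock, Prog.Writes, writes_forUp] at h
  casesm* _ ∨ _
  all_goals first
    | omega
    | (have := writes_double (x := x) (by assumption); omega)

/-- A candidate `c` starts at `1` and grows until `N ≤ 2^(qc)`. A loop of `N` rounds is long enough
because the logarithm is at most `N`. -/
theorem tot_computeBlock (ω : ℕ → Bool) (s : State) {q N : ℕ} (hq : 0 < q) (hN : s.reg 0 = N)
    (hN2 : 2 ≤ N) :
    Tot ω (computeBlock q) s (q + 10 + N * (q + 15)) (fun s' =>
      s'.reg 3 = Nat.clog (2 ^ q) N ∧ s'.reg 4 = 2 ^ (Nat.clog (2 ^ q) N - 1)) := by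
  have h1q : 1 < 2 ^ q := Nat.one_lt_two_pow (by omega)
  have hpos : 0 < Nat.clog (2 ^ q) N := Nat.clog_pos h1q hN2
  have hle : ∀ k, Nat.clog (2 ^ q) N ≤ k ↔ N ≤ 2 ^ (q * k) := by
    intro k
    rw [Nat.clog_le_iff_le_pow h1q, pow_mul]
  refine Tot.le (.seq (.const (.seq (.const (.seq (.const (.seq_of
    ((tot_double ω _ 29 (by decide) q).frame) ?_)))))))
    (T := 1 + (1 + (1 + ((q + 1) + (3 + N * ((q + 10) + 4)))))) (by
      have := Nat.mul_le_mul_left N (show q + 10 + 4 ≤ q + 15 by omega); omega)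
  rintro s₁ ⟨h29, hfr⟩
  have hfr' : ∀ x, x ≠ 3 → x ≠ 4 → x ≠ 29 → x ≠ 42 → s₁.reg x = s.reg x := by
    intro x e1 e2 e3 e4
    rw [hfr x fun h => by have := writes_double h; omega]
    simp [e1, e2, e3]
  have h3 : s₁.reg 3 = 1 := by
    rw [hfr 3 fun h => by have := writes_double h; omega]; simp
  have h4 : s₁.reg 4 = 1 := by
    rw [hfr 4 fun h => by have := writes_double h; omega]; simp
  simp at h29
  -- The alternative `j < c` says that an unfinished candidate has grown in every round; after `N`
  -- rounds it is impossible.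
  refine (Tot.forUp (n := N) (T := q + 10) (fun j s' => ∃ c, 1 ≤ c ∧ c ≤ Nat.clog (2 ^ q) N ∧
    (c = Nat.clog (2 ^ q) N ∨ j < c) ∧ s'.reg 3 = c ∧ s'.reg 4 = 2 ^ (c - 1) ∧
    s'.reg 29 = 2 ^ (q * c)) ?_ ⟨by decide, ?_⟩ ⟨by decide, by decide, ?_⟩ ?_ ?_ ?_).imp ?_
  · rw [hfr' 0 (by decide) (by decide) (by decide) (by decide), hN]
  · simp only [Prog.Writes, not_or]
    exact ⟨by decide, by decide, by decide, by decide, by decide,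
      fun h => by have := writes_double h; omega⟩
  · simp only [Prog.Writes, not_or]
    exact ⟨by decide, by decide, by decide, by decide, by decide,
      fun h => by have := writes_double h; omega⟩
  · rintro j s₂ s₃ ⟨c, e1, e2, e3, e4, e5, e6⟩ _ _ hr
    exact ⟨c, e1, e2, e3, by rw [hr 3 (by decide) (by decide), e4],
      by rw [hr 4 (by decide) (by decide), e5], by rw [hr 29 (by decide) (by decide), e6]⟩
  · exact ⟨1, le_rfl, hpos, Or.inr (by omega), h3, by simp [h4], by simp [h29]⟩
  · rintro j s₂ hj ⟨c, e1, e2, e3, e4, e5, e6⟩ _ hfr2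
    have e0 : s₂.reg 0 = N := by
      rw [hfr2 0, hfr' 0 (by decide) (by decide) (by decide) (by decide), hN]
      simp only [Prog.Writes, not_or]
      exact ⟨by decide, by decide, by decide, by decide, by decide, by decide, by decide,
        fun h => by have := writes_double h; omega⟩
    refine Tot.le (.seq (.sub (.ifZero (T := 1) (T' := q + 4) ?_ ?_))) (by omega)
    · intro h0
      simp [e0, e6, Nat.sub_eq_zero_iff_le] at h0
      refine .const ⟨c, e1, e2, Or.inl (le_antisymm e2 ((hle c).2 h0)), ?_, ?_, ?_⟩
      · simp [e4]
      · simp [e5]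
      · simp [e6]
    · intro h0
      simp [e0, e6] at h0
      have hlt : c < Nat.clog (2 ^ q) N := by
        by_contra h
        have := (hle c).1 (not_lt.1 h)
        omega
      refine Tot.le (.seq (.const (.seq (.add (.seq (.add
        ((tot_double ω _ 29 (by decide) q).frame.imp ?_))))))) (by omega)
      rintro s₃ ⟨f1, f2⟩
      refine ⟨c + 1, by omega, hlt, by omega, ?_, ?_, ?_⟩
      · rw [f2 3 fun h => by have := writes_double h; omega]
        simp [e4]
      · rw [f2 4 fun h => by have := writes_double h; omega]
        simp [e5]
        rw [← two_mul, ← pow_succ']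
        congr 1
        omega
      · rw [f1]
        simp [e6]
        ring
  · rintro s₂ ⟨c, e1, e2, e3, e4, e5, e6⟩
    have hcN : Nat.clog (2 ^ q) N ≤ N := by
      rw [hle]
      calc N ≤ 2 ^ N := Nat.lt_two_pow_self.le
        _ ≤ 2 ^ (q * N) := Nat.pow_le_pow_right (by norm_num) (Nat.le_mul_of_pos_left _ hq)
    obtain rfl : c = Nat.clog (2 ^ q) N := by omega
    exact ⟨e4, e5⟩

theorem storeFree_computeBlock (q : ℕ) : (computeBlock q).StoreFree := by
  simp [computeBlock, Prog.StoreFree, storeFree_forUp, storeFree_double]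

theorem coinFree_computeBlock (q : ℕ) : (computeBlock q).CoinFree := by
  simp [computeBlock, Prog.CoinFree, coinFree_forUp, coinFree_double]

/-- Compute the parameters that do not depend on the stage. -/
def setup (q : ℕ) : Prog :=
  computeBlock q ;; multiple 5 3 q ;; multiple 6 3 (8 * q - 5) ;; .const 42 8 ;; .add 6 6 42 ;;
    multiple 7 3 (4 * q ^ 2 + 2) ;; .const 42 1 ;; .add 18 0 42 ;; .sub 18 18 4 ;;
    .const 42 0 ;; .add 17 3 42 ;; .const 1 0 ;; addMul 2 0 21 0

/-- Time bound for `setup`. -/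
def setupTime (q N : ℕ) : ℕ := N * (q + 20) + 4 * q ^ 2 + 10 * q + 40

/-- Register `1`, which holds `N` on input, is cleared to become the output flag, and `R[2] = N²`
protects the input matrix. -/
theorem tot_setup (ω : ℕ → Bool) {q N : ℕ} (hq : 0 < q) (hN2 : 2 ≤ N)
    (A : Fin N → Fin N → Prop) :
    Tot ω (setup q) (inputState N N A) (setupTime q N)
      (Undecided q (Nat.clog (2 ^ q) N) N (inputState N N A).mem 0) := by
  set s := inputState N N A with hs
  have hs0 : s.reg 0 = N := by simp [hs, inputState]
  have hsr : ∀ x, 2 ≤ x → s.reg x = 0 := by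
    intro x hx
    simp only [hs, inputState]
    rw [if_neg (by omega), if_neg (by omega)]
  refine Tot.le (.seq_of ((((tot_computeBlock ω s hq hs0 hN2).frame).mem_frame
    (storeFree_computeBlock q)).coins_frame (coinFree_computeBlock q)) ?_)
    (T := (q + 10 + N * (q + 15)) + ((q + 1) + ((8 * q - 5 + 1) + (1 + (1 + ((4 * q ^ 2 + 2 + 1) +
      (1 + (1 + (1 + (1 + (1 + (1 + (3 + N * 5)))))))))))))
    (by unfold setupTime; rw [show q + 20 = q + 15 + 5 by rfl, mul_add N (q + 15)]; omega)
  rintro s₁ ⟨⟨⟨⟨h3, h4⟩, hfr⟩, hm⟩, hc⟩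
  have hfr' : ∀ x, x ≠ 3 → x ≠ 4 → x ≠ 9 → x < 21 → s₁.reg x = s.reg x := by
    intro x e1 e2 e3 e4
    refine hfr x fun h => ?_
    have := writes_computeBlock h
    omega
  refine .seq_of (tot_multiple ω _ 5 3 (by decide) q) fun s₂ e₂ => ?_
  refine .seq_of (tot_multiple ω _ 6 3 (by decide) _) fun s₃ e₃ => ?_
  refine .seq (.const (.seq (.add ?_)))
  refine .seq_of (tot_multiple ω _ 7 3 (by decide) _) fun s₄ e₄ => ?_
  refine .seq (.const (.seq (.add (.seq (.sub (.seq (.const (.seq (.add (.seq (.const ?_)))))))))))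
  subst e₂ e₃ e₄
  have f0 : s₁.reg 0 = N := by rw [hfr' 0 (by decide) (by decide) (by decide) (by decide), hs0]
  have f2 : s₁.reg 2 = 0 := by
    rw [hfr' 2 (by decide) (by decide) (by decide) (by decide), hsr 2 le_rfl]
  have f8 : s₁.reg 8 = 0 := by
    rw [hfr' 8 (by decide) (by decide) (by decide) (by decide), hsr 8 (by decide)]
  refine Tot.le ((((tot_addMul ω _ (by decide)).frame.mem_frame
    (storeFree_addMul _ _ _ _)).coins_frame (coinFree_addMul _ _ _ _)).imp ?_) ?_
  · rintro s₅ ⟨⟨⟨g2, gfr⟩, gm⟩, gc⟩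
    simp only [writes_addMul] at gfr
    simp [f0, f2] at g2
    refine ⟨?_, ?_, ?_, ?_, ?_, ?_, ?_, ?_, ?_, ?_, ?_, ?_, ?_, ?_⟩
    · rw [gfr 0 (by decide)]; simp [f0]
    · rw [gfr 1 (by decide)]; simp
    · rw [gfr 3 (by decide)]; simp [h3]
    · rw [gfr 4 (by decide)]; simp [h4]
    · rw [gfr 5 (by decide)]; simp [h3]
    · rw [gfr 6 (by decide)]; simp [h3, width]
    · rw [gfr 7 (by decide)]; simp [h3, thr]
    · rw [gfr 8 (by decide)]; simp [f8]
    · rw [gfr 17 (by decide)]; simp [h3]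
    · rw [gfr 18 (by decide)]; simp [f0, h4, sizes]
    · rw [g2]
    · intro x hx
      rw [gm]
      simp only [State.setReg_mem, hm, hs, inputState]
      rw [if_neg]
      rintro ⟨i, j, rfl, -⟩
      have := Nat.mul_le_mul_right N (show (i : ℕ) + 1 ≤ N from i.2)
      rw [add_mul] at this
      have := j.2
      omega
    · intro x _
      rw [gm]
      simp [hm]
    · rw [gc]
      simp only [State.setReg_coins, hc, offset, Finset.range_zero, Finset.sum_empty]
      rfl
  · simp [f0]

/-- The whole distinguisher: its output is `1` if the first stage whose tests are successful is
also successful on the input. -/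
def distinguisher (q : ℕ) (P : Prog) : Prog :=
  setup q ;; .loop 17 (stage P) ;; .const 42 0 ;; .add 0 1 42

theorem tot_distinguisher_of_passes {P : Prog} {T : Polynomial ℕ}
    {val : ∀ m k : ℕ, (Fin m → Fin k → Bool) → ℕ} (hP : Computes P T val) (ω : ℕ → Bool)
    {q N M i : ℕ} (hq : 0 < q) (hN2 : 2 ≤ N) (A : Fin N → Fin N → Prop)
    (hib : i < Nat.clog (2 ^ q) N) (hi : Passes val q (Nat.clog (2 ^ q) N) N i ω)
    (hmin : ∀ k < i, ¬ Passes val q (Nat.clog (2 ^ q) N) N k ω)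
    (hM : ∀ j ≤ i, stageTime P T q (Nat.clog (2 ^ q) N) N (j + 1) ≤ M) :
    Tot ω (distinguisher q P) (inputState N N A) (setupTime q N + (i + 1) * (M + 1) + 3)
      (fun s' => s'.reg 0 = keepIf (Detects val q (Nat.clog (2 ^ q) N) N
        (fun u v => (inputState N N A).mem (u * N + v) ≠ 0) i ω) 1) := by
  refine Tot.le (.seq_of (tot_setup ω hq hN2 A) fun s₁ h₁ => .seq_of
    (tot_stages_of_passes hP ω hib hi hM i 0 s₁ (zero_add i) (fun k _ h => hmin k h) h₁)
      fun s₂ h₂ => .seq (.const (.add ?_)))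
    (T := setupTime q N + (((i + 1) * (M + 1) + 1) + (1 + 1))) (by omega)
  simpa using h₂

theorem tot_distinguisher_of_not_passes {P : Prog} {T : Polynomial ℕ}
    {val : ∀ m k : ℕ, (Fin m → Fin k → Bool) → ℕ} (hP : Computes P T val) (ω : ℕ → Bool)
    {q N M : ℕ} (hq : 0 < q) (hN2 : 2 ≤ N) (A : Fin N → Fin N → Prop)
    (hnp : ∀ k < Nat.clog (2 ^ q) N, ¬ Passes val q (Nat.clog (2 ^ q) N) N k ω)
    (hM : ∀ j < Nat.clog (2 ^ q) N, stageTime P T q (Nat.clog (2 ^ q) N) N (j + 1) ≤ M) :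
    Tot ω (distinguisher q P) (inputState N N A)
      (setupTime q N + Nat.clog (2 ^ q) N * (M + 1) + 3) (fun s' => s'.reg 0 = 0) := by
  refine Tot.le (.seq_of (tot_setup ω hq hN2 A) fun s₁ h₁ => .seq_of
    (tot_stages_of_not_passes hP ω hnp hM _ 0 s₁ (zero_add _) h₁)
      fun s₂ h₂ => .seq (.const (.add ?_)))
    (T := setupTime q N + ((Nat.clog (2 ^ q) N * (M + 1) + 1) + (1 + 1))) (by omega)
  simpa using h₂

end RAM

/-! ### Proportions in finite types -/

namespace RAM

open Classical in
/-- The proportion of the elements of a finite type that have a property. -/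
noncomputable def proportion {F : Type*} [Fintype F] (Q : F → Prop) : ℝ :=
  ((Finset.univ.filter Q).card : ℝ) / Fintype.card F

section Proportion

variable {F F' : Type*} [Fintype F] [Fintype F']

theorem proportion_eq (Q : F → Prop) [DecidablePred Q] :
    proportion Q = ((Finset.univ.filter Q).card : ℝ) / Fintype.card F := by
  unfold proportion
  congr!

theorem proportion_congr {Q R : F → Prop} (h : ∀ x, Q x ↔ R x) : proportion Q = proportion R := by
  rw [show Q = R from funext fun x => propext (h x)]

theorem proportion_nonneg (Q : F → Prop) : 0 ≤ proportion Q := by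
  unfold proportion; positivity

theorem proportion_le_one (Q : F → Prop) : proportion Q ≤ 1 := by
  classical
  rw [proportion_eq]
  refine div_le_one_of_le₀ ?_ (by positivity)
  exact_mod_cast Finset.card_filter_le _ _

theorem proportion_mono {Q R : F → Prop} (h : ∀ x, Q x → R x) : proportion Q ≤ proportion R := by
  classical
  simp only [proportion_eq]
  gcongr with x
  exact h x

theorem proportion_or_le (Q R : F → Prop) :
    proportion (fun x => Q x ∨ R x) ≤ proportion Q + proportion R := by
  classical
  simp only [proportion_eq]
  rw [← add_div]
  gcongr
  rw [Finset.filter_or]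
  exact_mod_cast Finset.card_union_le _ _

theorem proportion_exists_le {ι : Type*} (s : Finset ι) (Q : ι → F → Prop) :
    proportion (fun x => ∃ i ∈ s, Q i x) ≤ ∑ i ∈ s, proportion (Q i) := by
  classical
  simp only [proportion_eq]
  rw [← Finset.sum_div]
  gcongr
  have : Finset.univ.filter (fun x => ∃ i ∈ s, Q i x) =
      s.biUnion fun i => Finset.univ.filter (Q i) := by
    ext x; simp
  rw [this]
  exact_mod_cast Finset.card_biUnion_le

theorem proportion_exists_le_card_mul {ι : Type*} (s : Finset ι) (Q : ι → F → Prop) {c : ℝ}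
    (h : ∀ i ∈ s, proportion (Q i) ≤ c) :
    proportion (fun x => ∃ i ∈ s, Q i x) ≤ s.card * c := by
  refine (proportion_exists_le s Q).trans ((Finset.sum_le_sum h).trans ?_)
  simp

theorem proportion_not [Nonempty F] (Q : F → Prop) :
    proportion (fun x => ¬ Q x) = 1 - proportion Q := by
  classical
  simp only [proportion_eq]
  have h := Finset.card_filter_add_card_filter_not (s := (Finset.univ : Finset F)) Q
  have h0 : (Fintype.card F : ℝ) ≠ 0 := by
    exact_mod_cast Fintype.card_ne_zero
  rw [eq_sub_iff_add_eq, ← add_div, div_eq_one_iff_eq h0]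
  rw [Finset.card_univ] at h
  rw [add_comm]
  exact_mod_cast h

theorem proportion_equiv (e : F ≃ F') (Q : F' → Prop) :
    proportion (fun x => Q (e x)) = proportion Q := by
  classical
  simp only [proportion_eq]
  rw [Fintype.card_congr e]
  congr 2
  refine Finset.card_bij' (fun x _ => e x) (fun y _ => e.symm y) ?_ ?_ ?_ ?_ <;> simp

theorem proportion_prod (Q : F × F' → Prop) :
    proportion Q = (∑ x, proportion fun y => Q (x, y)) / Fintype.card F := by
  classical
  simp only [proportion_eq]
  rw [← Finset.sum_div, div_div, Fintype.card_prod]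
  push_cast
  rw [mul_comm (Fintype.card F : ℝ)]
  congr 1
  rw [← Nat.cast_sum]
  congr 1
  rw [Finset.card_filter, Fintype.sum_prod_type]
  exact Finset.sum_congr rfl fun x _ => (Finset.card_filter _ _).symm

theorem proportion_prod_swap (Q : F × F' → Prop) :
    proportion Q = proportion fun z : F' × F => Q (z.2, z.1) :=
  (proportion_equiv (Equiv.prodComm F' F) Q).symm

theorem proportion_and_const (p : Prop) (Q : F → Prop) [Decidable p] :
    proportion (fun x => p ∧ Q x) = if p then proportion Q else 0 := by
  classical
  split_ifs with h <;> simp [h, proportion_eq]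

theorem proportion_and (Q : F → Prop) (R : F' → Prop) :
    proportion (fun z : F × F' => Q z.1 ∧ R z.2) = proportion Q * proportion R := by
  classical
  rw [proportion_prod]
  simp only [proportion_and_const]
  rw [← Finset.sum_filter, Finset.sum_const, nsmul_eq_mul]
  rw [proportion_eq Q, div_mul_eq_mul_div]

theorem proportion_fst [Nonempty F'] (Q : F → Prop) :
    proportion (fun z : F × F' => Q z.1) = proportion Q := by
  have h := proportion_and Q fun _ : F' => True
  have h1 : proportion (fun _ : F' => True) = 1 := by
    simp [proportion]
  simpa [h1] using h

/-- Independence of coordinates: the functions counted form a box, with free coordinates outside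
`T`. -/
theorem proportion_pi {ι : Type*} [Fintype ι] [DecidableEq ι] [Nonempty F] (T : Finset ι)
    (Q : ι → F → Prop) :
    proportion (fun f : ι → F => ∀ a ∈ T, Q a (f a)) = ∏ a ∈ T, proportion (Q a) := by
  classical
  have h0 : (Fintype.card F : ℝ) ≠ 0 := by exact_mod_cast Fintype.card_ne_zero
  have h : Finset.univ.filter (fun f : ι → F => ∀ a ∈ T, Q a (f a)) =
      Fintype.piFinset fun a => if a ∈ T then Finset.univ.filter (Q a) else Finset.univ := by
    ext f
    simp only [Finset.mem_filter, Finset.mem_univ, true_and, Fintype.mem_piFinset]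
    refine forall_congr' fun a => ?_
    split_ifs with ha <;> simp [ha]
  simp only [proportion_eq]
  rw [h, Fintype.card_piFinset, Fintype.card_fun, Finset.prod_div_distrib]
  have h2 : ∀ a, (if a ∈ T then Finset.univ.filter (Q a) else Finset.univ).card =
      if a ∈ T then (Finset.univ.filter (Q a)).card else Fintype.card F := by
    intro a; split_ifs <;> simp
  simp only [h2, Finset.prod_ite, Finset.prod_const, Finset.filter_mem_eq_inter,
    Finset.univ_inter, Nat.cast_mul, Nat.cast_prod, Nat.cast_pow]
  have hf : (Finset.univ.filter fun a => a ∉ T) = Tᶜ := by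
    ext; simp
  rw [hf, div_eq_div_iff (by positivity) (by positivity), mul_assoc, ← pow_add,
    Finset.card_compl_add_card]

theorem proportion_mem_univ_pi {ι : Type*} [Fintype ι] [DecidableEq ι] [Nonempty F]
    (Q : F → Prop) : proportion (fun f : ι → F => ∀ a, Q (f a)) =
      proportion Q ^ Fintype.card ι := by
  have := proportion_pi (Finset.univ : Finset ι) fun _ => Q
  simpa using this

end Proportion

/-! ### Sequences of coin flips -/

instance : IsProbabilityMeasure coinLaw := by
  unfold coinLaw; infer_instance

/-- Continue a finite sequence by `false`. -/
def pad {d : ℕ} (v : Fin d → Bool) (i : ℕ) : Bool := if h : i < d then v ⟨i, h⟩ else false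

theorem pad_restrict (d : ℕ) (ω : ℕ → Bool) : ∀ i ∈ Set.Iio d, pad (fun i : Fin d => ω i) i = ω i := by
  intro i hi
  simp [pad, Set.mem_Iio.1 hi]

theorem dependsOn_pad_iff {d : ℕ} {Q : (ℕ → Bool) → Prop} (hQ : DependsOn Q (Set.Iio d))
    (ω : ℕ → Bool) : Q (pad fun i : Fin d => ω i) ↔ Q ω :=
  iff_of_eq (hQ (pad_restrict d ω))

theorem measurableSet_of_dependsOn {d : ℕ} {Q : (ℕ → Bool) → Prop}
    (hQ : DependsOn Q (Set.Iio d)) : MeasurableSet {ω | Q ω} := by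
  have : {ω | Q ω} = (fun ω (i : Fin d) => ω i) ⁻¹' {v | Q (pad v)} := by
    ext ω
    simp [dependsOn_pad_iff hQ]
  rw [this]
  exact (by fun_prop : Measurable fun (ω : ℕ → Bool) (i : Fin d) => ω i) (Set.toFinite _).measurableSet

theorem coinLaw_cylinder (d : ℕ) (x : ℕ → Bool) :
    coinLaw {ω | ∀ i < d, ω i = x i} = ((2 : ℝ≥0∞) ^ d)⁻¹ := by
  have : {ω : ℕ → Bool | ∀ i < d, ω i = x i} =
      Set.pi (Finset.range d : Finset ℕ) fun i => {x i} := by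
    ext ω; simp [Set.mem_pi]
  rw [this, coinLaw, Measure.infinitePi_pi _ (by measurability)]
  simp [ENNReal.inv_pow]

/-- All prefixes of length `d` have mass `2^(-d)`, so the probability of an event that reads only
`d` coins is a proportion. From here on probabilities can be computed by counting. -/
theorem coinLaw_real_eq {d : ℕ} {Q : (ℕ → Bool) → Prop} (hQ : DependsOn Q (Set.Iio d)) :
    coinLaw.real {ω | Q ω} = proportion fun v : Fin d → Bool => Q (pad v) := by
  classical
  have hm : Measurable fun (ω : ℕ → Bool) (i : Fin d) => ω i := by fun_prop
  have h1 : {ω | Q ω} = (fun ω (i : Fin d) => ω i) ⁻¹'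
      (Finset.univ.filter fun v : Fin d → Bool => Q (pad v) : Finset (Fin d → Bool)) := by
    ext ω
    simp [dependsOn_pad_iff hQ]
  have h2 : ∀ v : Fin d → Bool, (coinLaw.map fun (ω : ℕ → Bool) (i : Fin d) => ω i).real {v} =
      ((2 : ℝ) ^ d)⁻¹ := by
    intro v
    rw [map_measureReal_apply hm (by measurability)]
    have : (fun (ω : ℕ → Bool) (i : Fin d) => ω i) ⁻¹' {v} = {ω | ∀ i < d, ω i = pad v i} := by
      ext ω
      simp only [Set.mem_preimage, Set.mem_singleton_iff, funext_iff, Set.mem_ofPred_eq]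
      refine ⟨fun h i hi => by simp [pad, hi, ← h], fun h i => by rw [h i i.2]; simp [pad]⟩
    rw [this, measureReal_def, coinLaw_cylinder]
    simp
  rw [h1, ← map_measureReal_apply hm (Finset.measurableSet _), ← sum_measureReal_singleton]
  simp only [h2, Finset.sum_const, nsmul_eq_mul, proportion]
  simp [div_eq_mul_inv]

/-- `f` is determined by the first `d` coin flips, and its values are equally likely. -/
def Uniform {F : Type*} [Fintype F] (d : ℕ) (f : (ℕ → Bool) → F) : Prop :=
  DependsOn f (Set.Iio d) ∧ ∀ Q : F → Prop, coinLaw.real {ω | Q (f ω)} = proportion Q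

theorem dependsOn_shift {β : Type*} {d e : ℕ} {g : (ℕ → Bool) → β} (hg : DependsOn g (Set.Iio e)) :
    DependsOn (fun ω => g (shift d ω)) (Set.Iio (d + e)) := by
  intro ω ω' h
  refine hg fun i hi => h (d + i) ?_
  simp only [Set.mem_Iio] at hi ⊢
  omega

theorem dependsOn_mono {β : Type*} {d e : ℕ} {g : (ℕ → Bool) → β}
    (hg : DependsOn g (Set.Iio d)) (h : d ≤ e) : DependsOn g (Set.Iio e) :=
  fun _ _ hω => hg fun i hi => hω i (lt_of_lt_of_le hi h)

section Uniform

variable {F F' : Type*} [Fintype F] [Fintype F'] {d e : ℕ} {f : (ℕ → Bool) → F}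
  {g : (ℕ → Bool) → F'}

/-- The first `d` coins are independent of the following ones; composite samples are assembled block
by block in this way. -/
theorem Uniform.prod (hf : Uniform d f) (hg : Uniform e g) :
    Uniform (d + e) fun ω => (f ω, g (shift d ω)) := by
  have hdep : DependsOn (fun ω => (f ω, g (shift d ω))) (Set.Iio (d + e)) := by
    intro ω ω' h
    exact Prod.ext (dependsOn_mono hf.1 (Nat.le_add_right d e) h) (dependsOn_shift hg.1 h)
  refine ⟨hdep, fun Q => ?_⟩
  rw [coinLaw_real_eq (d := d + e) (Q := fun ω => Q (f ω, g (shift d ω)))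
    fun ω ω' h => congrArg Q (hdep h), ← proportion_equiv (Fin.appendEquiv d e)]
  have h1 : ∀ z : (Fin d → Bool) × (Fin e → Bool),
      Q (f (pad (Fin.appendEquiv d e z)), g (shift d (pad (Fin.appendEquiv d e z)))) ↔
        Q (f (pad z.1), g (pad z.2)) := by
    rintro ⟨v, w⟩
    have e1 : f (pad (Fin.append v w)) = f (pad v) := by
      refine hf.1 fun i hi => ?_
      have hi : i < d := hi
      have : (⟨i, by omega⟩ : Fin (d + e)) = Fin.castAdd e ⟨i, hi⟩ := rfl
      rw [pad, dif_pos (by omega), this, Fin.append_left, pad, dif_pos hi]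
    have e2 : g (shift d (pad (Fin.append v w))) = g (pad w) := by
      refine hg.1 fun i hi => ?_
      have hi : i < e := hi
      have : (⟨d + i, by omega⟩ : Fin (d + e)) = Fin.natAdd d ⟨i, hi⟩ := rfl
      rw [shift_apply, pad, dif_pos (by omega), this, Fin.append_right, pad, dif_pos hi]
    simp only [Fin.appendEquiv, Equiv.coe_fn_mk, e1, e2]
  rw [proportion_congr h1, proportion_prod]
  have h2 : ∀ x, (proportion fun w : Fin e → Bool => Q (x, g (pad w))) =
      proportion fun y => Q (x, y) := by
    intro x
    rw [← hg.2, coinLaw_real_eq (d := e) (Q := fun ω => Q (x, g ω))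
      fun ω ω' h => congrArg (fun y => Q (x, y)) (hg.1 h)]
  simp only [h2]
  -- The second component has become uniform. Swapping the factors allows the same replacement for
  -- the first.
  rw [← proportion_prod (fun z : (Fin d → Bool) × F' => Q (f (pad z.1), z.2)),
    proportion_prod_swap, proportion_prod, proportion_prod_swap Q, proportion_prod]
  congr 1
  refine Finset.sum_congr rfl fun y _ => ?_
  rw [← hf.2, coinLaw_real_eq (d := d) (Q := fun ω => Q (f ω, y))
    fun ω ω' h => congrArg (fun x => Q (x, y)) (hf.1 h)]

theorem Uniform.equiv (hf : Uniform d f) (e : F ≃ F') : Uniform d fun ω => e (f ω) :=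
  ⟨fun _ _ h => congrArg e (hf.1 h), fun Q => by
    rw [hf.2 fun x => Q (e x), proportion_equiv]⟩

theorem Uniform.fst [Nonempty F'] {f : (ℕ → Bool) → F × F'} (hf : Uniform d f) :
    Uniform d fun ω => (f ω).1 :=
  ⟨fun _ _ h => congrArg Prod.fst (hf.1 h), fun Q => by
    rw [hf.2 fun z => Q z.1, proportion_fst]⟩

theorem Uniform.congr {f' : (ℕ → Bool) → F} (hf : Uniform d f) (h : ∀ ω, f ω = f' ω) :
    Uniform d f' := by
  rwa [← show f = f' from funext h]

theorem Uniform.restrict (d : ℕ) : Uniform d fun ω (i : Fin d) => ω i := by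
  have h : DependsOn (fun (ω : ℕ → Bool) (i : Fin d) => ω i) (Set.Iio d) :=
    fun ω ω' h => funext fun i => h i i.2
  refine ⟨h, fun Q => ?_⟩
  rw [coinLaw_real_eq (d := d) fun ω ω' hω => congrArg Q (h hω)]
  refine proportion_congr fun v => ?_
  have : (fun i : Fin d => pad v i) = v := by
    funext i; simp [pad]
  exact iff_of_eq (congrArg Q this)

theorem Uniform.of_unique [Unique F] (f : (ℕ → Bool) → F) : Uniform 0 f := by
  refine ⟨fun _ _ _ => Subsingleton.elim _ _, fun Q => ?_⟩
  have : ∀ ω, Q (f ω) ↔ Q default := fun ω => by rw [Subsingleton.elim (f ω) default]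
  simp only [this]
  by_cases h : Q default
  · have h' : ∀ x, Q x := fun x => by rwa [Subsingleton.elim x default]
    simp [h, proportion, h']
  · have h' : ∀ x, ¬ Q x := fun x => by rwa [Subsingleton.elim x default]
    simp [h, proportion, h']

theorem Uniform.iterate (hf : Uniform d f) (m : ℕ) :
    Uniform (m * d) fun ω (j : Fin m) => f (shift (j * d) ω) := by
  induction m with
  | zero =>
    rw [zero_mul]
    exact .of_unique _
  | succ m ih =>
    rw [add_mul, one_mul]
    have h := (ih.prod hf).equiv
      ((Equiv.prodComm (Fin m → F) F).trans (Fin.snocEquiv fun _ : Fin (m + 1) => F))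
    convert h using 3 with ω j
    refine Fin.lastCases ?_ (fun j => ?_) j
    · simp [Fin.snocEquiv]
    · simp [Fin.snocEquiv]

/-- Conditioning on `f`: the remaining randomness comes from later coins. With `f` a random graph,
this expresses the success probability of a test as an average over graphs. -/
theorem coinLaw_real_fubini (hf : Uniform d f) {R : F → (ℕ → Bool) → Prop}
    (hR : ∀ x, DependsOn (R x) (Set.Iio e)) :
    coinLaw.real {ω | R (f ω) (shift d ω)} =
      (∑ x, coinLaw.real {ω | R x ω}) / Fintype.card F := by
  have h := (hf.prod (.restrict e)).2 fun z => R z.1 (pad z.2)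
  rw [proportion_prod] at h
  simp only [← coinLaw_real_eq (hR _)] at h
  rw [← h]
  congr 1
  ext ω
  exact (dependsOn_pad_iff (hR _) _).symm

theorem coinLaw_real_and_shift {Q R : (ℕ → Bool) → Prop} (hQ : DependsOn Q (Set.Iio d))
    (hR : DependsOn R (Set.Iio e)) :
    coinLaw.real {ω | Q ω ∧ R (shift d ω)} = coinLaw.real {ω | Q ω} * coinLaw.real {ω | R ω} := by
  have h := ((Uniform.restrict d).prod (.restrict e)).2 fun z => Q (pad z.1) ∧ R (pad z.2)
  rw [proportion_and (fun v : Fin d → Bool => Q (pad v)) fun w : Fin e → Bool => R (pad w),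
    ← coinLaw_real_eq hQ,
    ← coinLaw_real_eq hR] at h
  rw [← h]
  congr 1
  ext ω
  exact (and_congr (dependsOn_pad_iff hQ _) (dependsOn_pad_iff hR _)).symm

theorem coinLaw_real_shift {R : (ℕ → Bool) → Prop} (d : ℕ) (hR : DependsOn R (Set.Iio e)) :
    coinLaw.real {ω | R (shift d ω)} = coinLaw.real {ω | R ω} := by
  have := coinLaw_real_and_shift (d := d) (Q := fun _ => True) (fun _ _ _ => rfl) hR
  simpa using this

theorem coinLaw_real_forall_shift {R : (ℕ → Bool) → Prop} (hR : DependsOn R (Set.Iio d)) (m : ℕ) :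
    coinLaw.real {ω | ∀ i < m, R (shift (i * d) ω)} = coinLaw.real {ω | R ω} ^ m := by
  have hdep : ∀ m, DependsOn (fun ω => ∀ i < m, R (shift (i * d) ω)) (Set.Iio (m * d)) := by
    intro m ω ω' h
    refine forall_congr fun i => forall_congr fun hi => hR fun j hj => h _ ?_
    have := Nat.mul_le_mul_right d (show i + 1 ≤ m from hi)
    rw [add_mul] at this
    simp only [Set.mem_Iio] at hj ⊢
    omega
  induction m with
  | zero => simp
  | succ m ih =>
    rw [pow_succ, ← ih, ← coinLaw_real_and_shift (hdep m) hR]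
    simp only [Nat.lt_succ_iff_lt_or_eq, or_imp, forall_and, forall_eq]

end Uniform

/-! ### Decoding the samples of the reduction -/

theorem bitsVal_lt (B : ℕ) (ω : ℕ → Bool) : bitsVal B ω < 2 ^ B := by
  induction B with
  | zero => simp [bitsVal]
  | succ B ih =>
    rw [bitsVal, pow_succ]
    split_ifs <;> omega

theorem dependsOn_bitsVal (B : ℕ) : DependsOn (bitsVal B) (Set.Iio B) := by
  induction B with
  | zero => intro _ _ _; rfl
  | succ B ih =>
    intro ω ω' h
    rw [bitsVal, bitsVal, dependsOn_mono ih (Nat.le_succ B) h, h B (by simp)]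

theorem bitsVal_inj {B : ℕ} {ω ω' : ℕ → Bool} (h : bitsVal B ω = bitsVal B ω') :
    ∀ i < B, ω i = ω' i := by
  induction B with
  | zero => simp
  | succ B ih =>
    have h1 : bitsVal B ω = bitsVal B ω' ∧ ω B = ω' B := by
      rw [bitsVal, bitsVal] at h
      rcases hb : ω B <;> rcases hb' : ω' B <;> simp [hb, hb'] at h ⊢ <;> omega
    intro i hi
    rcases Nat.lt_succ_iff_lt_or_eq.1 hi with hi | rfl
    · exact ih h1.1 i hi
    · exact h1.2

/-- Binary expansion is injective on `B` digits, hence a bijection by counting. -/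
theorem uniform_bitsVal (B : ℕ) :
    Uniform B fun ω => (⟨bitsVal B ω, bitsVal_lt B ω⟩ : Fin (2 ^ B)) := by
  let φ : (Fin B → Bool) → Fin (2 ^ B) := fun v => ⟨bitsVal B (pad v), bitsVal_lt B _⟩
  have hφ : Function.Bijective φ := by
    rw [Fintype.bijective_iff_injective_and_card]
    refine ⟨fun v w h => ?_, by simp⟩
    funext i
    have := bitsVal_inj (Fin.mk.inj_iff.1 h) i i.2
    simpa [pad] using this
  convert (Uniform.restrict B).equiv (Equiv.ofBijective φ hφ) using 3 with ω
  exact (dependsOn_bitsVal B (pad_restrict B ω)).symm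

/-- The random choices of the reduction: a tuple of `l` vertices for each row of the upper half
and for each column, and a coin for each entry. -/
abbrev Sample (l n B : ℕ) : Type := (Fin (2 * n) → Fin l → Fin (2 ^ B)) × (Fin (2 * n) → Fin n → Bool)

/-- The random choices that are encoded by a sequence of coin flips. -/
def decode (l n B : ℕ) (ω : ℕ → Bool) : Sample l n B :=
  (fun a x => ⟨vertexOf B ω (a * l + x), bitsVal_lt B _⟩,
    fun a c => ω (2 * n * (l * B) + (a * n + c)))

theorem uniform_decode (l n B : ℕ) : Uniform (coinCount l n B) (decode l n B) := by
  have h := (((uniform_bitsVal B).iterate l).iterate (2 * n)).prod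
    ((Uniform.restrict n).iterate (2 * n))
  refine h.congr fun ω => Prod.ext (funext fun a => funext fun x => Fin.ext ?_)
    (funext fun a => funext fun c => ?_)
  · simp only [decode, vertexOf, shift_shift]
    rw [show (a * l + x : ℕ) * B = a * (l * B) + x * B by ring]
  · simp only [decode, shift_apply]

/-- The entries of the matrix that belongs to a sample. -/
def SampleEntry {l n B : ℕ} (N : ℕ) (E : ℕ → ℕ → Prop) (z : Sample l n B) (a : Fin (2 * n))
    (b : Fin n) : Prop :=
  ((a : ℕ) < n ∧ z.2 a b = true ∧
    ∀ x y, ReflAdj N E (z.1 a x) (z.1 ⟨n + b, by omega⟩ y)) ∨ (a : ℕ) = n + b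

open Classical in
/-- The matrix that belongs to a sample. -/
noncomputable def sampleMatrix {l n B : ℕ} (N : ℕ) (E : ℕ → ℕ → Prop) (z : Sample l n B) :
    Fin (2 * n) → Fin n → Bool :=
  fun a b => decide (SampleEntry N E z a b)

theorem sampleMatrix_eq_true {l n B N : ℕ} {E : ℕ → ℕ → Prop} {z : Sample l n B} {a : Fin (2 * n)}
    {b : Fin n} : sampleMatrix N E z a b = true ↔ SampleEntry N E z a b := by
  simp [sampleMatrix]

theorem entryMatrix_eq_sampleMatrix (N l n B : ℕ) (E : ℕ → ℕ → Prop) (ω : ℕ → Bool) :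
    entryMatrix N l n B E ω = sampleMatrix N E (decode l n B ω) := by
  funext a b
  have ha := a.2
  have hb := b.2
  rw [Bool.eq_iff_iff, entryMatrix_eq_true, sampleMatrix_eq_true, Entry, SampleEntry]
  split_ifs with h
  · simp only [h, true_and, show (a : ℕ) ≠ n + b by omega, or_false, decode, Fin.forall_iff]
  · simp only [h, false_and, false_or]

theorem success_iff {val : ∀ m k : ℕ, (Fin m → Fin k → Bool) → ℕ} {N l n B θ r : ℕ}
    {E : ℕ → ℕ → Prop} {ω : ℕ → Bool} : Success val N l n B θ r E ω ↔
      θ < r * val (2 * n) n (sampleMatrix N E (decode l n B ω)) := by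
  rw [Success, entryMatrix_eq_sampleMatrix]

theorem coinLaw_real_success (val : ∀ m k : ℕ, (Fin m → Fin k → Bool) → ℕ) (N l n B θ r : ℕ)
    (E : ℕ → ℕ → Prop) : coinLaw.real {ω | Success val N l n B θ r E ω} =
      proportion fun z : Sample l n B => θ < r * val (2 * n) n (sampleMatrix N E z) := by
  simp only [success_iff]
  exact (uniform_decode l n B).2 fun z => θ < r * val (2 * n) n (sampleMatrix N E z)

theorem dependsOn_success (val : ∀ m k : ℕ, (Fin m → Fin k → Bool) → ℕ) (N l n B θ r : ℕ)
    (E : ℕ → ℕ → Prop) : DependsOn (Success val N l n B θ r E) (Set.Iio (coinCount l n B)) := by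
  intro ω ω' h
  rw [eq_iff_iff, success_iff, success_iff, (uniform_decode l n B).1 h]

end RAM

/-! ### Random graphs -/

namespace PlantedClique

instance (N : ℕ) : MeasurableSingletonClass (SimpleGraph (Fin N)) where
  measurableSet_singleton G := by
    have : ({G} : Set (SimpleGraph (Fin N))) = SimpleGraph.edgeSet ⁻¹' {G.edgeSet} := by
      ext H; simp
    rw [this]
    exact SimpleGraph.measurable_edgeSet (MeasurableSet.singleton _)

instance (N : ℕ) : IsProbabilityMeasure (null N) := by
  unfold null; infer_instance

theorem null_singleton_eq {N : ℕ} (G : SimpleGraph (Fin N)) :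
    null N {G} = ((1 / 2 : NNReal)) ^ (N.choose 2) := by
  rw [null, SimpleGraph.binomialRandom_singleton]
  have h1 : unitInterval.toNNReal half = 1 / 2 := by
    ext; simp [half]
  have h2 : unitInterval.toNNReal (unitInterval.symm half) = 1 / 2 := by
    ext; simp [half]; norm_num
  have h3 : G.edgeSet.ncard ≤ N.choose 2 := by
    classical
    rw [← SimpleGraph.coe_edgeFinset, Set.ncard_coe_finset]
    simpa using G.card_edgeFinset_le_card_choose_two
  rw [h1, h2]
  norm_cast
  rw [← pow_add]
  simp
  omega

/-- At edge probability `1/2` the mass of a graph does not depend on its edges; as the masses add up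
to `1`, the distribution is uniform. -/
theorem null_singleton {N : ℕ} (G : SimpleGraph (Fin N)) :
    null N {G} = (Fintype.card (SimpleGraph (Fin N)) : ℝ≥0∞)⁻¹ := by
  have h : ∑ H, null N {H} = 1 := by
    rw [sum_measure_singleton]
    simp
  simp only [null_singleton_eq, Finset.sum_const, nsmul_eq_mul, Finset.card_univ] at h ⊢
  exact ENNReal.eq_inv_of_mul_eq_one_left (by rwa [mul_comm])

theorem lintegral_null {N : ℕ} (f : SimpleGraph (Fin N) → ℝ≥0∞) :
    ∫⁻ G, f G ∂null N = (∑ G, f G) / Fintype.card (SimpleGraph (Fin N)) := by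
  rw [lintegral_fintype, ENNReal.div_eq_inv_mul, Finset.mul_sum]
  exact Finset.sum_congr rfl fun G _ => by rw [null_singleton, mul_comm]

theorem lintegral_planted {N κ : ℕ} (f : SimpleGraph (Fin N) → ℝ≥0∞) :
    ∫⁻ G, f G ∂planted N κ = ((N.choose κ : ℕ) : ℝ≥0∞)⁻¹ *
      ∑ S ∈ (Finset.univ : Finset (Fin N)).powersetCard κ,
        (∑ G, f (G ⊔ cliqueOn S)) / Fintype.card (SimpleGraph (Fin N)) := by
  have hf : Measurable f := measurable_of_finite f
  rw [planted, lintegral_smul_measure, lintegral_finsetSum_measure, smul_eq_mul]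
  congr 1
  refine Finset.sum_congr rfl fun S _ => ?_
  rw [lintegral_map hf (measurable_of_finite _), lintegral_null]

/-- The graph whose edges are given by the part of a binary matrix above the diagonal. -/
def graphOf {N : ℕ} (v : Fin N → Fin N → Bool) : SimpleGraph (Fin N) where
  Adj a b := a ≠ b ∧ v (min a b) (max a b) = true
  symm := ⟨fun a b h => ⟨h.1.symm, by rw [min_comm, max_comm]; exact h.2⟩⟩
  loopless := ⟨fun _ h => h.1 rfl⟩

theorem graphOf_adj_of_lt {N : ℕ} (v : Fin N → Fin N → Bool) {a b : Fin N} (h : a < b) :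
    (graphOf v).Adj a b ↔ v a b = true := by
  show a ≠ b ∧ v (min a b) (max a b) = true ↔ _
  rw [min_eq_left h.le, max_eq_right h.le]
  exact and_iff_right h.ne

theorem graph_ext_of_lt {N : ℕ} {G H : SimpleGraph (Fin N)}
    (h : ∀ a b, a < b → (G.Adj a b ↔ H.Adj a b)) : G = H := by
  ext a b
  rcases lt_trichotomy a b with hab | rfl | hab
  · exact h a b hab
  · simp
  · rw [G.adj_comm, H.adj_comm]
    exact h b a hab

open Classical in
/-- A graph is given by the part of its adjacency matrix above the diagonal. -/
noncomputable def graphEquiv (N : ℕ) :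
    SimpleGraph (Fin N) ≃ ({p : Fin N × Fin N // p.1 < p.2} → Bool) where
  toFun G p := decide (G.Adj p.1.1 p.1.2)
  invFun w := graphOf fun a b => if h : a < b then w ⟨(a, b), h⟩ else false
  left_inv G := graph_ext_of_lt fun a b h => by
    rw [graphOf_adj_of_lt _ h, dif_pos h, decide_eq_true_eq]
  right_inv w := by
    funext ⟨⟨a, b⟩, h⟩
    have h : a < b := h
    rw [Bool.eq_iff_iff, decide_eq_true_eq, graphOf_adj_of_lt _ h, dif_pos h]

theorem graphEquiv_eq_true {N : ℕ} {G : SimpleGraph (Fin N)}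
    {p : {p : Fin N × Fin N // p.1 < p.2}} : graphEquiv N G p = true ↔ G.Adj p.1.1 p.1.2 := by
  simp [graphEquiv]

/-- As `A` and `B` are disjoint, the pairs in `A × B` are distinct potential edges, which are
independent. -/
theorem proportion_biclique (N : ℕ) {A B : Finset (Fin N)} (h : Disjoint A B) :
    RAM.proportion (fun G : SimpleGraph (Fin N) => ∀ a ∈ A, ∀ b ∈ B, G.Adj a b) =
      (1 / 2) ^ (A.card * B.card) := by
  classical
  have hne : ∀ p ∈ A ×ˢ B, p.1 ≠ p.2 := by
    intro p hp he
    rw [Finset.mem_product] at hp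
    exact Finset.disjoint_left.1 h hp.1 (he ▸ hp.2)
  let φ : {p // p ∈ A ×ˢ B} → {p : Fin N × Fin N // p.1 < p.2} := fun p =>
    ⟨(min p.1.1 p.1.2, max p.1.1 p.1.2), min_lt_max.2 (hne p.1 p.2)⟩
  -- Two pairs with the same unordered edge could differ only by being crossed, which would put a
  -- vertex of `A` into `B`.
  have hφ : Function.Injective φ := by
    rintro ⟨⟨a, b⟩, hp⟩ ⟨⟨a', b'⟩, hp'⟩ he
    have hd : ∀ x ∈ A, ∀ y ∈ B, x ≠ y := fun x hx y hy he =>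
      Finset.disjoint_left.1 h hx (he ▸ hy)
    rw [Finset.mem_product] at hp hp'
    have h1 := hd a hp.1 b hp.2
    have h2 := hd a hp.1 b' hp'.2
    have h3 := hd a' hp'.1 b hp.2
    simp only [φ, Subtype.mk.injEq, Prod.mk.injEq] at he
    rcases le_total a b with h4 | h4 <;> rcases le_total a' b' with h5 | h5 <;>
      simp only [h4, h5, min_eq_left, min_eq_right, max_eq_left, max_eq_right] at he
    · simp [he.1, he.2]
    · exact absurd he.1 h2
    · exact absurd he.2 h2
    · simp [he.1, he.2]
  have key : ∀ G : SimpleGraph (Fin N), (∀ a ∈ A, ∀ b ∈ B, G.Adj a b) ↔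
      ∀ p ∈ Finset.univ.image φ, graphEquiv N G p = true := by
    intro G
    rw [Finset.forall_mem_image]
    have hG : ∀ p : {p // p ∈ A ×ˢ B}, G.Adj (φ p).1.1 (φ p).1.2 ↔ G.Adj p.1.1 p.1.2 := by
      intro p
      rcases le_total p.1.1 p.1.2 with h | h
      · simp only [φ, min_eq_left h, max_eq_right h]
      · simp only [φ, min_eq_right h, max_eq_left h, G.adj_comm]
    simp only [graphEquiv_eq_true, hG]
    constructor
    · rintro h ⟨⟨a, b⟩, hp⟩ _
      rw [Finset.mem_product] at hp
      exact h a hp.1 b hp.2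
    · intro h a ha b hb
      exact h (x := ⟨(a, b), Finset.mem_product.2 ⟨ha, hb⟩⟩) (Finset.mem_univ _)
  rw [RAM.proportion_congr key, RAM.proportion_equiv (graphEquiv N)
    (fun v => ∀ p ∈ Finset.univ.image φ, v p = true),
    RAM.proportion_pi (F := Bool) (Finset.univ.image φ) (fun _ x => x = true)]
  have h2 : RAM.proportion (fun x : Bool => x = true) = 1 / 2 := by
    rw [RAM.proportion_eq, show (Finset.univ.filter fun x : Bool => x = true) = {true} from rfl]
    simp
  rw [h2, Finset.prod_const, Finset.card_image_of_injective _ hφ, Finset.card_univ,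
    Fintype.card_coe, Finset.card_product]

/-- Of the `N²` coins only those above the diagonal determine the graph; the others are discarded by
passing to a marginal. -/
theorem uniform_graphOf (N : ℕ) :
    RAM.Uniform (N * N) fun ω => graphOf fun a b : Fin N => ω (a * N + b) := by
  have h := (((RAM.Uniform.restrict N).iterate N).equiv
    (Equiv.curry (Fin N) (Fin N) Bool).symm).equiv
      (Equiv.piEquivPiSubtypeProd (fun p : Fin N × Fin N => p.1 < p.2) fun _ => Bool)
  refine ((h.fst).equiv (graphEquiv N).symm).congr fun ω => ?_
  rw [Equiv.symm_apply_eq]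
  funext p
  rw [Bool.eq_iff_iff, graphEquiv_eq_true, graphOf_adj_of_lt _ p.2]
  exact Iff.rfl

/-- The adjacency relation of a graph, as a relation between natural numbers. -/
def natAdj {N : ℕ} (G : SimpleGraph (Fin N)) (u v : ℕ) : Prop :=
  ∃ (hu : u < N) (hv : v < N), G.Adj ⟨u, hu⟩ ⟨v, hv⟩

theorem reflAdj_natAdj {N : ℕ} (G : SimpleGraph (Fin N)) (u v : ℕ) :
    RAM.ReflAdj N (natAdj G) u v ↔ ∃ (hu : u < N) (hv : v < N), u = v ∨ G.Adj ⟨u, hu⟩ ⟨v, hv⟩ := by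
  unfold RAM.ReflAdj natAdj
  constructor
  · rintro ⟨hu, hv, h⟩
    refine ⟨hu, hv, h.imp_right ?_⟩
    rintro ⟨h1, h2, h3⟩
    rcases le_total u v with h | h
    · simpa only [min_eq_left h, max_eq_right h] using h3
    · simpa only [min_eq_right h, max_eq_left h] using h3.symm
  · rintro ⟨hu, hv, h⟩
    refine ⟨hu, hv, h.imp_right fun h3 => ⟨by omega, by omega, ?_⟩⟩
    rcases le_total u v with h | h
    · simpa only [min_eq_left h, max_eq_right h] using h3
    · simpa only [min_eq_right h, max_eq_left h] using h3.symm

end PlantedClique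

namespace RAM

open PlantedClique

theorem sampleMatrix_congr {l n B N : ℕ} {E E' : ℕ → ℕ → Prop} {z z' : Sample l n B}
    (h2 : z.2 = z'.2) (h : ∀ a x b y, ReflAdj N E (z.1 a x) (z.1 b y) ↔
      ReflAdj N E' (z'.1 a x) (z'.1 b y)) : sampleMatrix N E z = sampleMatrix N E' z' := by
  funext a b
  rw [Bool.eq_iff_iff, sampleMatrix_eq_true, sampleMatrix_eq_true]
  simp only [SampleEntry, h, h2]

theorem reflAdj_congr_of_lt {N : ℕ} {E E' : ℕ → ℕ → Prop}
    (h : ∀ u v, u < v → v < N → (E u v ↔ E' u v)) (u v : ℕ) :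
    ReflAdj N E u v ↔ ReflAdj N E' u v := by
  unfold ReflAdj
  refine and_congr_right fun hu => and_congr_right fun hv => ?_
  by_cases huv : u = v
  · simp [huv]
  · exact or_congr_right (h _ _ (by omega) (by omega))

/-- The probability that the reduction is successful on a graph. -/
noncomputable def successProb (val : ∀ m k : ℕ, (Fin m → Fin k → Bool) → ℕ) (l n B θ r : ℕ)
    {N : ℕ} (G : SimpleGraph (Fin N)) : ℝ :=
  coinLaw.real {ω | Success val N l n B θ r (natAdj G) ω}

theorem successProb_eq (val : ∀ m k : ℕ, (Fin m → Fin k → Bool) → ℕ) (l n B θ r : ℕ)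
    {N : ℕ} (G : SimpleGraph (Fin N)) : successProb val l n B θ r G =
      proportion fun z : Sample l n B => θ < r * val (2 * n) n (sampleMatrix N (natAdj G) z) :=
  coinLaw_real_success ..

/-- Relabelling the vertices permutes the possible tuples, which are uniformly distributed, and
leaves the resulting matrix unchanged. -/
theorem successProb_simpleGraph (val : ∀ m k : ℕ, (Fin m → Fin k → Bool) → ℕ)
    {l n B θ r N : ℕ} (hN : N ≤ 2 ^ B) (σ : Equiv.Perm (Fin N)) (G : SimpleGraph (Fin N)) :
    successProb val l n B θ r (Equiv.simpleGraph σ G) = successProb val l n B θ r G := by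
  -- Tuples have entries below `2^B`, so `σ` is extended by the identity to the numbers that are not
  -- vertices.
  set τ : Equiv.Perm (Fin (2 ^ B)) := σ.viaFintypeEmbedding (Fin.castLEEmb hN) with hτ
  have h1 : ∀ a : Fin N, τ (Fin.castLE hN a) = Fin.castLE hN (σ a) := fun a =>
    Equiv.Perm.viaFintypeEmbedding_apply_image σ (Fin.castLEEmb hN) a
  have h2 : ∀ u : Fin (2 ^ B), (τ u : ℕ) < N ↔ (u : ℕ) < N := by
    intro u
    by_cases hu : (u : ℕ) < N
    · have := h1 ⟨u, hu⟩
      rw [show Fin.castLE hN ⟨u, hu⟩ = u from rfl] at this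
      simp [this, hu]
    · rw [hτ, Equiv.Perm.viaFintypeEmbedding_apply_notMem_range]
      rintro ⟨a, rfl⟩
      exact hu a.2
  have h3 : ∀ u : Fin (2 ^ B), ∀ hu : (u : ℕ) < N, ∀ hu' : (τ u : ℕ) < N,
      (⟨τ u, hu'⟩ : Fin N) = σ ⟨u, hu⟩ := by
    intro u hu hu'
    have := h1 ⟨u, hu⟩
    rw [show Fin.castLE hN ⟨u, hu⟩ = u from rfl] at this
    exact Fin.ext (by simp [this])
  rw [successProb_eq, successProb_eq, ← proportion_equiv (Equiv.prodCongr
    (Equiv.piCongrRight fun _ : Fin (2 * n) => Equiv.piCongrRight fun _ : Fin l => τ)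
      (Equiv.refl _))]
  refine proportion_congr fun z => ?_
  suffices h : ∀ a x b y, ReflAdj N (natAdj (Equiv.simpleGraph σ G)) (τ (z.1 a x)) (τ (z.1 b y)) ↔
      ReflAdj N (natAdj G) (z.1 a x) (z.1 b y) by
    rw [sampleMatrix_congr (z := Equiv.prodCongr (Equiv.piCongrRight fun _ =>
      Equiv.piCongrRight fun _ => τ) (Equiv.refl _) z) (z' := z) (E' := natAdj G) rfl h]
  intro a x b y
  simp only [reflAdj_natAdj]
  constructor
  · rintro ⟨hu, hv, h⟩
    refine ⟨(h2 _).1 hu, (h2 _).1 hv, ?_⟩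
    rw [Fin.val_inj, τ.injective.eq_iff] at h
    rw [Fin.val_inj]
    refine h.imp_right fun h => ?_
    rw [h3 _ ((h2 _).1 hu), h3 _ ((h2 _).1 hv)] at h
    simpa [Equiv.simpleGraph] using h
  · rintro ⟨hu, hv, h⟩
    refine ⟨(h2 _).2 hu, (h2 _).2 hv, ?_⟩
    rw [Fin.val_inj, τ.injective.eq_iff]
    rw [Fin.val_inj] at h
    refine h.imp_right fun h => ?_
    rw [h3 _ hu, h3 _ hv]
    simpa [Equiv.simpleGraph] using h

/-- The first `κ` vertices. -/
def initialSegment (N κ : ℕ) : Finset (Fin N) := Finset.univ.filter fun u => (u : ℕ) < κ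

theorem exists_perm_map_eq {α : Type*} [Fintype α] [DecidableEq α] {S T : Finset α}
    (h : S.card = T.card) : ∃ σ : Equiv.Perm α, ∀ x, σ x ∈ T ↔ x ∈ S := by
  have e : {x // x ∈ S} ≃ {x // x ∈ T} := Fintype.equivOfCardEq (by simpa using h)
  refine ⟨e.extendSubtype, fun x => ⟨fun hx => ?_, e.extendSubtype_mem x⟩⟩
  by_contra hn
  exact e.extendSubtype_not_mem x hn hx

/-- A permutation that carries `S` to `T` preserves the set of all graphs and, by relabelling
invariance, the success probability. Planting on an initial segment is therefore as good as planting
on a random set. -/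
theorem sum_successProb_planted (val : ∀ m k : ℕ, (Fin m → Fin k → Bool) → ℕ)
    {l n B θ r N : ℕ} (hN : N ≤ 2 ^ B) {S T : Finset (Fin N)} (h : S.card = T.card) :
    ∑ G, successProb val l n B θ r (G ⊔ cliqueOn S) =
      ∑ G, successProb val l n B θ r (G ⊔ cliqueOn T) := by
  obtain ⟨σ, hσ⟩ := exists_perm_map_eq h
  rw [← Equiv.sum_comp (Equiv.simpleGraph σ)
    fun G => successProb val l n B θ r (G ⊔ cliqueOn T)]
  refine Finset.sum_congr rfl fun G _ => ?_
  rw [← successProb_simpleGraph val hN σ]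
  congr 1
  ext a b
  obtain ⟨a, rfl⟩ := σ.surjective a
  obtain ⟨b, rfl⟩ := σ.surjective b
  simp [Equiv.simpleGraph, cliqueOn, hσ]

/-- The first `N²` coins give a uniform graph and the later ones the sample. The generated matrix
and the graph agree above the diagonal, which is all that is read. -/
theorem coinLaw_real_plantedSuccess (val : ∀ m k : ℕ, (Fin m → Fin k → Bool) → ℕ)
    (N l n B θ r κ : ℕ) : coinLaw.real {ω | PlantedSuccess val N l n B θ r κ ω} =
      (∑ G, successProb val l n B θ r (G ⊔ cliqueOn (initialSegment N κ))) /
        Fintype.card (SimpleGraph (Fin N)) := by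
  unfold successProb
  rw [← coinLaw_real_fubini (uniform_graphOf N) fun G => dependsOn_success val N l n B θ r _]
  congr 1
  ext ω
  simp only [Set.mem_ofPred_eq, PlantedSuccess, success_iff]
  rw [sampleMatrix_congr rfl fun a x b y => reflAdj_congr_of_lt (fun u v huv hv => ?_) _ _]
  have hu : u < N := huv.trans hv
  simp only [natAdj, hu, hv, exists_true_left, SimpleGraph.sup_adj, PlantedEntry]
  rw [graphOf_adj_of_lt _ (by exact huv), or_comm]
  refine or_congr Iff.rfl ?_
  simp [cliqueOn, initialSegment, huv.ne]
  tauto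

end RAM

/-! ### The reduction on a random graph -/

namespace RAM

open PlantedClique

theorem injective_concept_sampleMatrix {l n B : ℕ} (N : ℕ) (E : ℕ → ℕ → Prop)
    (z : Sample l n B) : Function.Injective (Learning.concept (sampleMatrix N E z)) := by
  intro b b' h
  have hb := b.2
  have h1 : (⟨n + b, by omega⟩ : Fin (2 * n)) ∈ Learning.concept (sampleMatrix N E z) b' := by
    rw [← h]
    simp [Learning.concept, sampleMatrix_eq_true, SampleEntry]
  simp [Learning.concept, sampleMatrix_eq_true, SampleEntry] at h1
  exact Fin.ext h1

/-- `G` contains a complete bipartite graph with `h` vertices on each side. -/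
def HasBiclique {N : ℕ} (h : ℕ) (G : SimpleGraph (Fin N)) : Prop :=
  ∃ p ∈ (Finset.univ : Finset (Fin N)).powersetCard h ×ˢ
    (Finset.univ : Finset (Fin N)).powersetCard h,
      Disjoint p.1 p.2 ∧ ∀ a ∈ p.1, ∀ b ∈ p.2, G.Adj a b

/-- Some `t` of the tuples have all their entries in the same `w` vertices. -/
def Concentrated {l n B : ℕ} (N w t : ℕ) (z : Sample l n B) : Prop :=
  ∃ p ∈ (Finset.univ : Finset (Fin N)).powersetCard w ×ˢ
    (Finset.univ : Finset (Fin (2 * n))).powersetCard t,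
      ∀ a ∈ p.2, ∀ x, ∃ v ∈ p.1, (v : ℕ) = z.1 a x

/-- If `t` rows had a common `1` in more than `t` columns, then every vertex in the row tuples would
be equal or adjacent to every vertex in the column tuples. Without concentration both vertex sets
have more than `2h` elements, so disjoint subsets of size `h` can be chosen, and these form a
biclique. -/
theorem littlestoneDim_sampleMatrix_le {l n B N h t : ℕ} {G : SimpleGraph (Fin N)}
    {z : Sample l n B} (hN : 2 * h ≤ N) (ht : 0 < t) (hG : ¬ HasBiclique h G)
    (hz : ¬ Concentrated N (2 * h) t z) :
    Learning.littlestoneDim (Learning.conceptClass (sampleMatrix N (natAdj G) z)) ≤ 2 * t := by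
  classical
  refine Learning.littlestoneDim_le_two_mul _ t fun S hS => ?_
  by_contra! hcard
  set C : Finset (Fin n) := Finset.univ.filter fun b =>
    S ⊆ Learning.concept (sampleMatrix N (natAdj G) z) b with hC
  have hCcard : t < C.card := by
    refine hcard.trans_le ?_
    refine (Finset.card_le_card ?_).trans
      (Finset.card_image_le (s := C) (f := Learning.concept (sampleMatrix N (natAdj G) z)))
    intro c hc
    rw [Finset.mem_filter, Learning.conceptClass, Finset.mem_image] at hc
    obtain ⟨⟨b, -, rfl⟩, hb⟩ := hc
    exact Finset.mem_image_of_mem _ (by simpa [hC] using hb)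
  have hentry : ∀ a ∈ S, ∀ b ∈ C, SampleEntry N (natAdj G) z a b := by
    intro a ha b hb
    have := (Finset.mem_filter.1 hb).2 ha
    simpa [Learning.concept, sampleMatrix_eq_true] using this
  obtain ⟨a₀, ha₀⟩ := Finset.card_pos.1 (ht.trans_le hS)
  -- Two different columns exclude the identity block: a row there has its only `1` in one column.
  -- So all entries considered come from the adjacency test.
  obtain ⟨b₀, hb₀, b₁, hb₁, hb⟩ := Finset.one_lt_card.1 (show 1 < C.card by omega)
  have hadj : ∀ a ∈ S, ∀ b ∈ C, ∀ x y,
      ReflAdj N (natAdj G) (z.1 a x) (z.1 ⟨n + b, by omega⟩ y) := by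
    intro a ha b hb'
    rcases hentry a ha b hb' with h1 | h1
    · exact h1.2.2
    · rcases hentry a ha b₀ hb₀ with h2 | h2
      · omega
      · rcases hentry a ha b₁ hb₁ with h3 | h3
        · omega
        · exact absurd (Fin.ext (by omega)) hb
  let U : Finset (Fin (2 * n)) → Finset (Fin N) := fun T =>
    Finset.univ.filter fun u => ∃ a ∈ T, ∃ x, (u : ℕ) = z.1 a x
  have hU : ∀ T : Finset (Fin (2 * n)), t ≤ T.card → (∀ a ∈ T, ∀ x, (z.1 a x : ℕ) < N) →
      2 * h < (U T).card := by
    intro T hT hlt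
    by_contra! hle
    -- The set of vertices is enlarged to exactly `2h` elements, the size over which `Concentrated`
    -- quantifies; there is room since `2h ≤ N`.
    obtain ⟨W, hW, hWc⟩ := Finset.exists_superset_card_eq hle (by simpa using hN)
    obtain ⟨T', hT', hTc⟩ := Finset.exists_subset_card_eq hT
    refine hz ⟨(W, T'), by simp [hWc, hTc], fun a ha x => ?_⟩
    refine ⟨⟨z.1 a x, hlt a (hT' ha) x⟩, hW ?_, rfl⟩
    exact Finset.mem_filter.2 ⟨Finset.mem_univ _, a, hT' ha, x, rfl⟩
  let e : Fin n ↪ Fin (2 * n) := ⟨fun b => ⟨n + b, by omega⟩, fun b b' hbb => by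
    simpa [Fin.ext_iff] using hbb⟩
  have h1 := hU S hS fun a ha x => (hadj a ha b₀ hb₀ x x).1
  have h2 := hU (C.map e) (by rw [Finset.card_map]; omega) (by
    intro a ha x
    obtain ⟨b, hb, rfl⟩ := Finset.mem_map.1 ha
    exact (hadj a₀ ha₀ b hb x x).2.1)
  obtain ⟨A, hA, hAc⟩ := Finset.exists_subset_card_eq (show h ≤ (U S).card by omega)
  -- Removing `A` costs only `h` of more than `2h` vertices, and makes the case of equal vertices
  -- impossible.
  have h3 : h ≤ (U (C.map e) \ A).card := by
    have := Finset.le_card_sdiff A (U (C.map e))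
    omega
  obtain ⟨B', hB, hBc⟩ := Finset.exists_subset_card_eq h3
  refine hG ⟨(A, B'), by simp [hAc, hBc], ?_, fun u hu v hv => ?_⟩
  · exact Finset.disjoint_of_subset_right hB Finset.disjoint_sdiff
  · obtain ⟨-, a, ha, x, hax⟩ := Finset.mem_filter.1 (hA hu)
    obtain ⟨hv1, hv2⟩ := Finset.mem_sdiff.1 (hB hv)
    obtain ⟨-, c, hc, y, hby⟩ := Finset.mem_filter.1 hv1
    obtain ⟨b, hb, rfl⟩ := Finset.mem_map.1 hc
    have h4 := hadj a ha b hb x y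
    rw [reflAdj_natAdj, ← hax, show (⟨n + b, by omega⟩ : Fin (2 * n)) = e b from rfl, ← hby] at h4
    obtain ⟨_, _, h5 | h5⟩ := h4
    · exact absurd (Fin.ext h5 ▸ hu) hv2
    · exact h5

theorem card_powersetCard_le_pow (n k : ℕ) :
    (((Finset.univ : Finset (Fin n)).powersetCard k).card : ℝ) ≤ (n : ℝ) ^ k := by
  rw [Finset.card_powersetCard, Finset.card_univ, Fintype.card_fin]
  exact_mod_cast Nat.choose_le_pow n k

/-- A union bound over both sides; a given disjoint pair is complete with probability `2^(-h²)`. -/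
theorem proportion_hasBiclique_le (N h : ℕ) :
    proportion (HasBiclique (N := N) h) ≤ (N : ℝ) ^ (2 * h) * (1 / 2) ^ (h * h) := by
  refine (proportion_exists_le_card_mul _ _ (c := (1 / 2) ^ (h * h)) fun p hp => ?_).trans ?_
  · rw [Finset.mem_product, Finset.mem_powersetCard, Finset.mem_powersetCard] at hp
    by_cases hd : Disjoint p.1 p.2
    · refine (proportion_mono fun G hG => hG.2).trans ?_
      rw [proportion_biclique N hd, hp.1.2, hp.2.2]
    · have : ∀ G : SimpleGraph (Fin N),
          ¬ (Disjoint p.1 p.2 ∧ ∀ a ∈ p.1, ∀ b ∈ p.2, G.Adj a b) := fun G h => hd h.1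
      simp only [proportion, this]
      simp
  · rw [Finset.card_product, Nat.cast_mul, two_mul, pow_add]
    gcongr <;> exact card_powersetCard_le_pow N h

theorem proportion_forall_tuple {l n B : ℕ} (T : Finset (Fin (2 * n)))
    (Q : Fin (2 ^ B) → Prop) : proportion (fun z : Sample l n B => ∀ a ∈ T, ∀ x, Q (z.1 a x)) =
      (proportion Q ^ l) ^ T.card := by
  rw [proportion_fst (F' := Fin (2 * n) → Fin n → Bool)
    fun f : Fin (2 * n) → Fin l → Fin (2 ^ B) => ∀ a ∈ T, ∀ x, Q (f a x),
    proportion_pi T fun _ (g : Fin l → Fin (2 ^ B)) => ∀ x, Q (g x)]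
  rw [proportion_mem_univ_pi, Fintype.card_fin, Finset.prod_const]

/-- A union bound over at most `N^w` vertex sets and `(2n)^t` sets of tuples; all `t * l` entries
are independent, and each falls into the set with probability at most `w / 2^B`. -/
theorem proportion_concentrated_le (l n B N w t : ℕ) :
    proportion (Concentrated (l := l) (n := n) (B := B) N w t) ≤
      (N : ℝ) ^ w * ((2 * n) * ((w : ℝ) / 2 ^ B) ^ l) ^ t := by
  classical
  refine (proportion_exists_le_card_mul _ _
    (c := (((w : ℝ) / 2 ^ B) ^ l) ^ t) fun p hp => ?_).trans ?_
  · rw [Finset.mem_product, Finset.mem_powersetCard, Finset.mem_powersetCard] at hp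
    rw [proportion_forall_tuple p.2 fun u => ∃ v ∈ p.1, (v : ℕ) = u, hp.2.2]
    refine pow_le_pow_left₀ (pow_nonneg (proportion_nonneg _) _)
      (pow_le_pow_left₀ (proportion_nonneg _) ?_ _) _
    rw [proportion_eq, Fintype.card_fin]
    push_cast
    gcongr
    rw [← hp.1.2, ← Finset.card_map Fin.valEmbedding, ← Finset.card_map (Fin.valEmbedding (n := N))]
    refine Finset.card_le_card fun u hu => ?_
    obtain ⟨u, hu', rfl⟩ := Finset.mem_map.1 hu
    obtain ⟨-, v, hv, hvu⟩ := Finset.mem_filter.1 hu'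
    exact Finset.mem_map.2 ⟨v, hv, hvu⟩
  · rw [Finset.card_product, Nat.cast_mul, mul_pow (2 * (n : ℝ)), mul_assoc]
    gcongr
    · exact card_powersetCard_le_pow N w
    · exact_mod_cast card_powersetCard_le_pow (2 * n) t

/-- Without a biclique and without concentration the computed value is at most `2t`, and by `hθ` the
threshold is then not exceeded. -/
theorem average_successProb_le {val : ∀ m k : ℕ, (Fin m → Fin k → Bool) → ℕ}
    (hval : ∀ (m k : ℕ) (M : Fin m → Fin k → Bool), 0 < m → 0 < k →
      Function.Injective (Learning.concept M) →
        val m k M ≤ Learning.littlestoneDim (Learning.conceptClass M))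
    {l n B θ r N h t : ℕ} (hn : 0 < n) (hN : 2 * h ≤ N) (ht : 0 < t) (hθ : r * (2 * t) ≤ θ) :
    (∑ G : SimpleGraph (Fin N), successProb val l n B θ r G) /
      Fintype.card (SimpleGraph (Fin N)) ≤ (N : ℝ) ^ (2 * h) * (1 / 2) ^ (h * h) +
        (N : ℝ) ^ (2 * h) * ((2 * n) * (((2 * h : ℕ) : ℝ) / 2 ^ B) ^ l) ^ t := by
  have h1 : ∀ G : SimpleGraph (Fin N), successProb val l n B θ r G ≤
      proportion fun z : Sample l n B => HasBiclique h G ∨ Concentrated N (2 * h) t z := by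
    intro G
    rw [successProb_eq]
    refine proportion_mono fun z hz => ?_
    by_contra! hc
    have h2 := hval _ _ _ (by omega) hn (injective_concept_sampleMatrix N (natAdj G) z)
    have h3 := h2.trans (littlestoneDim_sampleMatrix_le hN ht hc.1 hc.2)
    have h4 := Nat.mul_le_mul_left r h3
    omega
  have : Nonempty (Sample l n B) := ⟨(fun _ _ => ⟨0, by positivity⟩, fun _ _ => false)⟩
  have h2 : proportion (fun z : SimpleGraph (Fin N) × Sample l n B =>
      HasBiclique h z.1 ∨ Concentrated N (2 * h) t z.2) ≤
      proportion (HasBiclique (N := N) h) +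
        proportion (Concentrated (l := l) (n := n) (B := B) N (2 * h) t) := by
    refine (proportion_or_le _ _).trans (add_le_add ?_ ?_)
    · rw [proportion_fst]
    · rw [proportion_prod_swap, proportion_fst]
  rw [proportion_prod] at h2
  refine le_trans ?_ (h2.trans (add_le_add (proportion_hasBiclique_le N h)
    (proportion_concentrated_le l n B N (2 * h) t)))
  exact div_le_div_of_nonneg_right (Finset.sum_le_sum fun G _ => h1 G) (Nat.cast_nonneg _)

end RAM

/-! ### The reduction on a graph with a large clique -/

namespace RAM

open PlantedClique

/-- All entries of a tuple belong to `S`. -/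
def Inside {l B N : ℕ} (S : Finset (Fin N)) (f : Fin l → Fin (2 ^ B)) : Prop :=
  ∀ x, ∃ v ∈ S, (v : ℕ) = f x

theorem proportion_inside {N B : ℕ} (l : ℕ) (hN : N ≤ 2 ^ B) (S : Finset (Fin N)) :
    proportion (Inside (l := l) (B := B) S) = ((S.card : ℝ) / 2 ^ B) ^ l := by
  classical
  have h := proportion_mem_univ_pi (ι := Fin l) fun u : Fin (2 ^ B) => ∃ v ∈ S, (v : ℕ) = u
  rw [Fintype.card_fin] at h
  rw [show Inside (l := l) (B := B) S = fun f => ∀ x, ∃ v ∈ S, (v : ℕ) = f x from rfl, h,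
    proportion_eq, Fintype.card_fin]
  push_cast
  congr 3
  rw [← Finset.card_map (Fin.castLEEmb hN)]
  congr 1
  ext u
  simp [Fin.ext_iff]

/-- The random choices, with those that belong to the same column taken together. -/
def sampleEquiv (l n B : ℕ) : Sample l n B ≃
    (Fin n → Fin l → Fin (2 ^ B)) × (Fin n → (Fin l → Fin (2 ^ B)) × (Fin (2 * n) → Bool)) where
  toFun z := (fun a => z.1 ⟨a, by omega⟩, fun c => (z.1 ⟨n + c, by omega⟩, fun a => z.2 a c))
  invFun w := (fun a => if h : (a : ℕ) < n then w.1 ⟨a, h⟩ else (w.2 ⟨a - n, by omega⟩).1,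
    fun a c => (w.2 c).2 a)
  left_inv z := by
    refine Prod.ext (funext fun a => ?_) rfl
    dsimp only
    split_ifs with h
    · rfl
    · exact congrArg z.1 (Fin.ext (by show n + ((a : ℕ) - n) = a; omega))
  right_inv w := by
    refine Prod.ext (funext fun a => ?_) (funext fun c => Prod.ext ?_ rfl)
    · simp
    · simp

/-- After regrouping by columns, the tuple of a column and its vector of coins are independent of
each other and of all other columns. -/
theorem proportion_forall_column {l n B : ℕ} (Q : (Fin l → Fin (2 ^ B)) → Prop)
    (R : (Fin (2 * n) → Bool) → Prop) :
    proportion (fun z : Sample l n B => ∀ c : Fin n,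
      ¬ (Q (z.1 ⟨n + c, by omega⟩) ∧ R fun a => z.2 a c)) =
        (1 - proportion Q * proportion R) ^ n := by
  have hne : Nonempty (Fin (2 ^ B)) := ⟨⟨0, by positivity⟩⟩
  refine (proportion_equiv (sampleEquiv l n B)
    fun w => ∀ c, ¬ (Q (w.2 c).1 ∧ R (w.2 c).2)).trans ?_
  rw [proportion_prod_swap, proportion_fst (F' := Fin n → Fin l → Fin (2 ^ B))
      fun w : Fin n → (Fin l → Fin (2 ^ B)) × (Fin (2 * n) → Bool) =>
        ∀ c, ¬ (Q (w c).1 ∧ R (w c).2),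
    proportion_mem_univ_pi fun w : (Fin l → Fin (2 ^ B)) × (Fin (2 * n) → Bool) =>
      ¬ (Q w.1 ∧ R w.2), proportion_not, proportion_and, Fintype.card_fin]

theorem proportion_pattern {m : ℕ} (T t : Finset (Fin m)) :
    proportion (fun g : Fin m → Bool => ∀ a ∈ T, (g a = true ↔ a ∈ t)) = (1 / 2) ^ T.card := by
  rw [proportion_pi T fun a (x : Bool) => (x = true ↔ a ∈ t)]
  refine Finset.prod_eq_pow_card fun a _ => ?_
  classical
  by_cases h : a ∈ t
  · rw [proportion_eq]
    simp only [h, iff_true]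
    rw [show (Finset.univ.filter fun x : Bool => x = true) = {true} from rfl]
    simp
  · rw [proportion_eq]
    simp only [h, iff_false]
    rw [show (Finset.univ.filter fun x : Bool => ¬ x = true) = {false} from rfl]
    simp

/-- Some block of `n₀` rows has no tuple inside `S`. -/
def EmptyBlock {l n B N : ℕ} (S : Finset (Fin N)) (d n₀ : ℕ) (z : Sample l n B) : Prop :=
  ∃ i ∈ Finset.range d, ∀ a ∈ Finset.univ.filter
    (fun a : Fin (2 * n) => i * n₀ ≤ a ∧ (a : ℕ) < (i + 1) * n₀), ¬ Inside S (z.1 a)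

/-- Some pattern on `d` rows does not occur in any column with a tuple inside `S`. -/
def MissingPattern {l n B N : ℕ} (S : Finset (Fin N)) (d : ℕ) (z : Sample l n B) : Prop :=
  ∃ T ∈ (Finset.univ : Finset (Fin (2 * n))).powersetCard d, ∃ t ∈ T.powerset,
    ∀ c : Fin n, ¬ (Inside S (z.1 ⟨n + c, by omega⟩) ∧ ∀ a ∈ T, (z.2 a c = true ↔ a ∈ t))

theorem proportion_emptyBlock_le {l n B N d n₀ : ℕ} (hN : N ≤ 2 ^ B) (hd : d * n₀ ≤ n)
    (S : Finset (Fin N)) : proportion (EmptyBlock (l := l) (n := n) (B := B) S d n₀) ≤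
      d * (1 - ((S.card : ℝ) / 2 ^ B) ^ l) ^ n₀ := by
  have hne : Nonempty (Fin (2 ^ B)) := ⟨⟨0, by positivity⟩⟩
  refine (proportion_exists_le_card_mul (Finset.range d) _
    (c := (1 - ((S.card : ℝ) / 2 ^ B) ^ l) ^ n₀) fun i hi => ?_).trans (by simp)
  have hi := Finset.mem_range.1 hi
  rw [proportion_fst (F' := Fin (2 * n) → Fin n → Bool)
    fun f : Fin (2 * n) → Fin l → Fin (2 ^ B) => ∀ a ∈ Finset.univ.filter
      (fun a : Fin (2 * n) => i * n₀ ≤ a ∧ (a : ℕ) < (i + 1) * n₀), ¬ Inside S (f a),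
    proportion_pi _ fun _ (g : Fin l → Fin (2 ^ B)) => ¬ Inside S g, Finset.prod_const,
    proportion_not, proportion_inside l hN]
  refine le_of_eq ?_
  congr 1
  have h1 : (i + 1) * n₀ ≤ n := (Nat.mul_le_mul_right n₀ (show i + 1 ≤ d from hi)).trans hd
  rw [← Finset.card_map Fin.valEmbedding]
  have : (Finset.univ.filter fun a : Fin (2 * n) => i * n₀ ≤ a ∧ (a : ℕ) < (i + 1) * n₀).map
      Fin.valEmbedding = Finset.Ico (i * n₀) ((i + 1) * n₀) := by
    ext a
    simp only [Finset.mem_map, Finset.mem_filter, Finset.mem_univ, true_and, Finset.mem_Ico,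
      Fin.valEmbedding_apply]
    constructor
    · rintro ⟨b, hb, rfl⟩; exact hb
    · intro h; exact ⟨⟨a, by omega⟩, h, rfl⟩
  rw [this, Nat.card_Ico, add_mul, one_mul, Nat.add_sub_cancel_left]

/-- The rows that will be shattered depend on the sample, so the union bound runs over all sets of
`d` rows and all patterns on them. One column realizes a given pattern with probability `p^l
2^(-d)`. -/
theorem proportion_missingPattern_le {l n B N : ℕ} (hN : N ≤ 2 ^ B) (d : ℕ)
    (S : Finset (Fin N)) : proportion (MissingPattern (l := l) (n := n) (B := B) S d) ≤
      (2 * n) ^ d * (2 ^ d * (1 - ((S.card : ℝ) / 2 ^ B) ^ l * (1 / 2) ^ d) ^ n) := by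
  have h0 : 0 ≤ 1 - ((S.card : ℝ) / 2 ^ B) ^ l * (1 / 2) ^ d := by
    rw [← proportion_inside l hN S, sub_nonneg]
    exact mul_le_one₀ (proportion_le_one _) (by positivity) (pow_le_one₀ (by norm_num) (by norm_num))
  refine (proportion_exists_le_card_mul _ _
    (c := 2 ^ d * (1 - ((S.card : ℝ) / 2 ^ B) ^ l * (1 / 2) ^ d) ^ n) fun T hT => ?_).trans ?_
  · rw [Finset.mem_powersetCard] at hT
    refine (proportion_exists_le_card_mul _ _
      (c := (1 - ((S.card : ℝ) / 2 ^ B) ^ l * (1 / 2) ^ d) ^ n) fun t ht => ?_).trans ?_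
    · rw [proportion_forall_column (Inside S) fun g => ∀ a ∈ T, (g a = true ↔ a ∈ t),
        proportion_inside l hN, proportion_pattern, hT.2]
    · rw [Finset.card_powerset, hT.2]
      push_cast
      exact le_rfl
  · gcongr
    exact_mod_cast card_powersetCard_le_pow (2 * n) d

/-- Each of `d` disjoint blocks supplies a row whose tuple lies in the clique `S`. For a column with
tuple in `S`, the adjacency test on these rows is always passed, so its entries there are its coins,
and every pattern occurs among such columns. By `hd` the blocks lie in the upper half, clear of the
identity. -/
theorem le_vcDim_sampleMatrix {l n B N d n₀ : ℕ} {G : SimpleGraph (Fin N)} {S : Finset (Fin N)}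
    {z : Sample l n B} (hd : d * n₀ ≤ n) (hG : ∀ u ∈ S, ∀ v ∈ S, u ≠ v → G.Adj u v)
    (h1 : ¬ EmptyBlock S d n₀ z) (h2 : ¬ MissingPattern S d z) :
    d ≤ (Learning.conceptClass (sampleMatrix N (natAdj G) z)).vcDim := by
  classical
  have hrow : ∀ i : Fin d, ∃ a : Fin (2 * n), (i * n₀ ≤ a ∧ (a : ℕ) < (i + 1) * n₀) ∧
      Inside S (z.1 a) := by
    intro i
    by_contra! h
    exact h1 ⟨i, Finset.mem_range.2 i.2, fun a ha => h a (by simpa using ha)⟩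
  choose a ha hin using hrow
  have hinj : Function.Injective a := by
    intro i j hij
    have hi := ha i
    have hj := ha j
    rw [← hij] at hj
    refine Fin.ext ?_
    by_contra hne
    rcases Nat.lt_or_gt_of_ne hne with h | h
    · have := Nat.mul_le_mul_right n₀ (show (i : ℕ) + 1 ≤ j from h)
      omega
    · have := Nat.mul_le_mul_right n₀ (show (j : ℕ) + 1 ≤ i from h)
      omega
  set T : Finset (Fin (2 * n)) := Finset.univ.image a with hT
  have hTc : T.card = d := by
    rw [hT, Finset.card_image_of_injective _ hinj, Finset.card_univ, Fintype.card_fin]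
  have hsh : (Learning.conceptClass (sampleMatrix N (natAdj G) z)).Shatters T := by
    intro t ht
    have : ∃ c : Fin n, Inside S (z.1 ⟨n + c, by omega⟩) ∧
        ∀ a ∈ T, (z.2 a c = true ↔ a ∈ t) := by
      by_contra! h
      refine h2 ⟨T, by simp [hTc], t, Finset.mem_powerset.2 ht, fun c hc => ?_⟩
      obtain ⟨b, hb, h3⟩ := h c hc.1
      have := hc.2 b hb
      tauto
    obtain ⟨c, hc, hp⟩ := this
    refine ⟨_, Finset.mem_image_of_mem _ (Finset.mem_univ c), ?_⟩
    ext b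
    simp only [Finset.mem_inter, Learning.concept, Finset.mem_filter, Finset.mem_univ, true_and,
      sampleMatrix_eq_true]
    constructor
    · rintro ⟨hb, h3⟩
      rcases h3 with h3 | h3
      · exact (hp b hb).1 h3.2.1
      · obtain ⟨i, -, rfl⟩ := Finset.mem_image.1 hb
        have := ha i
        have h4 := Nat.mul_le_mul_right n₀ (show (i : ℕ) + 1 ≤ d from i.2)
        omega
    · intro hb
      refine ⟨ht hb, Or.inl ⟨?_, (hp b (ht hb)).2 hb, fun x y => ?_⟩⟩
      · obtain ⟨i, -, rfl⟩ := Finset.mem_image.1 (ht hb)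
        have := ha i
        have h4 := Nat.mul_le_mul_right n₀ (show (i : ℕ) + 1 ≤ d from i.2)
        omega
      · obtain ⟨i, -, rfl⟩ := Finset.mem_image.1 (ht hb)
        obtain ⟨u, hu, hux⟩ := hin i x
        obtain ⟨v, hv, hvy⟩ := hc y
        rw [reflAdj_natAdj, ← hux, ← hvy]
        refine ⟨u.2, v.2, ?_⟩
        by_cases huv : u = v
        · exact Or.inl (by rw [huv])
        · exact Or.inr (hG u hu v hv huv)
  rw [← hTc]
  exact hsh.card_le_vcDim

/-- A bound for the probability that the reduction with `d` rows in mind fails on a graph with a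
clique that contains a fraction `p` of all vertices. -/
noncomputable def failBound (l n d n₀ : ℕ) (p : ℝ) : ℝ :=
  d * (1 - p ^ l) ^ n₀ + (2 * n) ^ d * (2 ^ d * (1 - p ^ l * (1 / 2) ^ d) ^ n)

theorem one_sub_successProb_le {val : ∀ m k : ℕ, (Fin m → Fin k → Bool) → ℕ}
    {l n B θ r N d n₀ : ℕ}
    (hval : ∀ M : Fin (2 * n) → Fin n → Bool, Function.Injective (Learning.concept M) →
      d ≤ (Learning.conceptClass M).vcDim → θ < r * val (2 * n) n M)
    (hN : N ≤ 2 ^ B) (hd : d * n₀ ≤ n) {G : SimpleGraph (Fin N)} {S : Finset (Fin N)}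
    (hG : ∀ u ∈ S, ∀ v ∈ S, u ≠ v → G.Adj u v) :
    1 - successProb val l n B θ r G ≤ failBound l n d n₀ (S.card / 2 ^ B) := by
  have hne : Nonempty (Sample l n B) := ⟨(fun _ _ => ⟨0, by positivity⟩, fun _ _ => false)⟩
  rw [successProb_eq, ← proportion_not]
  refine (proportion_mono (R := fun z : Sample l n B => EmptyBlock S d n₀ z ∨
    MissingPattern S d z) fun z hz => ?_).trans ((proportion_or_le _ _).trans
      (add_le_add (proportion_emptyBlock_le hN hd S) (proportion_missingPattern_le hN d S)))
  by_contra! h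
  exact hz (hval _ (injective_concept_sampleMatrix N (natAdj G) z)
    (le_vcDim_sampleMatrix hd hG h.1 h.2))

theorem card_initialSegment {N κ : ℕ} (h : κ ≤ N) : (initialSegment N κ).card = κ := by
  rw [initialSegment, ← Finset.card_map Fin.valEmbedding]
  have : (Finset.univ.filter fun u : Fin N => (u : ℕ) < κ).map Fin.valEmbedding =
      Finset.range κ := by
    ext a
    simp only [Finset.mem_map, Finset.mem_filter, Finset.mem_univ, true_and, Finset.mem_range,
      Fin.valEmbedding_apply]
    constructor
    · rintro ⟨b, hb, rfl⟩; exact hb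
    · intro h; exact ⟨⟨a, by omega⟩, h, rfl⟩
  rw [this, Finset.card_range]

theorem one_sub_plantedSuccess_le {val : ∀ m k : ℕ, (Fin m → Fin k → Bool) → ℕ}
    {l n B θ r N d n₀ κ : ℕ}
    (hval : ∀ M : Fin (2 * n) → Fin n → Bool, Function.Injective (Learning.concept M) →
      d ≤ (Learning.conceptClass M).vcDim → θ < r * val (2 * n) n M)
    (hN : N ≤ 2 ^ B) (hd : d * n₀ ≤ n) (hκ : κ ≤ N) :
    1 - coinLaw.real {ω | PlantedSuccess val N l n B θ r κ ω} ≤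
      failBound l n d n₀ (κ / 2 ^ B) := by
  have h0 : (0 : ℝ) < Fintype.card (SimpleGraph (Fin N)) := by
    exact_mod_cast Fintype.card_pos
  rw [coinLaw_real_plantedSuccess, sub_le_iff_le_add, ← sub_le_iff_le_add', le_div_iff₀ h0]
  have h1 : ∀ G : SimpleGraph (Fin N), 1 - failBound l n d n₀ (κ / 2 ^ B) ≤
      successProb val l n B θ r (G ⊔ cliqueOn (initialSegment N κ)) := by
    intro G
    have := one_sub_successProb_le (l := l) (B := B) hval hN hd
      (G := G ⊔ cliqueOn (initialSegment N κ)) (S := initialSegment N κ) fun u hu v hv huv =>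
        Or.inr (by simp [cliqueOn, hu, hv, huv])
    rw [card_initialSegment hκ] at this
    linarith
  calc _ = ∑ _ : SimpleGraph (Fin N), (1 - failBound l n d n₀ (κ / 2 ^ B)) := by
        rw [Finset.sum_const, Finset.card_univ, nsmul_eq_mul, mul_comm]
    _ ≤ _ := Finset.sum_le_sum fun G _ => h1 G

end RAM

/-! ### The behaviour of the distinguisher -/

namespace RAM

open PlantedClique

theorem dependsOn_plantedSuccess (val : ∀ m k : ℕ, (Fin m → Fin k → Bool) → ℕ)
    (N l n B θ r κ : ℕ) :
    DependsOn (PlantedSuccess val N l n B θ r κ) (Set.Iio (testCoins N l n B)) := by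
  intro ω ω' h
  rw [eq_iff_iff, PlantedSuccess, PlantedSuccess]
  refine Iff.trans ?_ (iff_of_eq (dependsOn_shift (d := N * N) (dependsOn_success val N l n B θ r
    (PlantedEntry N κ ω')) h))
  refine success_congr fun u v hu hv => ?_
  have hb := Nat.mul_le_mul_right N (show u + 1 ≤ N from hu)
  rw [add_mul] at hb
  rw [PlantedEntry, PlantedEntry, h (u * N + v)]
  simp only [testCoins, Set.mem_Iio]
  omega

theorem dependsOn_testsPass (val : ∀ m k : ℕ, (Fin m → Fin k → Bool) → ℕ)
    (N l n B θ r y D : ℕ) :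
    DependsOn (TestsPass val N l n B θ r y D) (Set.Iio (D * (N * testCoins N l n B))) := by
  intro ω ω' h
  refine forall_congr fun a => forall_congr fun ha => forall_congr fun i => forall_congr fun hi => ?_
  refine dependsOn_plantedSuccess val N l n B θ r _ fun x hx => h _ ?_
  have h1 := Nat.mul_le_mul_right (N * testCoins N l n B) (show a + 1 ≤ D from ha)
  have h2 := Nat.mul_le_mul_right (testCoins N l n B) (show i + 1 ≤ N from hi)
  simp only [Set.mem_Iio] at hx ⊢
  calc (a * N + i) * testCoins N l n B + x < a * (N * testCoins N l n B) +
        (i + 1) * testCoins N l n B := by nlinarith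
    _ ≤ a * (N * testCoins N l n B) + N * testCoins N l n B := by omega
    _ = (a + 1) * (N * testCoins N l n B) := by ring
    _ ≤ _ := h1

/-- Only the `N` tests with clique size `κ` are kept; they read disjoint blocks of coins. -/
theorem coinLaw_real_testsPass_le {val : ∀ m k : ℕ, (Fin m → Fin k → Bool) → ℕ}
    {N l n B θ r y D κ : ℕ} (h1 : y ≤ κ) (h2 : κ < y + D) :
    coinLaw.real {ω | TestsPass val N l n B θ r y D ω} ≤
      coinLaw.real {ω | PlantedSuccess val N l n B θ r κ ω} ^ N := by
  have hdep := dependsOn_plantedSuccess val N l n B θ r κ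
  have hdep2 : DependsOn (fun ω => ∀ i < N, PlantedSuccess val N l n B θ r κ
      (shift (i * testCoins N l n B) ω)) (Set.Iio (N * testCoins N l n B)) := by
    intro ω ω' h
    refine forall_congr fun i => forall_congr fun hi => hdep fun x hx => h _ ?_
    have h2 := Nat.mul_le_mul_right (testCoins N l n B) (show i + 1 ≤ N from hi)
    rw [add_mul] at h2
    simp only [Set.mem_Iio] at hx ⊢
    omega
  rw [← coinLaw_real_forall_shift hdep N,
    ← coinLaw_real_shift ((κ - y) * N * testCoins N l n B) hdep2]
  refine measureReal_mono fun ω hω i hi => ?_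
  have := hω (κ - y) (by omega) i hi
  rw [shift_shift, ← add_mul]
  rwa [show y + (κ - y) = κ by omega] at this

theorem coinLaw_real_not_testsPass_le {val : ∀ m k : ℕ, (Fin m → Fin k → Bool) → ℕ}
    {N l n B θ r y D : ℕ} {c : ℝ} (h : ∀ a < D,
      1 - coinLaw.real {ω | PlantedSuccess val N l n B θ r (y + a) ω} ≤ c) :
    coinLaw.real {ω | ¬ TestsPass val N l n B θ r y D ω} ≤ D * (N * c) := by
  have h1 : {ω | ¬ TestsPass val N l n B θ r y D ω} =
      ⋃ a ∈ Finset.range D, ⋃ i ∈ Finset.range N, {ω | ¬ PlantedSuccess val N l n B θ r (y + a)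
        (shift ((a * N + i) * testCoins N l n B) ω)} := by
    ext ω
    simp [TestsPass]
  rw [h1]
  refine (measureReal_biUnion_finset_le _ _).trans ?_
  refine (Finset.sum_le_sum fun a ha => (measureReal_biUnion_finset_le _ _).trans
    (Finset.sum_le_sum (g := fun _ => c) fun i _ => ?_)).trans (by simp)
  have hdep := dependsOn_plantedSuccess val N l n B θ r (y + a)
  have h2 : ∀ ω, (PlantedSuccess val N l n B θ r (y + a) ω → False) ↔
    ¬ PlantedSuccess val N l n B θ r (y + a) ω := fun _ => Iff.rfl
  rw [coinLaw_real_shift (R := fun ω => ¬ PlantedSuccess val N l n B θ r (y + a) ω) _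
    fun _ _ hω => congrArg Not (hdep hω)]
  refine le_trans (le_of_eq ?_) (h a (Finset.mem_range.1 ha))
  exact probReal_compl_eq_one_sub (measurableSet_of_dependsOn hdep)

theorem dependsOn_passes (val : ∀ m k : ℕ, (Fin m → Fin k → Bool) → ℕ) (q b N i : ℕ) :
    DependsOn (Passes val q b N i) (Set.Iio (offset q b N (i + 1))) := by
  rw [offset, Finset.sum_range_succ]
  exact dependsOn_shift (dependsOn_testsPass ..)

/-- The probability that the reduction of stage `i + 1` is successful on a graph. -/
noncomputable def stageProb (val : ∀ m k : ℕ, (Fin m → Fin k → Bool) → ℕ) (q b i : ℕ) {N : ℕ}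
    (G : SimpleGraph (Fin N)) : ℝ :=
  successProb val (8 * (i + 1)) (cols q b (i + 1)) (q * b) (thr q b) (i + 1) G

/-- The probability that a test of stage `i + 1` with clique size `κ` is successful. -/
noncomputable def testProb (val : ∀ m k : ℕ, (Fin m → Fin k → Bool) → ℕ) (q b N i κ : ℕ) : ℝ :=
  coinLaw.real {ω | PlantedSuccess val N (8 * (i + 1)) (cols q b (i + 1)) (q * b) (thr q b)
    (i + 1) κ ω}

theorem coinLaw_real_detects (val : ∀ m k : ℕ, (Fin m → Fin k → Bool) → ℕ) (q b i : ℕ) {N : ℕ}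
    (G : SimpleGraph (Fin N)) :
    coinLaw.real {ω | Detects val q b N (natAdj G) i ω} = stageProb val q b i G :=
  coinLaw_real_shift _ (dependsOn_success val _ _ _ _ _ _ _)

theorem coinLaw_real_passes_le {val : ∀ m k : ℕ, (Fin m → Fin k → Bool) → ℕ} {q b N i κ : ℕ}
    (h1 : 2 ^ (b - 1) ≤ κ) (h2 : κ ≤ N) :
    coinLaw.real {ω | Passes val q b N i ω} ≤ testProb val q b N i κ ^ N := by
  refine le_trans (le_of_eq ?_) (coinLaw_real_testsPass_le (D := sizes b N) h1
    (by unfold sizes; omega))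
  exact coinLaw_real_shift _ (dependsOn_testsPass val _ _ _ _ _ _ _ _)

theorem coinLaw_real_not_passes_le {val : ∀ m k : ℕ, (Fin m → Fin k → Bool) → ℕ} {q b N i : ℕ}
    {c : ℝ} (h : ∀ κ, 2 ^ (b - 1) ≤ κ → κ ≤ N → 1 - testProb val q b N i κ ≤ c) :
    coinLaw.real {ω | ¬ Passes val q b N i ω} ≤ sizes b N * (N * c) := by
  refine le_trans (le_of_eq ?_) (coinLaw_real_not_testsPass_le (l := 8 * (i + 1))
    (n := cols q b (i + 1)) (B := q * b) (θ := thr q b) (r := i + 1) (y := 2 ^ (b - 1))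
    fun a ha => h (2 ^ (b - 1) + a) (by omega) (by unfold sizes at ha; omega))
  exact coinLaw_real_shift (R := fun ω => ¬ TestsPass val N _ _ _ _ _ _ _ ω) _
    fun _ _ hω => congrArg Not (dependsOn_testsPass val _ _ _ _ _ _ _ _ hω)

/-- For a fixed input the tests of a stage and its run on the input use disjoint coins. -/
theorem coinLaw_real_passes_and_not_detects (val : ∀ m k : ℕ, (Fin m → Fin k → Bool) → ℕ)
    (q b i : ℕ) {N : ℕ} (G : SimpleGraph (Fin N)) :
    coinLaw.real {ω | Passes val q b N i ω ∧ ¬ Detects val q b N (natAdj G) i ω} =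
      coinLaw.real {ω | Passes val q b N i ω} * (1 - stageProb val q b i G) := by
  have hdep := dependsOn_success val N (8 * (i + 1)) (cols q b (i + 1)) (q * b) (thr q b) (i + 1)
    (natAdj G)
  refine (coinLaw_real_and_shift (dependsOn_passes val q b N i)
    (R := fun ω => ¬ Success val N (8 * (i + 1)) (cols q b (i + 1)) (q * b) (thr q b) (i + 1)
      (natAdj G) ω) fun _ _ hω => congrArg Not (hdep hω)).trans ?_
  congr 1
  exact probReal_compl_eq_one_sub (measurableSet_of_dependsOn hdep)

theorem mem_graphInput_iff {N : ℕ} (G : SimpleGraph (Fin N)) {u v : ℕ} (hu : u < N) (hv : v < N) :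
    (inputState N N G.Adj).mem (u * N + v) ≠ 0 ↔ natAdj G u v := by
  simp only [inputState, ne_eq, ite_eq_right_iff, one_ne_zero, imp_false, not_not, natAdj, hu, hv,
    exists_true_left]
  constructor
  · rintro ⟨i, j, hij, h⟩
    have h1 : v = j := by
      have := congrArg (· % N) hij
      simpa [Nat.mul_add_mod_of_lt, Nat.add_mod, Nat.mod_eq_of_lt hv, Nat.mod_eq_of_lt j.2]
        using this
    have h2 : u = i := by
      rw [h1] at hij
      exact Nat.eq_of_mul_eq_mul_right (by omega) (Nat.add_right_cancel hij)
    subst h1 h2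
    exact h
  · intro h
    exact ⟨⟨u, hu⟩, ⟨v, hv⟩, rfl, h⟩

theorem detects_graphInput {val : ∀ m k : ℕ, (Fin m → Fin k → Bool) → ℕ} {q b N i : ℕ}
    (G : SimpleGraph (Fin N)) (ω : ℕ → Bool) :
    Detects val q b N (fun u v => (inputState N N G.Adj).mem (u * N + v) ≠ 0) i ω ↔
      Detects val q b N (natAdj G) i ω :=
  success_congr fun _ _ hu hv => mem_graphInput_iff G hu hv


theorem stageTime_mono (P : Prog) (T : Polynomial ℕ) (q b N : ℕ) {r r' : ℕ} (h : r ≤ r') :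
    stageTime P T q b N r ≤ stageTime P T q b N r' := by
  have h1 : cols q b r ≤ cols q b r' :=
    Nat.pow_le_pow_right (by norm_num) (Nat.mul_le_mul_right _ h)
  have hT : ∀ x y : ℕ, x ≤ y → T.eval x ≤ T.eval y := by
    intro x y hxy
    rw [Polynomial.eval_eq_sum, Polynomial.eval_eq_sum]
    exact Finset.sum_le_sum fun i _ => Nat.mul_le_mul_left _ (Nat.pow_le_pow_left hxy i)
  have h2 := hT _ _ (Nat.mul_le_mul (Nat.mul_le_mul_left 2 h1) h1)
  unfold stageTime testTime runTimeBound writeTime evalTime matrixTime entryTime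
  gcongr

/-- The output of the distinguisher is `1` if and only if there is a first stage with successful
tests and the input is recognized in this stage. -/
theorem accepts_iff {P : Prog} {T : Polynomial ℕ}
    {val : ∀ m k : ℕ, (Fin m → Fin k → Bool) → ℕ} (hP : Computes P T val)
    {q N b : ℕ} (hq : 0 < q) (hN2 : 2 ≤ N) (hb : b = Nat.clog (2 ^ q) N)
    (G : SimpleGraph (Fin N)) (ω : ℕ → Bool) :
    (∃ t s', Exec ω (distinguisher q P) (graphInput G) t s' ∧ s'.reg 0 = 1) ↔
      ∃ i < b, Passes val q b N i ω ∧ (∀ k < i, ¬ Passes val q b N k ω) ∧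
        Detects val q b N (natAdj G) i ω := by
  classical
  subst hb
  by_cases h : ∃ i < Nat.clog (2 ^ q) N, Passes val q (Nat.clog (2 ^ q) N) N i ω
  · obtain ⟨h1, h2⟩ := Nat.find_spec h
    have h3 : ∀ k < Nat.find h, ¬ Passes val q (Nat.clog (2 ^ q) N) N k ω := fun k hk hp =>
      Nat.find_min h hk ⟨hk.trans h1, hp⟩
    obtain ⟨t, s', hx, -, hs⟩ := tot_distinguisher_of_passes hP ω hq hN2 G.Adj h1 h2 h3
      fun j hj => stageTime_mono P T q _ N (Nat.succ_le_succ hj)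
    constructor
    · rintro ⟨t', s'', hx', h0⟩
      obtain ⟨rfl, rfl⟩ := hx.unique hx'
      refine ⟨_, h1, h2, h3, ?_⟩
      rw [← detects_graphInput]
      by_contra hd
      rw [hs, keepIf_neg hd] at h0
      omega
    · rintro ⟨i, hi1, hi2, hi3, hd⟩
      have : i = Nat.find h := by
        refine le_antisymm ?_ (Nat.find_min' h ⟨hi1, hi2⟩)
        by_contra! hlt
        exact hi3 _ hlt h2
      subst this
      refine ⟨t, s', hx, ?_⟩
      rw [hs, keepIf_pos ((detects_graphInput G ω).2 hd)]
  · push Not at h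
    obtain ⟨t, s', hx, -, hs⟩ := tot_distinguisher_of_not_passes hP ω hq hN2 G.Adj h
      fun j hj => stageTime_mono P T q _ N (show j + 1 ≤ Nat.clog (2 ^ q) N from hj)
    constructor
    · rintro ⟨t', s'', hx', h0⟩
      obtain ⟨rfl, rfl⟩ := hx.unique hx'
      omega
    · rintro ⟨i, hi1, hi2, -⟩
      exact absurd hi2 (h i hi1)

/-- Soundness ignores the tests: acceptance implies that some stage, passed or not, would detect a
clique in the input. -/
theorem acceptProb_le {P : Prog} {T : Polynomial ℕ}
    {val : ∀ m k : ℕ, (Fin m → Fin k → Bool) → ℕ} (hP : Computes P T val)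
    {q N b : ℕ} (hq : 0 < q) (hN2 : 2 ≤ N) (hb : b = Nat.clog (2 ^ q) N)
    (G : SimpleGraph (Fin N)) : acceptProb (distinguisher q P) (graphInput G) ≤
      ENNReal.ofReal (∑ i ∈ Finset.range b, stageProb val q b i G) := by
  rw [acceptProb, ← ofReal_measureReal]
  refine ENNReal.ofReal_le_ofReal ?_
  simp only [accepts_iff hP hq hN2 hb]
  calc _ ≤ coinLaw.real (⋃ i ∈ Finset.range b, {ω | Detects val q b N (natAdj G) i ω}) := by
        refine measureReal_mono (fun ω hω => ?_) (measure_ne_top _ _)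
        obtain ⟨i, hi, -, -, hd⟩ := hω
        exact Set.mem_biUnion (Finset.mem_coe.2 (Finset.mem_range.2 hi)) hd
    _ ≤ _ := (measureReal_biUnion_finset_le _ _).trans
        (Finset.sum_le_sum fun i _ => (coinLaw_real_detects val q b i G).le)

/-- If stage `i₀ + 1` passes, then there is a first stage that passes, and rejection means that this
stage fails on the input. -/
theorem le_acceptProb {P : Prog} {T : Polynomial ℕ}
    {val : ∀ m k : ℕ, (Fin m → Fin k → Bool) → ℕ} (hP : Computes P T val)
    {q N b i₀ : ℕ} (hq : 0 < q) (hN2 : 2 ≤ N) (hb : b = Nat.clog (2 ^ q) N) (hi₀ : i₀ < b)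
    (G : SimpleGraph (Fin N)) :
    ENNReal.ofReal (1 - ((∑ i ∈ Finset.range b, coinLaw.real {ω | Passes val q b N i ω} *
      (1 - stageProb val q b i G)) + coinLaw.real {ω | ¬ Passes val q b N i₀ ω})) ≤
        acceptProb (distinguisher q P) (graphInput G) := by
  rw [acceptProb, ← ofReal_measureReal]
  refine ENNReal.ofReal_le_ofReal ?_
  simp only [accepts_iff hP hq hN2 hb]
  set A : Set (ℕ → Bool) := {ω | ∃ i < b, Passes val q b N i ω ∧
    (∀ k < i, ¬ Passes val q b N k ω) ∧ Detects val q b N (natAdj G) i ω} with hA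
  have h1 : (1 : ℝ) ≤ coinLaw.real A + coinLaw.real Aᶜ := by
    rw [← probReal_univ (μ := coinLaw), ← Set.union_compl_self A]
    exact measureReal_union_le _ _
  have h2 : Aᶜ ⊆ (⋃ i ∈ Finset.range b, {ω | Passes val q b N i ω ∧
      ¬ Detects val q b N (natAdj G) i ω}) ∪ {ω | ¬ Passes val q b N i₀ ω} := by
    classical
    intro ω hω
    by_cases hp : Passes val q b N i₀ ω
    · have h : ∃ i, i < b ∧ Passes val q b N i ω := ⟨i₀, hi₀, hp⟩
      obtain ⟨h3, h4⟩ := Nat.find_spec h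
      refine Or.inl (Set.mem_biUnion (Finset.mem_coe.2 (Finset.mem_range.2 h3)) ⟨h4, fun hd => hω ?_⟩)
      exact ⟨_, h3, h4, fun k hk hp => Nat.find_min h hk ⟨hk.trans h3, hp⟩, hd⟩
    · exact Or.inr hp
  have h3 := (measureReal_mono h2 (measure_ne_top coinLaw _)).trans ((measureReal_union_le _ _).trans
    (add_le_add_left ((measureReal_biUnion_finset_le _ _).trans (Finset.sum_le_sum fun i _ =>
      (coinLaw_real_passes_and_not_detects val q b i G).le)) _))
  linarith

theorem runTime_le {ω : ℕ → Bool} {P : Prog} {s : State} {n : ℕ} {Q : State → Prop}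
    (h : Tot ω P s n Q) : runTime P s ω ≤ n := by
  obtain ⟨t, s', hx, ht, -⟩ := h
  exact (iInf_le_of_le t (iInf_le_of_le s' (iInf_le_of_le hx le_rfl))).trans (by exact_mod_cast ht)

/-- If stage `i₀ + 1` passes, the loop ends there at the latest; otherwise the worst case of all `b`
stages is charged to the exceptional event. -/
theorem expectedTime_le {P : Prog} {T : Polynomial ℕ}
    {val : ∀ m k : ℕ, (Fin m → Fin k → Bool) → ℕ} (hP : Computes P T val)
    {q N b i₀ : ℕ} (hq : 0 < q) (hN2 : 2 ≤ N) (hb : b = Nat.clog (2 ^ q) N) (hi₀ : i₀ < b)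
    (G : SimpleGraph (Fin N)) : expectedTime (distinguisher q P) (graphInput G) ≤
      ENNReal.ofReal ((setupTime q N + (i₀ + 1) * (stageTime P T q b N (i₀ + 1) + 1) + 3 : ℕ) +
        (setupTime q N + b * (stageTime P T q b N b + 1) + 3 : ℕ) *
          coinLaw.real {ω | ¬ Passes val q b N i₀ ω}) := by
  classical
  set A : ℕ := setupTime q N + (i₀ + 1) * (stageTime P T q b N (i₀ + 1) + 1) + 3 with hA
  set C : ℕ := setupTime q N + b * (stageTime P T q b N b + 1) + 3 with hC
  have hm : MeasurableSet {ω | ¬ Passes val q b N i₀ ω} :=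
    (measurableSet_of_dependsOn (dependsOn_passes val q b N i₀)).compl
  have h1 : ∀ ω, runTime (distinguisher q P) (graphInput G) ω ≤
      (A : ℝ≥0∞) + {ω | ¬ Passes val q b N i₀ ω}.indicator (fun _ => (C : ℝ≥0∞)) ω := by
    intro ω
    by_cases hp : Passes val q b N i₀ ω
    · have h : ∃ i, Passes val q b N i ω := ⟨i₀, hp⟩
      have h3 : Nat.find h ≤ i₀ := Nat.find_min' h hp
      refine le_trans ?_ le_self_add
      subst hb
      refine (runTime_le (tot_distinguisher_of_passes hP ω hq hN2 G.Adj (by omega)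
        (Nat.find_spec h) (fun k hk => Nat.find_min h hk) (M := stageTime P T q _ N (i₀ + 1))
        fun j hj => stageTime_mono P T q _ N (by omega))).trans ?_
      rw [hA]
      gcongr
    · refine le_trans ?_ le_add_self
      rw [Set.indicator_of_mem (show ω ∈ {ω | ¬ Passes val q b N i₀ ω} from hp)]
      subst hb
      by_cases h : ∃ i < Nat.clog (2 ^ q) N, Passes val q (Nat.clog (2 ^ q) N) N i ω
      · obtain ⟨h3, h4⟩ := Nat.find_spec h
        refine (runTime_le (tot_distinguisher_of_passes hP ω hq hN2 G.Adj h3 h4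
          (fun k hk hp => Nat.find_min h hk ⟨hk.trans h3, hp⟩) (M := stageTime P T q _ N _)
          fun j hj => stageTime_mono P T q _ N (show j + 1 ≤ Nat.clog (2 ^ q) N by omega))).trans ?_
        rw [hC]
        gcongr
        exact h3
      · push Not at h
        exact runTime_le (tot_distinguisher_of_not_passes hP ω hq hN2 G.Adj h
          fun j hj => stageTime_mono P T q _ N (show j + 1 ≤ Nat.clog (2 ^ q) N from hj))
  refine (lintegral_mono h1).trans (le_of_eq ?_)
  rw [lintegral_add_left measurable_const, lintegral_indicator_const hm, lintegral_const,
    measure_univ, mul_one, ENNReal.ofReal_add (by positivity) (by positivity),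
    ENNReal.ofReal_mul (by positivity), ofReal_measureReal, ENNReal.ofReal_natCast,
    ENNReal.ofReal_natCast]

end RAM

/-! ### Acceptance probabilities on random graphs -/

namespace RAM

open PlantedClique

/-- The powers `1, p, …, p^N` are all at least `p^N`, and their sum times `1 - p` is at most `1`. A
stage that is often wrong on planted graphs rarely passes `N` tests, and one that often passes is
rarely wrong. -/
theorem pow_mul_one_sub_le {p : ℝ} (h0 : 0 ≤ p) (h1 : p ≤ 1) (N : ℕ) :
    p ^ N * (1 - p) ≤ 1 / (N + 1) := by
  rw [le_div_iff₀ (by positivity)]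
  have h2 : ((N : ℝ) + 1) * p ^ N ≤ ∑ k ∈ Finset.range (N + 1), p ^ k := by
    calc ((N : ℝ) + 1) * p ^ N = ∑ _k ∈ Finset.range (N + 1), p ^ N := by simp
      _ ≤ _ := Finset.sum_le_sum fun k hk =>
        pow_le_pow_of_le_one h0 h1 (by have := Finset.mem_range.1 hk; omega)
  have h3 := geom_sum_mul_neg p (N + 1)
  have h4 := mul_le_mul_of_nonneg_right h2 (sub_nonneg.2 h1)
  have h5 : 0 ≤ p ^ (N + 1) := by positivity
  calc p ^ N * (1 - p) * (N + 1) = (N + 1) * p ^ N * (1 - p) := by ring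
    _ ≤ 1 := by linarith

theorem lintegral_null_acceptProb_le {P : Prog} {T : Polynomial ℕ}
    {val : ∀ m k : ℕ, (Fin m → Fin k → Bool) → ℕ} (hP : Computes P T val)
    {q N b : ℕ} (hq : 0 < q) (hN2 : 2 ≤ N) (hb : b = Nat.clog (2 ^ q) N) {c : ℝ}
    (h : ∀ i < b, (∑ G : SimpleGraph (Fin N), stageProb val q b i G) /
      Fintype.card (SimpleGraph (Fin N)) ≤ c) :
    ∫⁻ G, acceptProb (distinguisher q P) (graphInput G) ∂null N ≤ ENNReal.ofReal (b * c) := by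
  have h0 : (0 : ℝ) < Fintype.card (SimpleGraph (Fin N)) := by
    exact_mod_cast Fintype.card_pos
  have hnn : ∀ i (G : SimpleGraph (Fin N)), 0 ≤ stageProb val q b i G :=
    fun _ _ => measureReal_nonneg
  refine (lintegral_mono fun G => acceptProb_le hP hq hN2 hb G).trans ?_
  rw [lintegral_null, ← ENNReal.ofReal_sum_of_nonneg fun G _ => Finset.sum_nonneg fun i _ => hnn i G,
    ← ENNReal.ofReal_natCast, ← ENNReal.ofReal_div_of_pos h0]
  refine ENNReal.ofReal_le_ofReal ?_
  rw [Finset.sum_comm, Finset.sum_div]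
  refine (Finset.sum_le_sum fun i hi => h i (Finset.mem_range.1 hi)).trans ?_
  simp

/-- The link between test and application: averaged over the graph, success on the input has the
same probability as success of a test with the same clique size. -/
theorem average_stageProb_planted (val : ∀ m k : ℕ, (Fin m → Fin k → Bool) → ℕ) {q b N κ : ℕ}
    (i : ℕ) (hN : N ≤ 2 ^ (q * b)) (hκ : κ ≤ N) {S : Finset (Fin N)} (hS : S.card = κ) :
    (∑ G, stageProb val q b i (G ⊔ cliqueOn S)) / Fintype.card (SimpleGraph (Fin N)) =
      testProb val q b N i κ := by
  rw [testProb, coinLaw_real_plantedSuccess]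
  congr 1
  exact sum_successProb_planted val hN (hS.trans (card_initialSegment hκ).symm)

/-- After averaging over the graph, each stage contributes at most `p^N(1-p) ≤ 1/(N+1)` to the
error, where `p` is its test probability. Passing does not depend on the input, so the factor `p^N`
comes out of the average. -/
theorem le_lintegral_planted_acceptProb {P : Prog} {T : Polynomial ℕ}
    {val : ∀ m k : ℕ, (Fin m → Fin k → Bool) → ℕ} (hP : Computes P T val)
    {q N b i₀ κ : ℕ} (hq : 0 < q) (hN2 : 2 ≤ N) (hb : b = Nat.clog (2 ^ q) N) (hi₀ : i₀ < b)
    (hN : N ≤ 2 ^ (q * b)) (hκ1 : 2 ^ (b - 1) ≤ κ) (hκ2 : κ ≤ N) :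
    ENNReal.ofReal (1 - (b / (N + 1) + coinLaw.real {ω | ¬ Passes val q b N i₀ ω})) ≤
      ∫⁻ G, acceptProb (distinguisher q P) (graphInput G) ∂planted N κ := by
  have h0 : (0 : ℝ) < Fintype.card (SimpleGraph (Fin N)) := by
    exact_mod_cast Fintype.card_pos
  set ε := coinLaw.real {ω | ¬ Passes val q b N i₀ ω} with hε
  let g : SimpleGraph (Fin N) → ℝ := fun G => 1 - ((∑ i ∈ Finset.range b,
    coinLaw.real {ω | Passes val q b N i ω} * (1 - stageProb val q b i G)) + ε)
  have hg : ∀ S ∈ (Finset.univ : Finset (Fin N)).powersetCard κ,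
      1 - (b / (N + 1) + ε) ≤ (∑ G, g (G ⊔ cliqueOn S)) / Fintype.card (SimpleGraph (Fin N)) := by
    intro S hS
    have hS := (Finset.mem_powersetCard.1 hS).2
    have h1 : ∑ G, g (G ⊔ cliqueOn S) = Fintype.card (SimpleGraph (Fin N)) * (1 - ε) -
        ∑ i ∈ Finset.range b, coinLaw.real {ω | Passes val q b N i ω} *
          (Fintype.card (SimpleGraph (Fin N)) -
            ∑ G, stageProb val q b i (G ⊔ cliqueOn S)) := by
      simp only [g, Finset.sum_sub_distrib, Finset.sum_add_distrib]
      rw [Finset.sum_comm]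
      simp only [← Finset.mul_sum, Finset.sum_sub_distrib]
      simp only [Finset.sum_const, Finset.card_univ, nsmul_eq_mul]
      ring_nf
    have h2 : ∀ i ∈ Finset.range b, coinLaw.real {ω | Passes val q b N i ω} *
          (Fintype.card (SimpleGraph (Fin N)) - ∑ G, stageProb val q b i (G ⊔ cliqueOn S)) ≤
        Fintype.card (SimpleGraph (Fin N)) * (1 / (N + 1)) := by
      intro i _
      have h3 := average_stageProb_planted val i hN hκ2 hS
      rw [div_eq_iff h0.ne'] at h3
      rw [h3]
      have h4 : testProb val q b N i κ ≤ 1 := measureReal_le_one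
      have h5 : 0 ≤ testProb val q b N i κ := measureReal_nonneg
      calc _ = Fintype.card (SimpleGraph (Fin N)) * (coinLaw.real {ω | Passes val q b N i ω} *
            (1 - testProb val q b N i κ)) := by ring
        _ ≤ Fintype.card (SimpleGraph (Fin N)) * (testProb val q b N i κ ^ N *
            (1 - testProb val q b N i κ)) := by
          have := sub_nonneg.2 h4
          gcongr
          exact coinLaw_real_passes_le hκ1 hκ2
        _ ≤ _ := by
          gcongr
          exact pow_mul_one_sub_le h5 h4 N
    have h3 := Finset.sum_le_sum h2
    rw [Finset.sum_const, Finset.card_range, nsmul_eq_mul] at h3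
    rw [h1, le_div_iff₀ h0]
    calc _ = Fintype.card (SimpleGraph (Fin N)) * (1 - ε) -
          b * (Fintype.card (SimpleGraph (Fin N)) * (1 / (N + 1))) := by ring
      _ ≤ _ := by linarith
  rw [lintegral_planted]
  have h1 : ∀ S ∈ (Finset.univ : Finset (Fin N)).powersetCard κ,
      ENNReal.ofReal (1 - (b / (N + 1) + ε)) ≤
        (∑ G, acceptProb (distinguisher q P) (graphInput (G ⊔ cliqueOn S))) /
          Fintype.card (SimpleGraph (Fin N)) := by
    intro S hS
    refine (ENNReal.ofReal_le_ofReal (hg S hS)).trans ?_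
    rw [ENNReal.ofReal_div_of_pos h0, ENNReal.ofReal_natCast]
    gcongr
    -- The lower bounds `g` may be negative for some graphs, so subadditivity of `ENNReal.ofReal`
    -- replaces additivity.
    refine (Finset.le_sum_of_subadditive ENNReal.ofReal ENNReal.ofReal_zero.le
      (fun x y => ENNReal.ofReal_add_le) _ _).trans (Finset.sum_le_sum fun G _ => ?_)
    exact le_acceptProb hP hq hN2 hb hi₀ (G ⊔ cliqueOn S)
  have h2 : ((N.choose κ : ℕ) : ℝ≥0∞) ≠ 0 := by
    exact_mod_cast (Nat.choose_pos hκ2).ne'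
  calc _ = ((N.choose κ : ℕ) : ℝ≥0∞)⁻¹ * ∑ _S ∈ (Finset.univ : Finset (Fin N)).powersetCard κ,
        ENNReal.ofReal (1 - (b / (N + 1) + ε)) := by
        rw [Finset.sum_const, Finset.card_powersetCard, Finset.card_univ, Fintype.card_fin,
          nsmul_eq_mul, ← mul_assoc, ENNReal.inv_mul_cancel h2 (ENNReal.natCast_ne_top _), one_mul]
    _ ≤ _ := by
      gcongr with S hS
      exact h1 S hS

end RAM

/-! ### Estimates -/

namespace RAM

/-- The expected number of tuples inside `2h = 6qb` given vertices. The exponent splits as `8qb =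
(8q-5)b + b + 4b`: the first part cancels the number of columns, the second absorbs `2^9 (6qb)^8`,
and a factor `2^(-4b)` per unit of `r` remains. -/
theorem cols_mul_pow_le {q b r : ℕ} (hq : 1 ≤ q) (hr : 1 ≤ r)
    (hb : 2 ^ 9 * (6 * q * b) ^ 8 ≤ 2 ^ b) :
    (2 * (cols q b r : ℝ)) * (((2 * (3 * q * b) : ℕ) : ℝ) / 2 ^ (q * b)) ^ (8 * r) ≤
      (1 / 2) ^ (4 * b * r) := by
  have h1 : (2 * (cols q b r : ℝ)) ≤ (2 ^ (1 + width q b)) ^ r := by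
    rw [cols, ← pow_mul]
    push_cast
    rw [← pow_succ']
    refine pow_le_pow_right₀ (by norm_num) ?_
    rw [add_mul, mul_comm r]
    omega
  have h2 : (2 : ℝ) ^ (1 + width q b) * (((2 * (3 * q * b) : ℕ) : ℝ) / 2 ^ (q * b)) ^ 8 ≤
      (1 / 2) ^ (4 * b) := by
    have h3 : ((2 : ℝ) ^ 9 * ((2 * (3 * q * b) : ℕ) : ℝ) ^ 8) ≤ 2 ^ b := by
      have : 2 * (3 * q * b) = 6 * q * b := by ring
      rw [this]
      exact_mod_cast hb
    have h4 : 1 + width q b = 9 + (8 * q - 5) * b := by unfold width; omega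
    have h5 : (q * b) * 8 = (8 * q - 5) * b + b + 4 * b := by
      obtain ⟨q, rfl⟩ := Nat.exists_eq_add_of_le hq
      rw [show 8 * (1 + q) - 5 = 8 * q + 3 by omega]
      ring
    rw [div_pow, ← pow_mul, h4, h5, pow_add, pow_add, pow_add, one_div, inv_pow, ← mul_div_assoc,
      div_le_iff₀ (by positivity)]
    have h6 : (0 : ℝ) < 2 ^ (4 * b) := by positivity
    calc (2 : ℝ) ^ 9 * 2 ^ ((8 * q - 5) * b) * ((2 * (3 * q * b) : ℕ) : ℝ) ^ 8
        = 2 ^ ((8 * q - 5) * b) * (2 ^ 9 * ((2 * (3 * q * b) : ℕ) : ℝ) ^ 8) := by ring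
      _ ≤ 2 ^ ((8 * q - 5) * b) * 2 ^ b := by gcongr
      _ = _ := by field_simp
  calc _ ≤ (2 ^ (1 + width q b)) ^ r * (((2 * (3 * q * b) : ℕ) : ℝ) / 2 ^ (q * b)) ^ (8 * r) := by
        gcongr
    _ = ((2 : ℝ) ^ (1 + width q b) * (((2 * (3 * q * b) : ℕ) : ℝ) / 2 ^ (q * b)) ^ 8) ^ r := by
        rw [mul_pow, pow_mul _ 8 r]
    _ ≤ ((1 / 2) ^ (4 * b)) ^ r := by gcongr
    _ = _ := by rw [← pow_mul]

/-- With `m = (qb)²` the number of choices of `2h` vertices is at most `2^(6m)`. The choice `h =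
3qb` makes `h² = 9m`, and `t = ⌊2q²b/r⌋ + 1` makes `4brt ≥ 8m`, so both terms are small with room to
spare. -/
theorem nullBound_le {q b r N : ℕ} (hq : 1 ≤ q) (hr : 1 ≤ r) (hN : N ≤ 2 ^ (q * b))
    (hb : 2 ^ 9 * (6 * q * b) ^ 8 ≤ 2 ^ b) :
    (N : ℝ) ^ (2 * (3 * q * b)) * (1 / 2) ^ ((3 * q * b) * (3 * q * b)) +
      (N : ℝ) ^ (2 * (3 * q * b)) * ((2 * (cols q b r : ℝ)) *
        (((2 * (3 * q * b) : ℕ) : ℝ) / 2 ^ (q * b)) ^ (8 * r)) ^ (2 * q ^ 2 * b / r + 1) ≤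
      2 * (1 / 2) ^ (2 * b) := by
  set m := (q * b) ^ 2 with hm
  have hbm : b ≤ m := by
    rw [hm]
    calc b ≤ q * b := Nat.le_mul_of_pos_left b hq
      _ ≤ _ := Nat.le_self_pow (by norm_num) _
  have hN' : (N : ℝ) ^ (2 * (3 * q * b)) ≤ 2 ^ (6 * m) := by
    calc (N : ℝ) ^ (2 * (3 * q * b)) ≤ (2 ^ (q * b)) ^ (2 * (3 * q * b)) := by
          gcongr
          exact_mod_cast hN
      _ = _ := by rw [← pow_mul, hm]; congr 1; ring
  have hcancel : ∀ k, (2 : ℝ) ^ (6 * m) * (1 / 2) ^ (6 * m + k) = (1 / 2) ^ k := by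
    intro k
    rw [pow_add, ← mul_assoc, ← mul_pow]
    norm_num
  have h1 : (N : ℝ) ^ (2 * (3 * q * b)) * (1 / 2) ^ ((3 * q * b) * (3 * q * b)) ≤
      (1 / 2) ^ (2 * b) := by
    calc _ ≤ (2 : ℝ) ^ (6 * m) * (1 / 2) ^ (6 * m + 3 * m) := by
          rw [show 6 * m + 3 * m = (3 * q * b) * (3 * q * b) by rw [hm]; ring]
          gcongr
      _ = (1 / 2) ^ (3 * m) := hcancel _
      _ ≤ _ := pow_le_pow_of_le_one (by norm_num) (by norm_num) (by omega)
  have h2 : (N : ℝ) ^ (2 * (3 * q * b)) * ((2 * (cols q b r : ℝ)) *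
        (((2 * (3 * q * b) : ℕ) : ℝ) / 2 ^ (q * b)) ^ (8 * r)) ^ (2 * q ^ 2 * b / r + 1) ≤
      (1 / 2) ^ (2 * b) := by
    have h3 : 2 * q ^ 2 * b ≤ r * (2 * q ^ 2 * b / r + 1) :=
      (Nat.lt_mul_div_succ _ (by omega)).le
    have h4 : 6 * m + 2 * m ≤ 4 * b * r * (2 * q ^ 2 * b / r + 1) := by
      calc 6 * m + 2 * m = 4 * b * (2 * q ^ 2 * b) := by rw [hm]; ring
        _ ≤ 4 * b * (r * (2 * q ^ 2 * b / r + 1)) := Nat.mul_le_mul_left _ h3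
        _ = _ := by ring
    calc _ ≤ (2 : ℝ) ^ (6 * m) * ((1 / 2) ^ (4 * b * r)) ^ (2 * q ^ 2 * b / r + 1) := by
          gcongr
          exact cols_mul_pow_le hq hr hb
      _ ≤ (2 : ℝ) ^ (6 * m) * (1 / 2) ^ (6 * m + 2 * m) := by
          rw [← pow_mul]
          gcongr 2 ^ (6 * m) * ?_
          exact pow_le_pow_of_le_one (by norm_num) (by norm_num) h4
      _ = (1 / 2) ^ (2 * m) := hcancel _
      _ ≤ _ := pow_le_pow_of_le_one (by norm_num) (by norm_num) (by omega)
  linarith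

/-- Rounding up in `t` costs `2r ≤ 2b`, which is why the threshold has `4q² + 2` rather than `4q²`.
-/
theorem mul_two_mul_le_thr {q b r : ℕ} (hr : r ≤ b) :
    r * (2 * (2 * q ^ 2 * b / r + 1)) ≤ thr q b := by
  have := Nat.mul_div_le (2 * q ^ 2 * b) r
  unfold thr
  calc r * (2 * (2 * q ^ 2 * b / r + 1)) = 2 * (r * (2 * q ^ 2 * b / r)) + 2 * r := by ring
    _ ≤ 2 * (2 * q ^ 2 * b) + 2 * b := by omega
    _ = _ := by ring

theorem one_sub_pow_le_exp {x : ℝ} (hx : x ≤ 1) (m : ℕ) : (1 - x) ^ m ≤ Real.exp (-(x * m)) := by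
  calc (1 - x) ^ m ≤ Real.exp (-x) ^ m :=
        pow_le_pow_left₀ (sub_nonneg.2 hx) (Real.one_sub_le_exp_neg x) m
    _ = _ := by rw [← Real.exp_nat_mul]; ring_nf

/-- The second identity fixes the constants of `width`: with `d = br` and `p = 2^(b-1) / 2^(qb)`, a
block of `n₀ = 2^(r * width - d)` rows satisfies `p^(8r) n₀ = 4^d`. The summand `8` in `width`
compensates for `b - 1` in place of `b`. -/
theorem width_mul_eq {q b : ℕ} (hq : 1 ≤ q) (hb : 1 ≤ b) (r : ℕ) :
    b * r ≤ r * width q b ∧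
      (b - 1) * (8 * r) + (r * width q b - b * r) = q * b * (8 * r) + 2 * (b * r) := by
  obtain ⟨q, rfl⟩ := Nat.exists_eq_add_of_le hq
  obtain ⟨b, rfl⟩ := Nat.exists_eq_add_of_le hb
  have h : r * width (1 + q) (1 + b) = (1 + b) * r + (r * (8 * q + 2) * (1 + b) + 8 * r) := by
    unfold width
    rw [show 8 * (1 + q) - 5 = 8 * q + 3 by omega]
    ring
  refine ⟨by omega, ?_⟩
  rw [h, Nat.add_sub_cancel_left, Nat.add_sub_cancel_left]
  ring

theorem mul_width_le {q b : ℕ} (hq : 1 ≤ q) (hb : 1 ≤ b) (r : ℕ) :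
    r * width q b ≤ 16 * q * (b * r) := by
  calc r * width q b ≤ r * (8 * q * b + 8 * q * b) := by
        refine Nat.mul_le_mul_left r ?_
        unfold width
        have h5 : 1 ≤ q * b := Nat.mul_pos hq hb
        have h6 : (8 * q - 5) * b ≤ 8 * q * b := Nat.mul_le_mul_right b (by omega)
        have h7 : 8 * q * b = 8 * (q * b) := by ring
        omega
    _ = _ := by ring

/-- A block is expected to contain at least `4^d` tuples inside the clique. As `n = 2^d n₀`, at
least `4^d` columns inside the clique are also expected for each pattern, despite the loss of `2^d`.
Both failure probabilities are thus at most `exp(-4^d)` before the union bounds, which cost only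
`2^(19qd²)`. -/
theorem failBound_le {q b r : ℕ} (hq : 1 ≤ q) (hb : 1 ≤ b) (hr : 1 ≤ r) {p : ℝ}
    (hp : (2 : ℝ) ^ (b - 1) / 2 ^ (q * b) ≤ p) (hp1 : p ≤ 1) :
    failBound (8 * r) (cols q b r) (b * r) (2 ^ (r * width q b - b * r)) p ≤
      2 ^ (19 * q * (b * r) ^ 2) * Real.exp (-4 ^ (b * r)) := by
  obtain ⟨hw1, hw2⟩ := width_mul_eq hq hb r
  set d := b * r with hd
  set n₀ := 2 ^ (r * width q b - d) with hn₀
  have hp0 : 0 ≤ p := le_trans (by positivity) hp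
  have hd1 : 1 ≤ d := Nat.mul_pos hb hr
  have hcols : (cols q b r : ℝ) = 2 ^ d * n₀ := by
    rw [cols, hn₀]
    push_cast
    rw [← pow_add]
    congr 1
    omega
  have hx : (4 : ℝ) ^ d ≤ p ^ (8 * r) * n₀ := by
    calc (4 : ℝ) ^ d = ((2 : ℝ) ^ (b - 1) / 2 ^ (q * b)) ^ (8 * r) * n₀ := by
          rw [div_pow, ← pow_mul, ← pow_mul, hn₀, div_mul_eq_mul_div, eq_div_iff (by positivity)]
          push_cast
          rw [← pow_add, hw2, pow_add, pow_mul 2 2 d]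
          norm_num
          ring
      _ ≤ _ := by gcongr
  have hp2 : p ^ (8 * r) ≤ 1 := pow_le_one₀ hp0 hp1
  have hp3 : p ^ (8 * r) * (1 / 2) ^ d ≤ 1 :=
    mul_le_one₀ hp2 (by positivity) (pow_le_one₀ (by norm_num) (by norm_num))
  have h1 : (1 - p ^ (8 * r)) ^ n₀ ≤ Real.exp (-4 ^ d) :=
    (one_sub_pow_le_exp hp2 n₀).trans (Real.exp_le_exp.2 (neg_le_neg hx))
  have h2 : (1 - p ^ (8 * r) * (1 / 2) ^ d) ^ cols q b r ≤ Real.exp (-4 ^ d) := by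
    refine (one_sub_pow_le_exp hp3 _).trans (Real.exp_le_exp.2 (neg_le_neg ?_))
    rw [hcols, mul_assoc, ← mul_assoc ((1 / 2 : ℝ) ^ d), ← mul_pow]
    norm_num
    exact hx
  have h3 : (2 * (cols q b r : ℝ)) ^ d * 2 ^ d ≤ 2 ^ (18 * q * d ^ 2) := by
    have : 2 * (cols q b r : ℝ) * 2 = 2 ^ (r * width q b + 2) := by
      rw [cols]; push_cast; ring
    rw [← mul_pow, this, ← pow_mul]
    refine pow_le_pow_right₀ (by norm_num) ?_
    have h4 : r * width q b ≤ 16 * q * d := mul_width_le hq hb r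
    have h5 : 1 ≤ q * d := Nat.mul_pos hq hd1
    calc (r * width q b + 2) * d ≤ (16 * q * d + 2 * (q * d)) * d :=
          Nat.mul_le_mul_right d (by omega)
      _ = _ := by ring
  have h4 : (d : ℝ) ≤ 2 ^ (18 * q * d ^ 2) := by
    calc (d : ℝ) ≤ 2 ^ d := by exact_mod_cast Nat.lt_two_pow_self.le
      _ ≤ _ := by
        refine pow_le_pow_right₀ (by norm_num) ?_
        calc d ≤ d ^ 2 := Nat.le_self_pow (by norm_num) d
          _ ≤ _ := Nat.le_mul_of_pos_left _ (by omega)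
  have h5 : (2 : ℝ) ^ (18 * q * d ^ 2) + 2 ^ (18 * q * d ^ 2) ≤ 2 ^ (19 * q * d ^ 2) := by
    rw [← two_mul, ← pow_succ']
    refine pow_le_pow_right₀ (by norm_num) ?_
    have : 1 ≤ q * d ^ 2 := Nat.mul_pos hq (by positivity)
    calc 18 * q * d ^ 2 + 1 ≤ 18 * q * d ^ 2 + q * d ^ 2 := by omega
      _ = _ := by ring
  unfold failBound
  calc _ ≤ (d : ℝ) * Real.exp (-4 ^ d) + (2 * (cols q b r : ℝ)) ^ d *
        (2 ^ d * Real.exp (-4 ^ d)) := by gcongr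
    _ = (d + (2 * (cols q b r : ℝ)) ^ d * 2 ^ d) * Real.exp (-4 ^ d) := by ring
    _ ≤ _ := by
      refine mul_le_mul_of_nonneg_right ?_ (Real.exp_pos _).le
      linarith

theorem two_pow_mul_exp_neg_le {C d : ℕ} (hd : C + 4 ≤ d) :
    (2 : ℝ) ^ (C * d ^ 2) * Real.exp (-4 ^ d) ≤ (1 / 2) ^ d := by
  have h2 : (2 : ℝ) ≤ Real.exp 1 := by
    have := Real.add_one_le_exp (1 : ℝ)
    linarith
  have h1 : C * d ^ 2 + d ≤ 4 ^ d := by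
    have h3 : d ^ 2 ≤ 2 ^ d := by
      have : 4 ≤ d := by omega
      clear hd h2
      induction d, this using Nat.le_induction with
      | base => norm_num
      | succ d hd ih =>
        rw [pow_succ 2 d]
        nlinarith
    have h4 : C + 1 ≤ 2 ^ d := (by omega : C + 1 ≤ d).trans Nat.lt_two_pow_self.le
    calc C * d ^ 2 + d ≤ (C + 1) * d ^ 2 := by nlinarith
      _ ≤ 2 ^ d * 2 ^ d := Nat.mul_le_mul h4 h3
      _ = 4 ^ d := by rw [← mul_pow]; norm_num
  have h3 : (2 : ℝ) ^ (C * d ^ 2 + d) ≤ Real.exp (4 ^ d) := by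
    calc (2 : ℝ) ^ (C * d ^ 2 + d) ≤ 2 ^ (4 ^ d) := pow_le_pow_right₀ (by norm_num) h1
      _ ≤ Real.exp 1 ^ (4 ^ d) := by gcongr
      _ = _ := by rw [← Real.exp_nat_mul]; push_cast; rw [mul_one]
  rw [Real.exp_neg, ← div_eq_mul_inv, div_le_iff₀ (Real.exp_pos _), one_div, inv_pow,
    ← div_eq_inv_mul, le_div_iff₀ (by positivity), ← pow_add]
  exact h3

theorem mul_two_pow_sub_le {d e : ℕ} (h : d ≤ e) : d * 2 ^ (e - d) ≤ 2 ^ e := by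
  calc d * 2 ^ (e - d) ≤ 2 ^ d * 2 ^ (e - d) := Nat.mul_le_mul_right _ Nat.lt_two_pow_self.le
    _ = 2 ^ e := by rw [← pow_add]; congr 1; omega

/-- A function of `b`, `r` and `N ≤ 2 ^ (q b)` that is at most exponential in `b r`. -/
def ExpBounded (q : ℕ) (f : ℕ → ℕ → ℕ → ℕ) : Prop :=
  ∃ A, ∀ b r N, 1 ≤ b → 1 ≤ r → N ≤ 2 ^ (q * b) → f b r N ≤ 2 ^ (A * (b * r))

/-! ### Closure properties, leading to a bound `2^(A * b * r)` for the time up to stage `r` -/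

namespace ExpBounded

variable {q : ℕ} {f g : ℕ → ℕ → ℕ → ℕ}

theorem const (c : ℕ) : ExpBounded q fun _ _ _ => c := by
  refine ⟨c, fun b r N hb hr _ => Nat.lt_two_pow_self.le.trans ?_⟩
  exact Nat.pow_le_pow_right (by norm_num) (Nat.le_mul_of_pos_right c (Nat.mul_pos hb hr))

theorem add (hf : ExpBounded q f) (hg : ExpBounded q g) :
    ExpBounded q fun b r N => f b r N + g b r N := by
  obtain ⟨A, hA⟩ := hf
  obtain ⟨C, hC⟩ := hg
  refine ⟨A + C + 1, fun b r N hb hr hN => ?_⟩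
  have h1 : 1 ≤ b * r := Nat.mul_pos hb hr
  calc f b r N + g b r N ≤ 2 ^ (A * (b * r)) + 2 ^ (C * (b * r)) :=
        add_le_add (hA b r N hb hr hN) (hC b r N hb hr hN)
    _ ≤ 2 ^ (A * (b * r) + C * (b * r)) + 2 ^ (A * (b * r) + C * (b * r)) :=
        add_le_add (Nat.pow_le_pow_right (by norm_num) (by omega))
          (Nat.pow_le_pow_right (by norm_num) (by omega))
    _ = 2 ^ (A * (b * r) + C * (b * r) + 1) := by ring
    _ ≤ _ := Nat.pow_le_pow_right (by norm_num) (by rw [add_mul, add_mul]; omega)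

theorem mul (hf : ExpBounded q f) (hg : ExpBounded q g) :
    ExpBounded q fun b r N => f b r N * g b r N := by
  obtain ⟨A, hA⟩ := hf
  obtain ⟨C, hC⟩ := hg
  refine ⟨A + C, fun b r N hb hr hN => ?_⟩
  rw [add_mul, pow_add]
  exact Nat.mul_le_mul (hA b r N hb hr hN) (hC b r N hb hr hN)

theorem mono (hf : ExpBounded q f) (h : ∀ b r N, g b r N ≤ f b r N) : ExpBounded q g := by
  obtain ⟨A, hA⟩ := hf
  exact ⟨A, fun b r N hb hr hN => (h b r N).trans (hA b r N hb hr hN)⟩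

theorem pow (hf : ExpBounded q f) (k : ℕ) : ExpBounded q fun b r N => f b r N ^ k := by
  induction k with
  | zero => simpa using const 1
  | succ k ih => simpa [pow_succ] using ih.mul hf

theorem eval (T : Polynomial ℕ) (hf : ExpBounded q f) :
    ExpBounded q fun b r N => T.eval (f b r N) := by
  induction T using Polynomial.induction_on' with
  | add p p' hp hp' => simpa using hp.add hp'
  | monomial k a => simpa using (const a).mul (hf.pow k)

theorem vertices : ExpBounded q fun _ _ N => N :=
  ⟨q, fun b r N _ hr hN => hN.trans (Nat.pow_le_pow_right (by norm_num)
    (Nat.mul_le_mul_left q (Nat.le_mul_of_pos_right b hr)))⟩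

theorem fst : ExpBounded q fun b _ _ => b :=
  ⟨1, fun b r _ _ hr _ => Nat.lt_two_pow_self.le.trans (Nat.pow_le_pow_right (by norm_num)
    (by rw [one_mul]; exact Nat.le_mul_of_pos_right b hr))⟩

theorem snd : ExpBounded q fun _ r _ => r :=
  ⟨1, fun b r _ hb _ _ => Nat.lt_two_pow_self.le.trans (Nat.pow_le_pow_right (by norm_num)
    (by rw [one_mul]; exact Nat.le_mul_of_pos_left r hb))⟩

theorem cols : ExpBounded q fun b r _ => RAM.cols q b r := by
  refine ⟨8 * q + 8, fun b r _ hb _ _ => Nat.pow_le_pow_right (by norm_num) ?_⟩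
  calc r * width q b ≤ r * ((8 * q + 8) * b) := by
        refine Nat.mul_le_mul_left r ?_
        unfold width
        have : (8 * q - 5) * b ≤ 8 * q * b := Nat.mul_le_mul_right b (by omega)
        rw [add_mul]
        omega
    _ = _ := by ring

theorem sizes : ExpBounded q fun b _ N => RAM.sizes b N :=
  vertices.mono fun b _ N => by
    have : 0 < 2 ^ (b - 1) := by positivity
    unfold RAM.sizes
    omega

theorem entryTime {v l n : ℕ → ℕ → ℕ → ℕ} (hv : ExpBounded q v) (hl : ExpBounded q l)
    (hn : ExpBounded q n) :
    ExpBounded q fun b r N => RAM.entryTime (v b r N) (l b r N) (n b r N) :=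
  (((const 3).add (hl.mul (((const 3).add (hl.mul ((((const 5).mul hv).add (const 34)).add
    (const 4)))).add (const 4)))).add ((const 15).mul hn)).add (const 30)

theorem matrixTime {v l n : ℕ → ℕ → ℕ → ℕ} (hv : ExpBounded q v) (hl : ExpBounded q l)
    (hn : ExpBounded q n) :
    ExpBounded q fun b r N => RAM.matrixTime (v b r N) (l b r N) (n b r N) :=
  (const 3).add (((const 2).mul hn).mul (((const 3).add (hn.mul (((entryTime hv hl hn).add
    (const 3)).add (const 4)))).add (const 4)))

theorem writeTime {v l n B : ℕ → ℕ → ℕ → ℕ} (hv : ExpBounded q v) (hl : ExpBounded q l)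
    (hn : ExpBounded q n) (hB : ExpBounded q B) :
    ExpBounded q fun b r N => RAM.writeTime (v b r N) (l b r N) (n b r N) (B b r N) :=
  ((const 4).add ((const 3).add (((const 2).mul hn).mul (((const 3).add (hl.mul ((((const 4).add
    (hB.mul (const 7))).add (const 3)).add (const 4)))).add (const 4))))).add (matrixTime hv hl hn)

theorem evalTime (P : Prog) (T : Polynomial ℕ) {n : ℕ → ℕ → ℕ → ℕ} (hn : ExpBounded q n) :
    ExpBounded q fun b r N => RAM.evalTime P T (n b r N) r :=
  ((((((const P.bound).add (const 3)).add (const 3)).add ((const 6).mul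
    (eval T (((const 2).mul hn).mul hn)))).add (const 1)).add ((const 3).add
      (snd.mul (const 5)))).add (const 4)

theorem runTimeBound (P : Prog) (T : Polynomial ℕ) {v l n B : ℕ → ℕ → ℕ → ℕ}
    (hv : ExpBounded q v) (hl : ExpBounded q l) (hn : ExpBounded q n) (hB : ExpBounded q B) :
    ExpBounded q fun b r N => RAM.runTimeBound P T (v b r N) (l b r N) (n b r N) (B b r N) r :=
  (writeTime hv hl hn hB).add (evalTime P T hn)

theorem testTime (P : Prog) (T : Polynomial ℕ) {v l n B : ℕ → ℕ → ℕ → ℕ}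
    (hv : ExpBounded q v) (hl : ExpBounded q l) (hn : ExpBounded q n) (hB : ExpBounded q B) :
    ExpBounded q fun b r N => RAM.testTime P T (v b r N) (l b r N) (n b r N) (B b r N) r :=
  (((const 3).add ((const 3).add (hv.mul (((const 3).add (hv.mul (const (13 + 4)))).add
    (const 4))))).add (runTimeBound P T hv hl hn hB)).add (const 3)

theorem width : ExpBounded q fun b _ _ => RAM.width q b :=
  ((const (8 * q - 5)).mul fst).add (const 8)

theorem stageTime (P : Prog) (T : Polynomial ℕ) :
    ExpBounded q fun b r N => RAM.stageTime P T q b N r := by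
  have hl : ExpBounded q fun _ r _ => 8 * r := (const 8).mul snd
  have hB : ExpBounded q fun b _ _ => q * b := (const q).mul fst
  exact (((((const 2).add ((const 8).add (snd.mul (((const 3).add (width.mul (const 5))).add
    (const 4))))).add ((const 4).add (sizes.mul (((const 3).add (vertices.mul
      ((testTime P T vertices hl cols hB).add (const 4)))).add (const 4))))).add (const 3)).add
        (runTimeBound P T vertices hl cols hB)).add (const 5)

theorem total (P : Prog) (T : Polynomial ℕ) : ExpBounded q fun b r N =>
    setupTime q N + r * (RAM.stageTime P T q b N r + 1) + 3 :=
  (((((vertices.mul (const (q + 20))).add (const (4 * q ^ 2))).add (const (10 * q))).add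
    (const 40)).add (snd.mul ((stageTime P T).add (const 1)))).add (const 3)

end ExpBounded


/-- Since `log(2n²) ≤ 33q * br`, a small constant in the little-o bound forces a value `v ≥
j(4q²+3)` from a dimension of at least `br`. Then `r * v ≥ (4q²+3) * jr ≥ (4q²+3)b`, just above the
threshold. -/
theorem eventually_thr_lt_mul {α : ℕ → ℝ} (hα : α =o[atTop] (fun n : ℕ => Real.log n))
    {q j : ℕ} (hq : 1 ≤ q) (hj : 1 ≤ j) :
    ∀ᶠ b in atTop, ∀ r d v : ℕ, 1 ≤ r → b ≤ j * r → b * r ≤ d →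
      (d : ℝ) ≤ α (2 * cols q b r * cols q b r) * v → thr q b < r * v := by
  have hq0 : (0 : ℝ) < q := by exact_mod_cast hq
  have hj0 : (0 : ℝ) < j := by exact_mod_cast hj
  -- The factor `33q` cancels the bound for the logarithm of the matrix size, and `j(4q²+3)` is the
  -- value of `v` that is needed.
  obtain ⟨n₀, hn₀⟩ := eventually_atTop.1 (hα.bound
    (show (0 : ℝ) < 1 / (33 * q * (j * (4 * q ^ 2 + 3))) by positivity))
  filter_upwards [eventually_ge_atTop n₀, eventually_ge_atTop 1] with b hbn hb r d v hr hbr hd hv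
  set n := cols q b r with hn
  have hbr1 : 1 ≤ b * r := Nat.mul_pos hb hr
  -- The matrix size is at least `b` for every `r`, so one threshold for `b` serves all stages.
  have hbcols : b ≤ n := by
    calc b ≤ b * r := Nat.le_mul_of_pos_right b hr
      _ ≤ 2 ^ (b * r) := Nat.lt_two_pow_self.le
      _ ≤ _ := Nat.pow_le_pow_right (by norm_num) (width_mul_eq hq hb r).1
  have hsq : b ≤ 2 * n * n := hbcols.trans (Nat.le_mul_of_pos_left n (by omega))
  have hlog : Real.log (2 * n * n : ℕ) ≤ 33 * q * (b * r) := by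
    have h1 : 2 * n * n = 2 ^ (1 + 2 * (r * width q b)) := by rw [hn, cols]; ring
    have h2 : 1 + 2 * (r * width q b) ≤ 33 * q * (b * r) := by
      have h3 := mul_width_le hq hb r
      have h4 : 1 ≤ q * (b * r) := Nat.mul_pos hq hbr1
      rw [mul_assoc] at h3 ⊢
      omega
    rw [h1, Nat.cast_pow, Real.log_pow]
    have h5 : Real.log (2 : ℕ) ≤ 1 := by
      have := Real.log_le_sub_one_of_pos (show (0 : ℝ) < (2 : ℕ) by norm_num)
      norm_num at this ⊢
      exact this
    calc ((1 + 2 * (r * width q b) : ℕ) : ℝ) * Real.log (2 : ℕ)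
        ≤ ((1 + 2 * (r * width q b) : ℕ) : ℝ) * 1 := by gcongr
      _ ≤ _ := by rw [mul_one]; exact_mod_cast h2
  have hαn : α (2 * n * n) ≤ 1 / (33 * q * (j * (4 * q ^ 2 + 3))) * (33 * q * (b * r)) := by
    refine (le_abs_self _).trans ((hn₀ _ (hbn.trans hsq)).trans ?_)
    rw [Real.norm_of_nonneg (Real.log_natCast_nonneg _)]
    gcongr
  have h1 : (b * r : ℝ) ≤
      1 / (33 * q * (j * (4 * q ^ 2 + 3))) * (33 * q * (b * r)) * v := by
    calc (b * r : ℝ) ≤ d := by exact_mod_cast hd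
      _ ≤ α (2 * n * n) * v := hv
      _ ≤ _ := by gcongr
  have h2 : (b * r : ℝ) * (j * (4 * q ^ 2 + 3)) ≤ b * r * v := by
    have h3 : 1 / (33 * q * (j * (4 * q ^ 2 + 3))) * (33 * q * (b * r)) * v =
        (b * r * v : ℝ) / (j * (4 * q ^ 2 + 3)) := by field_simp
    rwa [h3, le_div_iff₀ (by positivity)] at h1
  have h3 : j * (4 * q ^ 2 + 3) ≤ v :=
    Nat.le_of_mul_le_mul_left (by exact_mod_cast h2) hbr1
  calc thr q b = (4 * q ^ 2 + 2) * b := rfl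
    _ < (4 * q ^ 2 + 3) * b := Nat.mul_lt_mul_of_pos_right (by omega) hb
    _ ≤ (4 * q ^ 2 + 3) * (j * r) := Nat.mul_le_mul_left _ hbr
    _ = r * (j * (4 * q ^ 2 + 3)) := by ring
    _ ≤ r * v := Nat.mul_le_mul_left r h3

/-- The failure probability of a single test is of order `exp(-4^(br))`. This outweighs both the
number of tests, at most `2^(2qb)`, and the factor `2^(A b²)`, which stands for the time of all `b`
stages. -/
theorem eventually_coinLaw_real_not_passes_le {val : ∀ m k : ℕ, (Fin m → Fin k → Bool) → ℕ}
    {α : ℕ → ℝ} (hα : α =o[atTop] (fun n : ℕ => Real.log n))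
    (hval : ∀ (m k : ℕ) (M : Fin m → Fin k → Bool), 0 < m → 0 < k →
      Function.Injective (Learning.concept M) →
        ((Learning.conceptClass M).vcDim : ℝ) ≤ α (m * k) * val m k M)
    {q j : ℕ} (hq : 1 ≤ q) (hj : 1 ≤ j) (A : ℕ) :
    ∀ᶠ b in atTop, ∀ N i : ℕ, N ≤ 2 ^ (q * b) → b ≤ j * (i + 1) →
      2 ^ (A * b ^ 2) * coinLaw.real {ω | ¬ Passes val q b N i ω} ≤ (1 / 2) ^ b := by
  filter_upwards [eventually_thr_lt_mul hα hq hj, eventually_ge_atTop (A + 21 * q + 4)]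
    with b hthr hb N i hN hi
  have hb1 : 1 ≤ b := by omega
  have hr : 1 ≤ i + 1 := by omega
  set d := b * (i + 1) with hd
  have hbd : b ≤ d := Nat.le_mul_of_pos_right b hr
  set c : ℝ := 2 ^ (19 * q * d ^ 2) * Real.exp (-4 ^ d) with hc
  have hc0 : 0 ≤ c := by positivity
  have h1 : coinLaw.real {ω | ¬ Passes val q b N i ω} ≤ sizes b N * (N * c) := by
    refine coinLaw_real_not_passes_le fun κ hκ1 hκ2 => ?_
    refine (one_sub_plantedSuccess_le (d := d) (n₀ := 2 ^ ((i + 1) * width q b - d))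
      ?_ hN ?_ hκ2).trans (failBound_le hq hb1 hr ?_ ?_)
    · intro M hM hMd
      exact hthr (i + 1) _ _ hr hi hMd
        (hval _ _ M (Nat.mul_pos two_pos (cols_pos _ _ _)) (cols_pos _ _ _) hM)
    · exact mul_two_pow_sub_le (width_mul_eq hq hb1 (i + 1)).1
    · gcongr
      exact_mod_cast hκ1
    · rw [div_le_one (by positivity)]
      exact_mod_cast hκ2.trans hN
  have h2 : (sizes b N : ℝ) ≤ 2 ^ (q * b) := by
    have h3 : 0 < 2 ^ (b - 1) := by positivity
    have h4 : sizes b N ≤ 2 ^ (q * b) := by unfold sizes; omega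
    exact_mod_cast h4
  have h3 : (N : ℝ) ≤ 2 ^ (q * b) := by exact_mod_cast hN
  have h4 : A * b ^ 2 + (q * b + q * b) + 19 * q * d ^ 2 ≤ (A + 21 * q) * d ^ 2 := by
    have h5 : A * b ^ 2 ≤ A * d ^ 2 := Nat.mul_le_mul_left A (Nat.pow_le_pow_left hbd 2)
    have h6 : q * b ≤ q * d ^ 2 :=
      Nat.mul_le_mul_left q (hbd.trans (Nat.le_self_pow (by norm_num) d))
    calc A * b ^ 2 + (q * b + q * b) + 19 * q * d ^ 2
        ≤ A * d ^ 2 + (q * d ^ 2 + q * d ^ 2) + 19 * q * d ^ 2 := by omega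
      _ = _ := by ring
  calc 2 ^ (A * b ^ 2) * coinLaw.real {ω | ¬ Passes val q b N i ω}
      ≤ 2 ^ (A * b ^ 2) * (2 ^ (q * b) * (2 ^ (q * b) * c)) := by
        gcongr
        exact h1.trans (by gcongr)
    _ = 2 ^ (A * b ^ 2 + (q * b + q * b) + 19 * q * d ^ 2) * Real.exp (-4 ^ d) := by
        rw [hc, pow_add, pow_add, pow_add]
        ring
    _ ≤ 2 ^ ((A + 21 * q) * d ^ 2) * Real.exp (-4 ^ d) := by
        gcongr
        norm_num
    _ ≤ (1 / 2) ^ d := two_pow_mul_exp_neg_le (by omega)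
    _ ≤ _ := pow_le_pow_of_le_one (by norm_num) (by norm_num) hbd

theorem eventually_pow_le_two_pow (q : ℕ) :
    ∀ᶠ b : ℕ in atTop, 2 ^ 9 * (6 * q * b) ^ 8 ≤ 2 ^ b := by
  have h := tendsto_pow_const_div_const_pow_of_one_lt 8 (show (1 : ℝ) < 2 by norm_num)
  have h0 : (0 : ℝ) < 1 / (2 ^ 9 * (6 * q) ^ 8 + 1) := by positivity
  filter_upwards [h.eventually (ge_mem_nhds h0)] with b hb
  rw [div_le_div_iff₀ (by positivity) (by positivity), one_mul] at hb
  have h1 : ((2 ^ 9 * (6 * q * b) ^ 8 : ℕ) : ℝ) ≤ ((2 ^ b : ℕ) : ℝ) := by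
    push_cast
    refine le_trans ?_ hb
    calc _ = (b : ℝ) ^ 8 * (2 ^ 9 * (6 * q) ^ 8) := by ring
      _ ≤ _ := mul_le_mul_of_nonneg_left (le_add_of_nonneg_right zero_le_one) (by positivity)
  exact_mod_cast h1

theorem tendsto_clog_atTop {a : ℕ} (ha : 1 < a) : Tendsto (Nat.clog a) atTop atTop :=
  tendsto_atTop_atTop.2 fun c => ⟨a ^ c + 1, fun N hN => by
    by_contra h
    have := (Nat.clog_le_iff_le_pow ha).1 (show Nat.clog a N ≤ c by omega)
    omega⟩

theorem le_pow_mul_clog {q : ℕ} (hq : 1 ≤ q) (N : ℕ) : N ≤ 2 ^ (q * Nat.clog (2 ^ q) N) := by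
  rw [pow_mul]
  exact Nat.le_pow_clog (Nat.one_lt_two_pow (by omega)) N

theorem pow_mul_clog_sub_one_lt {q N : ℕ} (hq : 1 ≤ q) (hN : 2 ≤ N) :
    2 ^ (q * (Nat.clog (2 ^ q) N - 1)) < N := by
  rw [pow_mul]
  exact Nat.pow_pred_clog_lt_self (Nat.one_lt_two_pow (by omega)) (by omega)


/-- By minimality of `b` one has `2^(q(b-1)) < N`; now raise to the power `δ` and use `qδ ≥ 1`. -/
theorem two_pow_clog_sub_one_le_ceil {q N : ℕ} {δ : ℝ} (hq : 1 ≤ q) (hδ : 1 ≤ q * δ)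
    (hδ0 : 0 ≤ δ) (hN : 2 ≤ N) : 2 ^ (Nat.clog (2 ^ q) N - 1) ≤ ⌈(N : ℝ) ^ δ⌉₊ := by
  set a := Nat.clog (2 ^ q) N - 1 with ha
  have h1 : ((2 : ℝ) ^ a) ^ q ≤ N := by
    rw [← pow_mul, mul_comm]
    exact_mod_cast (pow_mul_clog_sub_one_lt hq hN).le
  have h2 : (2 : ℝ) ^ a ≤ (N : ℝ) ^ δ := by
    calc (2 : ℝ) ^ a = ((2 : ℝ) ^ a) ^ (1 : ℝ) := (Real.rpow_one _).symm
      _ ≤ ((2 : ℝ) ^ a) ^ (q * δ) :=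
        Real.rpow_le_rpow_of_exponent_le (one_le_pow₀ (by norm_num)) hδ
      _ = (((2 : ℝ) ^ a) ^ q) ^ δ := by rw [Real.rpow_mul (by positivity), Real.rpow_natCast]
      _ ≤ _ := Real.rpow_le_rpow (by positivity) h1 hδ0
  exact_mod_cast h2.trans (Nat.le_ceil _)

theorem ceil_rpow_le {N : ℕ} {δ : ℝ} (hδ1 : δ ≤ 1) (hN : 1 ≤ N) : ⌈(N : ℝ) ^ δ⌉₊ ≤ N := by
  refine Nat.ceil_le.2 ?_
  calc (N : ℝ) ^ δ ≤ (N : ℝ) ^ (1 : ℝ) :=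
        Real.rpow_le_rpow_of_exponent_le (by exact_mod_cast hN) hδ1
    _ = N := Real.rpow_one _

/-- A family of times that are at most `N ^ (ε log N)` for every `ε > 0` and all large `N` is
bounded by `N ^ o(log N)`. -/
theorem exists_isLittleO_exponent {τ : ∀ N : ℕ, SimpleGraph (Fin N) → ℝ≥0∞}
    (h : ∀ ε : ℝ, 0 < ε → ∀ᶠ N : ℕ in atTop, ∀ G,
      τ N G ≤ ENNReal.ofReal ((N : ℝ) ^ (ε * Real.log N))) :
    ∃ f : ℕ → ℝ, f =o[atTop] (fun N : ℕ => Real.log N) ∧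
      ∀ᶠ N : ℕ in atTop, ∀ G, τ N G ≤ ENNReal.ofReal ((N : ℝ) ^ f N) := by
  -- The worst case over all graphs, kept at least `1` so that its logarithm is nonnegative; the
  -- exponent is chosen such that `N^f(N)` equals it.
  set S : ℕ → ℝ := fun N => max 1 (⨆ G, (τ N G).toReal) with hS
  have hS1 : ∀ N, 1 ≤ S N := fun N => le_max_left _ _
  refine ⟨fun N => Real.log (S N) / Real.log N, ?_, ?_⟩
  · refine isLittleO_iff.2 fun c hc => ?_
    filter_upwards [h c hc, eventually_ge_atTop 2] with N hN hN2
    have hN0 : (0 : ℝ) < N := by exact_mod_cast (by omega : 0 < N)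
    have hlog : 0 < Real.log N := Real.log_pos (by exact_mod_cast (by omega : 1 < N))
    have hexp : (N : ℝ) ^ (c * Real.log N) = Real.exp (c * Real.log N * Real.log N) := by
      rw [Real.rpow_def_of_pos hN0, mul_comm]
    have h1 : S N ≤ Real.exp (c * Real.log N * Real.log N) := by
      refine max_le (Real.one_le_exp (by positivity)) (ciSup_le fun G => ?_)
      rw [← hexp]
      exact ENNReal.toReal_le_of_le_ofReal (by positivity) (hN G)
    have h2 : Real.log (S N) ≤ c * Real.log N * Real.log N :=
      (Real.log_le_iff_le_exp (zero_lt_one.trans_le (hS1 N))).2 h1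
    rw [Real.norm_of_nonneg (div_nonneg (Real.log_nonneg (hS1 N)) hlog.le),
      Real.norm_of_nonneg hlog.le, div_le_iff₀ hlog]
    exact h2
  · filter_upwards [h 1 one_pos, eventually_ge_atTop 2] with N hN hN2 G
    have hN0 : (0 : ℝ) < N := by exact_mod_cast (by omega : 0 < N)
    have hlog : 0 < Real.log N := Real.log_pos (by exact_mod_cast (by omega : 1 < N))
    have hexp : (N : ℝ) ^ (Real.log (S N) / Real.log N) = S N := by
      rw [Real.rpow_def_of_pos hN0, mul_div_cancel₀ _ hlog.ne',
        Real.exp_log (zero_lt_one.trans_le (hS1 N))]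
    rw [hexp, ← ENNReal.ofReal_toReal (ne_top_of_le_ne_top ENNReal.ofReal_ne_top (hN G))]
    refine ENNReal.ofReal_le_ofReal (le_max_of_le_right ?_)
    exact le_ciSup (f := fun G => (τ N G).toReal) (Set.finite_range _).bddAbove G

/-- Here `b ≤ 4 log N` and `b/j + 1 ≤ 2b/j`, so the exponent is at most `4 * 2 * 4 * A (log N)² /
j`. This is the origin of `32`. -/
theorem two_pow_le_rpow_log {q b j A N : ℕ} {ε : ℝ} (hq : 1 ≤ q) (hj : 1 ≤ j) (hb : 2 ≤ b)
    (hjb : j ≤ b) (hN : 2 ^ (q * (b - 1)) ≤ N) (hε : 32 * A ≤ ε * j) :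
    (2 : ℝ) ^ (A * (b * (b / j + 1))) ≤ (N : ℝ) ^ (ε * Real.log N) := by
  have hj0 : (0 : ℝ) < j := by exact_mod_cast hj
  have hN0 : 0 < N := lt_of_lt_of_le (by positivity) hN
  have h2 : Real.log 2 ≤ 1 := by
    have := Real.log_le_sub_one_of_pos (show (0 : ℝ) < 2 by norm_num)
    linarith
  have h3 : (1 / 2 : ℝ) ≤ Real.log 2 := by
    have := Real.one_sub_inv_le_log_of_pos (show (0 : ℝ) < 2 by norm_num)
    norm_num at this ⊢
    exact this
  set L := Real.log N with hL
  have h4 : (b : ℝ) ≤ 4 * L := by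
    have h5 : ((2 ^ (q * (b - 1)) : ℕ) : ℝ) ≤ N := by exact_mod_cast hN
    have h6 := Real.log_le_log (by positivity) h5
    rw [Nat.cast_pow, Real.log_pow] at h6
    have h7 : (b : ℝ) / 2 ≤ ((q * (b - 1) : ℕ) : ℝ) := by
      rw [div_le_iff₀ two_pos]
      have h8 : b ≤ (b - 1) * 2 := by omega
      have h9 : b - 1 ≤ q * (b - 1) := Nat.le_mul_of_pos_left _ hq
      exact_mod_cast h8.trans (Nat.mul_le_mul_right 2 h9)
    have h10 : (b : ℝ) / 2 * (1 / 2) ≤ ((q * (b - 1) : ℕ) : ℝ) * Real.log (2 : ℕ) := by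
      push_cast at h7 ⊢
      gcongr
    have h11 : (b : ℝ) / 2 * (1 / 2) ≤ L := h10.trans h6
    linarith
  have h5 : ((b / j + 1 : ℕ) : ℝ) ≤ 2 * b / j := by
    rw [le_div_iff₀ hj0]
    have h6 : (b / j + 1) * j ≤ 2 * b := by
      have := Nat.div_mul_le_self b j
      rw [add_mul]
      omega
    exact_mod_cast h6
  have hL0 : 0 ≤ L := by
    have : (0 : ℝ) ≤ b := Nat.cast_nonneg b
    linarith
  have h6 : ((A * (b * (b / j + 1)) : ℕ) : ℝ) ≤ ε * L * L := by
    rw [Nat.cast_mul, Nat.cast_mul]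
    calc (A : ℝ) * (b * ((b / j + 1 : ℕ) : ℝ)) ≤ A * ((4 * L) * (2 * (4 * L) / j)) := by
          have h7 : (2 * b / j : ℝ) ≤ 2 * (4 * L) / j := by gcongr
          gcongr
          exact h5.trans h7
      _ = 32 * A / j * (L * L) := by ring
      _ ≤ ε * (L * L) := by
          gcongr
          rwa [div_le_iff₀ hj0]
      _ = _ := by ring
  rw [Real.rpow_def_of_pos (by exact_mod_cast hN0), ← Real.rpow_natCast,
    Real.rpow_def_of_pos two_pos, Real.exp_le_exp, ← hL]
  calc Real.log 2 * ((A * (b * (b / j + 1)) : ℕ) : ℝ) ≤ 1 * (ε * L * L) := by gcongr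
    _ = _ := by ring

/-- For given `ε` the analysis, not the program, chooses a large `j` and looks at stage `⌊b/j⌋ + 1`.
Reaching it takes time `2^(O(b²/j))`, and the later stages contribute less than `1` to the
expectation. -/
theorem eventually_expectedTime_le {P : Prog} {T : Polynomial ℕ}
    {val : ∀ m k : ℕ, (Fin m → Fin k → Bool) → ℕ} (hP : Computes P T val)
    {α : ℕ → ℝ} (hα : α =o[atTop] (fun n : ℕ => Real.log n))
    (hval : ∀ (m k : ℕ) (M : Fin m → Fin k → Bool), 0 < m → 0 < k →
      Function.Injective (Learning.concept M) →
        ((Learning.conceptClass M).vcDim : ℝ) ≤ α (m * k) * val m k M)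
    {q : ℕ} (hq : 1 ≤ q) {ε : ℝ} (hε : 0 < ε) :
    ∀ᶠ N : ℕ in atTop, ∀ G : SimpleGraph (Fin N),
      expectedTime (distinguisher q P) (PlantedClique.graphInput G) ≤
        ENNReal.ofReal ((N : ℝ) ^ (ε * Real.log N)) := by
  obtain ⟨A, hA⟩ := ExpBounded.total (q := q) P T
  -- `A + 1` instead of `A` leaves room for the factor `2` from adding the contribution of the later
  -- stages.
  obtain ⟨j, hj⟩ := exists_nat_gt (max 1 (32 * (A + 1 : ℕ) / ε))
  have hj1 : 2 ≤ j := by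
    have : 1 < j := by exact_mod_cast (le_max_left _ _).trans_lt hj
    omega
  have hj2 : 32 * (A + 1 : ℕ) ≤ ε * j := by
    rw [← div_le_iff₀' hε]
    exact ((le_max_right _ _).trans_lt hj).le
  have hclog := tendsto_clog_atTop (Nat.one_lt_two_pow (show q ≠ 0 by omega))
  filter_upwards [hclog.eventually (eventually_coinLaw_real_not_passes_le hα hval hq
    (show 1 ≤ j by omega) A), hclog.eventually (eventually_ge_atTop j), eventually_ge_atTop 2]
    with N hpass hb hN2 G
  set b := Nat.clog (2 ^ q) N with hbdef
  have hi₀ : b / j < b := Nat.div_lt_self (by omega) (by omega)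
  have hN := le_pow_mul_clog hq N
  have hprob := hpass N (b / j) hN (Nat.lt_mul_div_succ b (by omega)).le
  refine (expectedTime_le hP hq hN2 hbdef hi₀ G).trans (ENNReal.ofReal_le_ofReal ?_)
  refine le_trans ?_ (two_pow_le_rpow_log hq (by omega) (by omega) hb
    (pow_mul_clog_sub_one_lt hq hN2).le hj2)
  set r := b / j + 1 with hr
  have h1 : ((setupTime q N + r * (stageTime P T q b N r + 1) + 3 : ℕ) : ℝ) ≤
      2 ^ (A * (b * r)) := by exact_mod_cast hA b r N (by omega) (Nat.succ_pos _) hN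
  have h2 : ((setupTime q N + b * (stageTime P T q b N b + 1) + 3 : ℕ) : ℝ) ≤
      2 ^ (A * b ^ 2) := by
    rw [pow_two]
    exact_mod_cast hA b b N (by omega) (by omega) hN
  have h3 : (1 / 2 : ℝ) ^ b ≤ 1 := pow_le_one₀ (by norm_num) (by norm_num)
  have h4 : (1 : ℝ) ≤ 2 ^ (A * (b * r)) := one_le_pow₀ (by norm_num)
  calc _ ≤ (2 : ℝ) ^ (A * (b * r)) +
        2 ^ (A * b ^ 2) * coinLaw.real {ω | ¬ Passes val q b N (b / j) ω} := by gcongr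
    _ ≤ 2 ^ (A * (b * r)) * 2 := by linarith
    _ = 2 ^ (A * (b * r) + 1) := (pow_succ _ _).symm
    _ ≤ _ := by
      refine pow_le_pow_right₀ (by norm_num) ?_
      have : 1 ≤ b * r := Nat.mul_pos (by omega) (Nat.succ_pos _)
      rw [add_mul]
      omega

/-- For correctness it suffices that the last stage, `r = b`, is likely to pass, which is the case
`j = 1`. The error is then at most `1/6 + 1/8 < 1/3`. -/
theorem eventually_lintegral_planted_ge {P : Prog} {T : Polynomial ℕ}
    {val : ∀ m k : ℕ, (Fin m → Fin k → Bool) → ℕ} (hP : Computes P T val)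
    {α : ℕ → ℝ} (hα : α =o[atTop] (fun n : ℕ => Real.log n))
    (hval : ∀ (m k : ℕ) (M : Fin m → Fin k → Bool), 0 < m → 0 < k →
      Function.Injective (Learning.concept M) →
        ((Learning.conceptClass M).vcDim : ℝ) ≤ α (m * k) * val m k M)
    {q : ℕ} (hq : 1 ≤ q) {δ : ℝ} (hδ0 : 0 ≤ δ) (hδ1 : δ ≤ 1) (hδ : 1 ≤ q * δ) :
    ∀ᶠ N : ℕ in atTop, 2 / 3 ≤ ∫⁻ G, acceptProb (distinguisher q P)
      (PlantedClique.graphInput G) ∂PlantedClique.planted N ⌈(N : ℝ) ^ δ⌉₊ := by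
  have hclog := tendsto_clog_atTop (Nat.one_lt_two_pow (show q ≠ 0 by omega))
  filter_upwards [hclog.eventually (eventually_coinLaw_real_not_passes_le hα hval hq
    le_rfl 0), hclog.eventually (eventually_pow_le_two_pow q),
    hclog.eventually (eventually_ge_atTop 3), eventually_ge_atTop 2] with N hpass hpow hb hN2
  set b := Nat.clog (2 ^ q) N with hbdef
  have hN := le_pow_mul_clog hq N
  have hprob := hpass N (b - 1) hN (by omega)
  have h1 : 6 * b ≤ N := by
    have h2 : 2 * (6 * q * b) ≤ 2 ^ b := le_trans (Nat.mul_le_mul (by norm_num)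
      (Nat.le_self_pow (by norm_num) _)) hpow
    have h3 : 2 ^ b = 2 * 2 ^ (b - 1) := by rw [← pow_succ']; congr 1; omega
    have h4 : 2 ^ (b - 1) ≤ 2 ^ (q * (b - 1)) :=
      Nat.pow_le_pow_right (by norm_num) (Nat.le_mul_of_pos_left _ hq)
    have h5 := pow_mul_clog_sub_one_lt hq hN2
    have h6 : 6 * b ≤ 6 * q * b := Nat.mul_le_mul_right b (by omega)
    rw [← hbdef] at h5
    omega
  refine le_trans ?_ (le_lintegral_planted_acceptProb (i₀ := b - 1) hP hq hN2 hbdef (by omega) hN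
    (two_pow_clog_sub_one_le_ceil hq hδ hδ0 hN2) (ceil_rpow_le hδ1 (by omega)))
  have h2 : (b : ℝ) / (N + 1) ≤ 1 / 6 := by
    rw [div_le_div_iff₀ (by positivity) (by norm_num)]
    have : (6 * b : ℝ) ≤ N := by exact_mod_cast h1
    linarith
  have h3 : coinLaw.real {ω | ¬ Passes val q b N (b - 1) ω} ≤ 1 / 8 := by
    rw [zero_mul, pow_zero, one_mul] at hprob
    refine hprob.trans ((pow_le_pow_of_le_one (by norm_num) (by norm_num) hb).trans ?_)
    norm_num
  rw [show (2 / 3 : ℝ≥0∞) = ENNReal.ofReal (2 / 3) by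
    rw [ENNReal.ofReal_div_of_pos (by norm_num)]; norm_num]
  exact ENNReal.ofReal_le_ofReal (by linarith)

theorem eventually_lintegral_null_le {P : Prog} {T : Polynomial ℕ}
    {val : ∀ m k : ℕ, (Fin m → Fin k → Bool) → ℕ} (hP : Computes P T val)
    (hval : ∀ (m k : ℕ) (M : Fin m → Fin k → Bool), 0 < m → 0 < k →
      Function.Injective (Learning.concept M) →
        val m k M ≤ Learning.littlestoneDim (Learning.conceptClass M))
    {q : ℕ} (hq : 1 ≤ q) :
    ∀ᶠ N : ℕ in atTop, ∫⁻ G, acceptProb (distinguisher q P)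
      (PlantedClique.graphInput G) ∂PlantedClique.null N ≤ 1 / 3 := by
  have hclog := tendsto_clog_atTop (Nat.one_lt_two_pow (show q ≠ 0 by omega))
  filter_upwards [hclog.eventually (eventually_pow_le_two_pow q),
    hclog.eventually (eventually_ge_atTop 3), eventually_ge_atTop 2] with N hpow hb hN2
  set b := Nat.clog (2 ^ q) N with hbdef
  have hN := le_pow_mul_clog hq N
  have h2 : 2 * (6 * q * b) ≤ 2 ^ b := le_trans (Nat.mul_le_mul (by norm_num)
    (Nat.le_self_pow (by norm_num) _)) hpow
  have h1 : 2 * (3 * q * b) ≤ N := by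
    have h3 : 2 ^ b = 2 * 2 ^ (b - 1) := by rw [← pow_succ']; congr 1; omega
    have h4 : 2 ^ (b - 1) ≤ 2 ^ (q * (b - 1)) :=
      Nat.pow_le_pow_right (by norm_num) (Nat.le_mul_of_pos_left _ hq)
    have h5 := pow_mul_clog_sub_one_lt hq hN2
    rw [← hbdef] at h5
    have h6 : 2 * (3 * q * b) = 6 * q * b := by ring
    omega
  -- Each stage contributes at most `2 * 2^(-2b)`, obtained with `h = 3qb` and `t = ⌊2q²b/r⌋ + 1`.
  refine (lintegral_null_acceptProb_le hP hq hN2 hbdef (c := 2 * (1 / 2) ^ (2 * b))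
    fun i hi => ?_).trans ?_
  · exact (average_successProb_le hval (cols_pos _ _ _) h1 (Nat.succ_pos _)
      (mul_two_mul_le_thr (q := q) (show i + 1 ≤ b by omega))).trans
        (nullBound_le hq (by omega) hN hpow)
  · rw [show (1 / 3 : ℝ≥0∞) = ENNReal.ofReal (1 / 3) by
      rw [ENNReal.ofReal_div_of_pos (by norm_num)]; norm_num]
    refine ENNReal.ofReal_le_ofReal ?_
    have h3 : (6 * b : ℝ) ≤ 2 ^ b := by
      have : 6 * b ≤ 6 * q * b := Nat.mul_le_mul_right b (by omega)
      exact_mod_cast (by omega : 6 * b ≤ 2 ^ b)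
    have h4 : (2 : ℝ) ^ b ≤ 2 ^ (2 * b) := pow_le_pow_right₀ (by norm_num) (by omega)
    rw [one_div, inv_pow, ← mul_assoc, ← div_eq_mul_inv, div_le_iff₀ (by positivity)]
    linarith

end RAM

/-! ### Hardness of approximating the two dimensions -/

namespace Learning

/-- Planted graphs only need a lower bound by the VC dimension and random graphs only an upper bound
by Littlestone's dimension, so any quantity in between is hard to approximate. -/
theorem not_polyTimeApprox (hSPC : PlantedClique.StrongishHypothesis) {α : ℕ → ℝ}
    (hα : α =o[atTop] (fun n : ℕ => Real.log n)) {dim : ∀ m : ℕ, Finset (Finset (Fin m)) → ℕ}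
    (hd1 : ∀ m (𝒞 : Finset (Finset (Fin m))), 𝒞.vcDim ≤ dim m 𝒞)
    (hd2 : ∀ m (𝒞 : Finset (Finset (Fin m))), dim m 𝒞 ≤ littlestoneDim 𝒞) :
    ¬ ∃ P : RAM.Prog, PolyTimeApprox P dim α := by
  rintro ⟨P, hcf, T, hP⟩
  -- The output is read off from the run whose coins are all `false`, harmless for a coin-free
  -- program. Matrices with repeated columns or an empty side get the dummy value `0`, which is
  -- never used.
  have h : ∀ (m k : ℕ) (M : Fin m → Fin k → Bool), ∃ v : ℕ, 0 < m → 0 < k →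
      Function.Injective (concept M) → (∃ (t : ℕ) (s : RAM.State),
        RAM.Exec (fun _ => false) P (RAM.inputState m k fun x j => M x j = true) t s ∧
        t ≤ T.eval (m * k) ∧ s.reg 0 = v) ∧
        v ≤ littlestoneDim (conceptClass M) ∧
        ((conceptClass M).vcDim : ℝ) ≤ α (m * k) * v := by
    intro m k M
    by_cases hM : 0 < m ∧ 0 < k ∧ Function.Injective (concept M)
    · obtain ⟨t, s, h1, h2, h3, h4⟩ := hP m k M hM.1 hM.2.1 hM.2.2 fun _ => false
      exact ⟨s.reg 0, fun _ _ _ => ⟨⟨t, s, h1, h2, rfl⟩, h3.trans (hd2 _ _),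
        le_trans (by exact_mod_cast hd1 _ _) h4⟩⟩
    · exact ⟨0, fun h1 h2 h3 => absurd ⟨h1, h2, h3⟩ hM⟩
  choose val hval using h
  have hcomp : RAM.Computes P T val :=
    ⟨hcf, fun m k M h1 h2 h3 => (hval m k M h1 h2 h3).1⟩
  have hle : ∀ (m k : ℕ) (M : Fin m → Fin k → Bool), 0 < m → 0 < k →
      Function.Injective (concept M) → val m k M ≤ littlestoneDim (conceptClass M) :=
    fun m k M h1 h2 h3 => (hval m k M h1 h2 h3).2.1
  have hge : ∀ (m k : ℕ) (M : Fin m → Fin k → Bool), 0 < m → 0 < k →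
      Function.Injective (concept M) → ((conceptClass M).vcDim : ℝ) ≤ α (m * k) * val m k M :=
    fun m k M h1 h2 h3 => (hval m k M h1 h2 h3).2.2
  obtain ⟨δ, hδ0, hδ1, hno⟩ := hSPC
  -- The only dependence of the distinguisher on `δ`: the constant `q` is built into the program and
  -- guarantees `2^(b-1) ≤ ⌈N^δ⌉`.
  obtain ⟨q, hq⟩ := exists_nat_gt (1 / δ)
  have hqδ : 1 ≤ q * δ := ((div_lt_iff₀ hδ0).1 hq).le
  have hq1 : 1 ≤ q := by
    have : (0 : ℝ) < q := lt_trans (by positivity) hq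
    exact_mod_cast this
  obtain ⟨f, hf, hfτ⟩ := RAM.exists_isLittleO_exponent
    (τ := fun N G => RAM.expectedTime (RAM.distinguisher q P) (PlantedClique.graphInput G))
    fun ε hε => RAM.eventually_expectedTime_le hcomp hα hge hq1 hε
  refine hno ⟨RAM.distinguisher q P, f, hf, ?_⟩
  filter_upwards [hfτ,
    RAM.eventually_lintegral_planted_ge hcomp hα hge hq1 hδ0.le hδ1.le hqδ,
    RAM.eventually_lintegral_null_le hcomp hle hq1] with N h1 h2 h3
  exact ⟨h1, h2, h3⟩

end Learning

theorem mainTheorem3 (hSPC : PlantedClique.StrongishHypothesis)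
    (α : ℕ → ℝ) (hα : α =o[atTop] (fun n : ℕ => Real.log n)) :
    (¬ ∃ P : RAM.Prog, Learning.PolyTimeApprox P (fun _ 𝒞 => 𝒞.vcDim) α) ∧
    (¬ ∃ P : RAM.Prog, Learning.PolyTimeApprox P (fun _ 𝒞 => Learning.littlestoneDim 𝒞) α) :=
  ⟨Learning.not_polyTimeApprox hSPC hα (fun _ _ => le_rfl)
      fun _ 𝒞 => Learning.vcDim_le_littlestoneDim 𝒞,
    Learning.not_polyTimeApprox hSPC hα (fun _ 𝒞 => Learning.vcDim_le_littlestoneDim 𝒞)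
      fun _ _ => le_rfl⟩
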